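/- Let $\mathbb F\in\{\mathbb R,\mathbb C\}$, let $n\ge 1$, $1\le s<p$ be integers, $K>0$, $\nu\in\mathbb R$, $\lambda>0$. Conventions. $\mathrm{sign}_{\mathbb R}(a)=1$ if $a\ge 0$ and $-1$ if $a<0$; $\mathrm{sign}_{\mathbb C}(z)=\mathrm{sign}_{\mathbb R}(\Re z)+i\,\mathrm{sign}_{\mathbb R}(\Im z)$; both act entrywise on vectors. $\|A\|$ is the $\ell^2$ operator norm, $\|A\|_\infty=\max_{i,j}|A_{ij}|$, and $\lambda_1(A)\ge\lambda_2(A)\ge\cdots$ are the eigenvalues of a Hermitian matrix $A$. With $\|X\|_{\psi_2}=\inf\{t>0:\mathbb E e^{X^2/t^2}\le 2\}$, a square-integrable mean-zero random vector $y\in\mathbb R^p$ is called $K$-subgaussian if $\|\langle y,v\rangle\|_{\psi_2}\le K(\mathbb E\langle y,v\rangle^2)^{1/2}$ for all $v\in\mathbb R^p$; a random vector in $\mathbb C^p$ is $K$-subgaussian if its real and imaginary parts are. For $p\times s$ matrices $U,V$ with orthonormal columns, $\mathrm{dist}(U,V)=\|UU^*-VV^*\|$ (the sine of the largest principal angle between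 the column spaces). Model. Let $y_k=x_k+e_k\in\mathbb F^p$, $k=1,\dots,n$, where $x_1,\dots,x_n,e_1,\dots,e_n$ are independent and - either $x_1,\dots,x_n$ are deterministic and $\Sigma_x:=\frac1n\sum_{k=1}^n x_kx_k^*$, or $x_1,\dots,x_n$ are i.i.d. copies of a $K$-subgaussian vector $x$ and $\Sigma_x:=\mathbb E(xx^*)$; - $e_1,\dots,e_n$ are i.i.d. copies of a $K$-subgaussian vector with uncorrelated mean-zero entries of variance $\nu^2$, such that, if $\mathbb F=\mathbb C$, the real and imaginary parts of each entry are independent. Let $\tau_k,\dot\tau_k$ ($k=1,\dots,n$) be independent of each other and of all the $x_j,e_j$, uniformly distributed on $[-\lambda,\lambda]^p$ if $\mathbb F=\mathbb R$ and on $[-\lambda,\lambda]^p+i[-\lambda,\lambda]^p$ if $\mathbb F=\mathbb C$. Put $q_k=\mathrm{sign}_{\mathbb F}(y_k+\tau_k)$, $\dot q_k=\mathrm{sign}_{\mathbb F}(y_k+\dot\tau_k)$, $$\hat\Sigma'_n=\frac{\lambda^2}{n}\sum_{k=1}^n q_k\dot q_k^*,\qquad \hat\Sigma_n=\tfrac12\hat\Sigma'_n+\tfrac12(\hat\Sigma'_n)^*,$$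 $$C_\infty=\max_{k}\|\mathbb E(y_ky_k^*)\|_\infty,\qquad C_{\rm op}=\max_{k}\|\mathbb E(y_ky_k^*)\|.$$ Theorem. There exist constants $B_K,C_K>0$ depending only on $K$ such that the following holds in the model above whenever $\lambda_s(\Sigma_x)>\lambda_{s+1}(\Sigma_x)$. Let the columns of $U$ and $\hat U_n$ be orthonormal bases of leading $s$-dimensional eigenspaces of $\Sigma_x$ and $\hat\Sigma_n$, respectively. If $n\ge2$ and $\lambda^2\ge B_K\log(n)\,C_\infty$, then for every $t\ge 0$, with probability at least $1-e^{-t}$, $$\mathrm{dist}(\hat U_n,U)\le\min\left\{1,\ \frac{C_K\,\lambda\,(C_{\rm op}^{1/2}+\lambda)}{\lambda_s(\Sigma_x)-\lambda_{s+1}(\Sigma_x)}\sqrt{\frac{p(\log p+t)}{n}}+\frac{C_K\lambda^2}{\lambda_s(\Sigma_x)-\lambda_{s+1}(\Sigma_x)}\cdot\frac{p(\log p+t)}{n}\right\}.$$ Moreover, the same bound holds with probability at least $1-e^{-t}$, for every $n\ge 1$ and without the condition $\lambda^2\ge B_K\log(n)C_\infty$, if the data are bounded by the dithering range, i.e. $\max_i|(y_k)_i|\le\lambda$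 almost surely for every $k$. -/

import Mathlib

open MeasureTheory ProbabilityTheory

/-! Throughout, `𝕜` with `[RCLike 𝕜]` is the field `ℝ` or `ℂ`.  If `𝕜 = ℝ` then `RCLike.I = 0`,
`RCLike.re z = z` and `RCLike.im z = 0`. -/

/-- The real sign function, with value `1` at `0`. -/
noncomputable def signReal (a : ℝ) : ℝ := if 0 ≤ a then 1 else -1

/-- The sign function of `𝕜`: `sign (Re z) + i sign (Im z)` over `ℂ`, and the real sign function
over `ℝ` (where `RCLike.I = 0`). -/
noncomputable def signField {𝕜 : Type*} [RCLike 𝕜] (z : 𝕜) : 𝕜 :=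
  (signReal (RCLike.re z) : 𝕜) + (signReal (RCLike.im z) : 𝕜) * RCLike.I

/-- The uniform distribution on the interval `[-lam, lam]`. -/
noncomputable def uniformInterval (lam : ℝ) : Measure ℝ :=
  ProbabilityTheory.cond (volume : Measure ℝ) (Set.Icc (-lam) lam)

/-- The uniform distribution on `[-lam, lam] ^ p` over `ℝ`, and on
`[-lam, lam] ^ p + i [-lam, lam] ^ p` over `ℂ`. -/
noncomputable def ditherLaw (𝕜 : Type*) [RCLike 𝕜] (p : ℕ) (lam : ℝ) : Measure (Fin p → 𝕜) :=
  ((Measure.pi fun _ : Fin p => uniformInterval lam).prod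
    (Measure.pi fun _ : Fin p => uniformInterval lam)).map
      (fun w i => ((w.1 i : ℝ) : 𝕜) + ((w.2 i : ℝ) : 𝕜) * RCLike.I)

/-- The subgaussian norm `inf {t > 0 : 𝔼 exp (X² / t²) ≤ 2}`, equal to `∞` if there is no
such `t`. -/
noncomputable def psi2Norm {Ω : Type*} [MeasurableSpace Ω] (X : Ω → ℝ) (μ : Measure Ω) : ENNReal :=
  ⨅ (t : ℝ) (_ : 0 < t) (_ : ∫⁻ ω, ENNReal.ofReal (Real.exp (X ω ^ 2 / t ^ 2)) ∂μ ≤ 2),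
    ENNReal.ofReal t

/-- A mean-zero (square integrable) random vector `y` in `ℝ ^ p` is `K`-subgaussian if
`‖⟨y, v⟩‖_{ψ₂} ≤ K ‖⟨y, v⟩‖_{L₂}` for all `v`. -/
structure IsSubgaussianReal {Ω : Type*} [MeasurableSpace Ω] {p : ℕ} (K : ℝ)
    (y : Ω → Fin p → ℝ) (μ : Measure Ω) : Prop where
  memLp : ∀ i, MemLp (fun ω => y ω i) 2 μ
  mean_zero : ∀ i, ∫ ω, y ω i ∂μ = 0
  bound : ∀ v : Fin p → ℝ,
    psi2Norm (fun ω => y ω ⬝ᵥ v) μ ≤ ENNReal.ofReal K * eLpNorm (fun ω => y ω ⬝ᵥ v) 2 μ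

/-- A random vector in `𝕜 ^ p` is `K`-subgaussian if its real and imaginary parts are.
(Over `ℝ` the imaginary part is zero, and the condition on it is void.) -/
def IsSubgaussianVec {Ω : Type*} [MeasurableSpace Ω] {𝕜 : Type*} [RCLike 𝕜] {p : ℕ} (K : ℝ)
    (y : Ω → Fin p → 𝕜) (μ : Measure Ω) : Prop :=
  IsSubgaussianReal K (fun ω i => RCLike.re (y ω i)) μ ∧
    IsSubgaussianReal K (fun ω i => RCLike.im (y ω i)) μ

/-- The rank one matrix `u v^*`. -/
def outerProd {𝕜 : Type*} [RCLike 𝕜] {p : ℕ} (u v : Fin p → 𝕜) : Matrix (Fin p) (Fin p) 𝕜 :=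
  Matrix.vecMulVec u (star v)

/-- The matrix `𝔼 (y y^*)`. -/
noncomputable def secondMoment {Ω : Type*} [MeasurableSpace Ω] {𝕜 : Type*} [RCLike 𝕜] {p : ℕ}
    (y : Ω → Fin p → 𝕜) (μ : Measure Ω) : Matrix (Fin p) (Fin p) 𝕜 :=
  Matrix.of fun i j => ∫ ω, outerProd (y ω) (y ω) i j ∂μ

/-- Deterministic signals `c₁, …, c_n`, with `Σ_x = (1/n) ∑ c_k c_k^*`. -/
def IsDeterministicSignal {Ω : Type*} {𝕜 : Type*} [RCLike 𝕜] {n p : ℕ}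
    (x : Fin n → Ω → Fin p → 𝕜) (Sx : Matrix (Fin p) (Fin p) 𝕜) : Prop :=
  ∃ c : Fin n → Fin p → 𝕜, (∀ k ω, x k ω = c k) ∧
    Sx = (n : 𝕜)⁻¹ • ∑ k, outerProd (c k) (c k)

/-- Independent, identically distributed, `K`-subgaussian signals, with `Σ_x = 𝔼 (x x^*)`. -/
structure IsStochasticSignal {Ω : Type*} [MeasurableSpace Ω] {𝕜 : Type*} [RCLike 𝕜] {n p : ℕ}
    (K : ℝ) (x : Fin n → Ω → Fin p → 𝕜) (Sx : Matrix (Fin p) (Fin p) 𝕜)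
    (μ : Measure Ω) : Prop where
  indep : iIndepFun x μ
  identDistrib : ∀ k l, IdentDistrib (x k) (x l) μ μ
  subgaussian : ∀ k, IsSubgaussianVec K (x k) μ
  covariance : ∀ k, Sx = secondMoment (x k) μ

/-- Independent, identically distributed, `K`-subgaussian noise vectors whose entries are
uncorrelated, mean-zero, of variance `ν²`; over `ℂ` the real and the imaginary part of each entry
are independent (over `ℝ` this is void). -/
structure IsNoise {Ω : Type*} [MeasurableSpace Ω] {𝕜 : Type*} [RCLike 𝕜] {n p : ℕ}
    (K ν : ℝ) (e : Fin n → Ω → Fin p → 𝕜) (μ : Measure Ω) : Prop where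
  indep : iIndepFun e μ
  identDistrib : ∀ k l, IdentDistrib (e k) (e l) μ μ
  subgaussian : ∀ k, IsSubgaussianVec K (e k) μ
  uncorrelated : ∀ k i j, i ≠ j → ∫ ω, e k ω i * star (e k ω j) ∂μ = 0
  variance : ∀ k i, ∫ ω, ‖e k ω i‖ ^ 2 ∂μ = ν ^ 2
  indep_re_im : ∀ k i,
    IndepFun (fun ω => RCLike.re (e k ω i)) (fun ω => RCLike.im (e k ω i)) μ

/-- The standing assumptions on signals `x_k` (with matrix `Σ_x`) and noise `e_k`. -/
structure ObservationModel {Ω : Type*} [MeasurableSpace Ω] {𝕜 : Type*} [RCLike 𝕜] {n p : ℕ}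
    (K ν : ℝ) (x e : Fin n → Ω → Fin p → 𝕜) (Sx : Matrix (Fin p) (Fin p) 𝕜)
    (μ : Measure Ω) : Prop where
  measurable_signal : ∀ k, Measurable (x k)
  measurable_noise : ∀ k, Measurable (e k)
  signal : IsDeterministicSignal x Sx ∨ IsStochasticSignal K x Sx μ
  noise : IsNoise K ν e μ
  indep : iIndepFun (Sum.elim x e) μ

/-- Rectangular dithers: uniformly distributed, and all of the dithers, signals and noise vectors
are independent. -/
structure RectangularDither {Ω : Type*} [MeasurableSpace Ω] {𝕜 : Type*} [RCLike 𝕜] {n p : ℕ}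
    (lam : ℝ) (x e τ τ' : Fin n → Ω → Fin p → 𝕜) (μ : Measure Ω) : Prop where
  measurable_fst : ∀ k, Measurable (τ k)
  measurable_snd : ∀ k, Measurable (τ' k)
  law_fst : ∀ k, μ.map (τ k) = ditherLaw 𝕜 p lam
  law_snd : ∀ k, μ.map (τ' k) = ditherLaw 𝕜 p lam
  indep : iIndepFun (Sum.elim (Sum.elim x e) (Sum.elim τ τ')) μ

/-- The sample `y_k = x_k + e_k`. -/
def observation {Ω : Type*} {𝕜 : Type*} [RCLike 𝕜] {n p : ℕ}
    (x e : Fin n → Ω → Fin p → 𝕜) (k : Fin n) (ω : Ω) : Fin p → 𝕜 :=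
  x k ω + e k ω

/-- The quantized sample `sign (y_k + τ_k)`, entry by entry. -/
noncomputable def quantized {Ω : Type*} {𝕜 : Type*} [RCLike 𝕜] {n p : ℕ}
    (y τ : Fin n → Ω → Fin p → 𝕜) (k : Fin n) (ω : Ω) : Fin p → 𝕜 :=
  fun i => signField (y k ω i + τ k ω i)

/-- The estimator `Σ' = (lam² / n) ∑ q_k q'_k^*`. -/
noncomputable def asymEstimator {Ω : Type*} {𝕜 : Type*} [RCLike 𝕜] {n p : ℕ} (lam : ℝ)
    (y τ τ' : Fin n → Ω → Fin p → 𝕜) (ω : Ω) : Matrix (Fin p) (Fin p) 𝕜 :=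
  ((lam ^ 2 / n : ℝ) : 𝕜) • ∑ k, outerProd (quantized y τ k ω) (quantized y τ' k ω)

/-- The symmetrized estimator `(Σ' + Σ'^*) / 2`. -/
noncomputable def symEstimator {Ω : Type*} {𝕜 : Type*} [RCLike 𝕜] {n p : ℕ} (lam : ℝ)
    (y τ τ' : Fin n → Ω → Fin p → 𝕜) (ω : Ω) : Matrix (Fin p) (Fin p) 𝕜 :=
  (1 / 2 : 𝕜) • asymEstimator lam y τ τ' ω +
    (1 / 2 : 𝕜) • (asymEstimator lam y τ τ' ω).conjTranspose

/-- The `k`-th largest eigenvalue (`1 ≤ k ≤ p`, counted with multiplicity) of a Hermitian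
matrix. -/
noncomputable def eigval {𝕜 : Type*} [RCLike 𝕜] {p : ℕ} (A : Matrix (Fin p) (Fin p) 𝕜)
    (k : ℕ) : ℝ :=
  open Classical in
  if h : A.IsHermitian ∧ 1 ≤ k ∧ k ≤ p then
    h.1.eigenvalues₀ ⟨k - 1, by have := h.2; simp only [Fintype.card_fin]; omega⟩
  else 0

/-- The columns of `U` form an orthonormal basis of a leading `s`-dimensional eigenspace of `A`:
they are orthonormal, with the same span as some orthonormal eigenvectors `v_1, …, v_s` of `A`
that belong to the `s` largest eigenvalues. -/
def IsLeadingBasis {𝕜 : Type*} [RCLike 𝕜] {p s : ℕ} (A : Matrix (Fin p) (Fin p) 𝕜)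
    (U : Matrix (Fin p) (Fin s) 𝕜) : Prop :=
  U.conjTranspose * U = 1 ∧
    ∃ V : Matrix (Fin p) (Fin s) 𝕜, V.conjTranspose * V = 1 ∧
      (∀ j : Fin s, A.mulVec (V.col j) = (eigval A (j + 1) : 𝕜) • V.col j) ∧
      Submodule.span 𝕜 (Set.range U.col) = Submodule.span 𝕜 (Set.range V.col)

/-- The `ℓ²` operator norm. -/
noncomputable def opNorm {𝕜 : Type*} [RCLike 𝕜] {p : ℕ} (A : Matrix (Fin p) (Fin p) 𝕜) : ℝ :=
  ‖Matrix.toEuclideanCLM (n := Fin p) (𝕜 := 𝕜) A‖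

/-- The entrywise maximum norm. -/
noncomputable def maxNorm {𝕜 : Type*} [RCLike 𝕜] {p : ℕ} (A : Matrix (Fin p) (Fin p) 𝕜) : ℝ :=
  ⨆ i, ⨆ j, ‖A i j‖

/-- The sine-theta distance `‖U U^* - V V^*‖` of the column spaces of two matrices with
orthonormal columns. -/
noncomputable def sinThetaDist {𝕜 : Type*} [RCLike 𝕜] {p s : ℕ}
    (U V : Matrix (Fin p) (Fin s) 𝕜) : ℝ :=
  opNorm (U * U.conjTranspose - V * V.conjTranspose)

/-- `C_∞ = max_k ‖𝔼 (y_k y_k^*)‖_∞`. -/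
noncomputable def Cinf {Ω : Type*} [MeasurableSpace Ω] {𝕜 : Type*} [RCLike 𝕜] {n p : ℕ}
    (y : Fin n → Ω → Fin p → 𝕜) (μ : Measure Ω) : ℝ :=
  ⨆ k, maxNorm (secondMoment (y k) μ)

/-- `C_op = max_k ‖𝔼 (y_k y_k^*)‖`. -/
noncomputable def Cop {Ω : Type*} [MeasurableSpace Ω] {𝕜 : Type*} [RCLike 𝕜] {n p : ℕ}
    (y : Fin n → Ω → Fin p → 𝕜) (μ : Measure Ω) : ℝ :=
  ⨆ k, opNorm (secondMoment (y k) μ)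

/-- The error bound, for constants `C = C_K`, `cop = C_op` and the eigengap `gap`. -/
noncomputable def errorBound (C cop lam gap : ℝ) (n p : ℕ) (t : ℝ) : ℝ :=
  min 1 (C * (lam * (Real.sqrt cop + lam)) / gap * Real.sqrt (p * (Real.log p + t) / n) +
    C * lam ^ 2 / gap * (p * (Real.log p + t) / n))

/-! ### The Lie product formula and the Golden–Thompson inequality -/

section TraceInequalities

open Matrix NormedSpace Filter Topology
open scoped ComplexOrder
open scoped Matrix.Norms.L2Operator

/-! Averaged over a uniform dither, the sign of a dithered real number `a` has mean equal to `a`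
clipped to `[-lam, lam]`, divided by `lam` (`integral_signReal_add`). Since the two dithers of a
sample are independent, the mean of a product of quantized entries factors for every pair of
entries, the diagonal included. Hence each symmetrized summand of the estimator has as its mean the
second moment matrix `G` of the clipped sample. The error then has two sources.

Fluctuation. The centred summands are independent Hermitian matrices of norm at most `4 p lam²`.
Their variance is at most `2 p lam² (‖G‖ + 2 lam²)` (`integral_norm_sq_symQuantized_sub_le`): one
quantized factor costs the number `p` of rows, while the other is tested in a single direction,
where its second moment is that of `G / lam²` up to a bounded diagonal. `matrix_bernstein` turns
this into the square root term and the linear term of the bound. It is proved by the Laplace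
transform method, peeling off one summand at a time with Golden–Thompson (`re_trace_exp_add_le`) and
`exp x ≤ 1 + x + x²` on `[-1, 1]`.

Bias. Clipping acts only beyond the dithering range. If `lam²` dominates `log n` times `C_∞`,
subgaussian tails make its effect on each entry `O(lam² / n)`; for bounded data there is no effect
(`integral_excess_observation_le`). In operator norm this costs `O(p lam² / n)`, which the linear
term absorbs. The same estimate allows `‖G‖` to be replaced by `C_op` in the variance.

Subspaces. The average of the unclipped second moments is `Σ_x + ν²`, which has the leading
eigenspaces and the eigengap of `Σ_x`. Davis–Kahan (`sinThetaDist_le`) converts the operator norm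
error into the distance of the eigenspaces; Weyl's inequality provides the gap of the estimator when
the error is small, and otherwise the trivial bound `1` suffices. -/

theorem norm_exp_le_exp_norm {A : Type*} [NormedRing A] [NormedAlgebra ℝ A] [CompleteSpace A]
    [NormOneClass A] [Algebra ℚ A] (a : A) : ‖exp a‖ ≤ Real.exp ‖a‖ := by
  rw [exp_eq_tsum ℝ, Real.exp_eq_exp_ℝ, exp_eq_tsum ℝ]
  refine (norm_tsum_le_tsum_norm (norm_expSeries_summable' (𝕂 := ℝ) a)).trans ?_
  refine Summable.tsum_le_tsum (fun k => ?_) (norm_expSeries_summable' (𝕂 := ℝ) a)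
    (expSeries_summable' (𝕂 := ℝ) ‖a‖)
  rw [norm_smul, smul_eq_mul, norm_inv, Real.norm_natCast]
  gcongr
  exact norm_pow_le a k

/-- The Lie product formula. -/
theorem tendsto_exp_mul_exp_pow {A : Type*} [NormedRing A] [NormedAlgebra ℝ A] [CompleteSpace A]
    [NormOneClass A] [Algebra ℚ A] (a b : A) :
    Tendsto (fun N : ℕ => (exp ((N : ℝ)⁻¹ • a) * exp ((N : ℝ)⁻¹ • b)) ^ N) atTop
      (𝓝 (exp (a + b))) := by
  obtain ⟨inst, rfl⟩ : ∃ h : NormedAlgebra ℚ A, ‹Algebra ℚ A› = h.toAlgebra :=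
    ⟨NormedAlgebra.restrictScalars ℚ ℝ A, Subsingleton.elim _ _⟩
  -- Telescoping estimate; the extra factor `M` on the left avoids the exponent `N - 1`.
  have hpow : ∀ (x y : A) (M : ℝ), ‖x‖ ≤ M → ‖y‖ ≤ M → ∀ N : ℕ,
      M * ‖x ^ N - y ^ N‖ ≤ N * M ^ N * ‖x - y‖ := by
    intro x y M hx hy N
    have hM : 0 ≤ M := (norm_nonneg x).trans hx
    induction N with
    | zero => simp
    | succ N ih =>
      have h1 : x ^ (N + 1) - y ^ (N + 1) = x ^ N * (x - y) + (x ^ N - y ^ N) * y := by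
        rw [pow_succ, pow_succ]; noncomm_ring
      have h2 : ‖x ^ (N + 1) - y ^ (N + 1)‖ ≤ M ^ N * ‖x - y‖ + ‖x ^ N - y ^ N‖ * M := by
        rw [h1]
        refine (norm_add_le _ _).trans (add_le_add ?_ ?_)
        · refine (norm_mul_le _ _).trans ?_
          gcongr
          exact (norm_pow_le _ _).trans (by gcongr)
        · refine (norm_mul_le _ _).trans ?_
          gcongr
      calc M * ‖x ^ (N + 1) - y ^ (N + 1)‖
          ≤ M * (M ^ N * ‖x - y‖ + ‖x ^ N - y ^ N‖ * M) := by gcongr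
        _ = M ^ (N + 1) * ‖x - y‖ + (M * ‖x ^ N - y ^ N‖) * M := by ring
        _ ≤ M ^ (N + 1) * ‖x - y‖ + (N * M ^ N * ‖x - y‖) * M := by gcongr
        _ = _ := by push_cast; ring
  have hexp : ∀ c : A, HasDerivAt (fun t : ℝ => exp (t • c)) c 0 := by
    intro c
    have := hasDerivAt_exp_smul_const (𝕂 := ℝ) c (0 : ℝ)
    simpa using this
  -- The two curves agree to first order at `0`, so at `t = 1 / N` they differ by `o(1 / N)`, and
  -- the `N` telescoped errors still tend to `0`.
  have hderiv : HasDerivAt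
      (fun t : ℝ => exp (t • a) * exp (t • b) - exp (t • (a + b))) 0 0 := by
    have := ((hexp a).mul (hexp b)).sub (hexp (a + b))
    simp only [zero_smul, exp_zero, one_mul, mul_one, sub_self] at this
    exact this
  have hslope : Tendsto (fun N : ℕ => (N : ℝ) * ‖exp ((N : ℝ)⁻¹ • a) * exp ((N : ℝ)⁻¹ • b)
      - exp ((N : ℝ)⁻¹ • (a + b))‖) atTop (𝓝 0) := by
    have h1 := hderiv.tendsto_slope_zero
    have h2 : Tendsto (fun N : ℕ => (N : ℝ)⁻¹) atTop (𝓝[≠] 0) := by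
      refine tendsto_nhdsWithin_iff.2 ⟨tendsto_inv_atTop_nhds_zero_nat, ?_⟩
      filter_upwards [eventually_gt_atTop 0] with N hN
      simp [hN.ne']
    have h3 := (h1.comp h2).norm
    simp only [Function.comp_def, norm_smul, inv_inv, zero_add, zero_smul, exp_zero, mul_one,
      sub_self, sub_zero, norm_zero, Real.norm_natCast] at h3
    exact h3
  set M : ℝ := ‖a‖ + ‖b‖ with hMdef
  have key : Tendsto (fun N : ℕ => (exp ((N : ℝ)⁻¹ • a) * exp ((N : ℝ)⁻¹ • b)) ^ N - exp (a + b))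
      atTop (𝓝 0) := by
    rw [tendsto_zero_iff_norm_tendsto_zero]
    have h0 := (hslope.const_mul (Real.exp M))
    rw [mul_zero] at h0
    refine squeeze_zero' (Eventually.of_forall fun _ => norm_nonneg _) ?_ h0
    filter_upwards [eventually_gt_atTop 0] with N hN
    have hN' : (0 : ℝ) < N := by exact_mod_cast hN
    have hs : ∀ c : A, ‖exp ((N : ℝ)⁻¹ • c)‖ ≤ Real.exp (‖c‖ / N) := by
      intro c
      refine (norm_exp_le_exp_norm _).trans ?_
      rw [norm_smul, norm_inv, Real.norm_natCast, inv_mul_eq_div]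
    have e1 : ‖exp ((N : ℝ)⁻¹ • a) * exp ((N : ℝ)⁻¹ • b)‖ ≤ Real.exp (M / N) := by
      refine (norm_mul_le _ _).trans ?_
      rw [hMdef, add_div, Real.exp_add]
      gcongr <;> exact hs _
    have e2 : ‖exp ((N : ℝ)⁻¹ • (a + b))‖ ≤ Real.exp (M / N) :=
      (hs _).trans (by gcongr; exact norm_add_le _ _)
    have e3 : exp ((N : ℝ)⁻¹ • (a + b)) ^ N = exp (a + b) := by
      rw [← NormedSpace.exp_nsmul, ← Nat.cast_smul_eq_nsmul ℝ, smul_smul,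
        mul_inv_cancel₀ hN'.ne', one_smul]
    have e4 := hpow _ _ _ e1 e2 N
    rw [e3, ← Real.exp_nat_mul, mul_div_cancel₀ _ hN'.ne'] at e4
    have e5 : 1 ≤ Real.exp (M / N) := Real.one_le_exp (by positivity)
    calc _ ≤ Real.exp (M / N) * ‖(exp ((N : ℝ)⁻¹ • a) * exp ((N : ℝ)⁻¹ • b)) ^ N - exp (a + b)‖ :=
          le_mul_of_one_le_left (norm_nonneg _) e5
      _ ≤ _ := e4
      _ = _ := by ring
  simpa using key.add_const (exp (a + b))

variable {𝕜 : Type*} [RCLike 𝕜] {ι : Type*} [Fintype ι]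

theorem re_trace_conjTranspose_mul_self_nonneg (M : Matrix ι ι 𝕜) :
    0 ≤ RCLike.re (trace (Mᴴ * M)) :=
  (RCLike.nonneg_iff.1 (posSemidef_conjTranspose_mul_self M).trace_nonneg).1

theorem re_trace_conjTranspose (M : Matrix ι ι 𝕜) :
    RCLike.re (trace Mᴴ) = RCLike.re (trace M) := by
  rw [trace_conjTranspose]; exact RCLike.conj_re _

/-- Expand the squared Frobenius norm of `Aᴴ - B`, which is nonnegative. -/
theorem two_mul_re_trace_mul_le (A B : Matrix ι ι 𝕜) :
    2 * RCLike.re (trace (A * B)) ≤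
      RCLike.re (trace (Aᴴ * A)) + RCLike.re (trace (Bᴴ * B)) := by
  have h := re_trace_conjTranspose_mul_self_nonneg (Aᴴ - B)
  have h2 : RCLike.re (trace (Bᴴ * Aᴴ)) = RCLike.re (trace (A * B)) := by
    rw [← conjTranspose_mul, re_trace_conjTranspose]
  have h3 : trace (A * Aᴴ) = trace (Aᴴ * A) := trace_mul_comm _ _
  simp only [conjTranspose_sub, conjTranspose_conjTranspose, sub_mul, mul_sub, trace_sub,
    map_sub, h2, h3] at h
  linarith

variable [DecidableEq ι]

theorem trace_mul_pow_comm (A B : Matrix ι ι 𝕜) (k : ℕ) :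
    trace ((A * B) ^ k) = trace ((B * A) ^ k) := by
  cases k with
  | zero => simp
  | succ k =>
    have h : (A * B) ^ (k + 1) = A * (B * A) ^ k * B := by
      induction k with
      | zero => simp
      | succ k ih => rw [pow_succ, ih, pow_succ (B * A) k]; simp only [mul_assoc]
    rw [h, trace_mul_comm, ← mul_assoc, ← pow_succ']

/-- The two inequalities feed each other in one induction. For the first, bound the trace of the
square of `(P * Q) ^ 2 ^ j` by its squared Frobenius norm, apply the second to `P * Q`, rearrange
cyclically, and apply the first to `P²` and `Q²`. For the second, apply it to `M * M`, rearrange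
cyclically into a power of `(M * Mᴴ) * (Mᴴ * M)`, separate the factors by the first, and use that
both have the same power traces. -/
theorem re_trace_pow_two_pow_le (j : ℕ) :
    (∀ P Q : Matrix ι ι 𝕜, P.IsHermitian → Q.IsHermitian →
      RCLike.re (trace ((P * Q) ^ 2 ^ j)) ≤ RCLike.re (trace (P ^ 2 ^ j * Q ^ 2 ^ j))) ∧
    ∀ M : Matrix ι ι 𝕜,
      RCLike.re (trace ((M ^ 2 ^ j)ᴴ * M ^ 2 ^ j)) ≤ RCLike.re (trace ((Mᴴ * M) ^ 2 ^ j)) := by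
  induction j with
  | zero => simp
  | succ j ih =>
    obtain ⟨ihL, ihG⟩ := ih
    have hsq : ∀ N : Matrix ι ι 𝕜, N ^ 2 ^ (j + 1) = (N * N) ^ 2 ^ j := by
      intro N; rw [← pow_two, ← pow_mul]; congr 1; ring
    refine ⟨fun P Q hP hQ => ?_, fun M => ?_⟩
    · have h1 := two_mul_re_trace_mul_le ((P * Q) ^ 2 ^ j) ((P * Q) ^ 2 ^ j)
      have h2 := ihG (P * Q)
      have h3 : trace (((P * Q)ᴴ * (P * Q)) ^ 2 ^ j) = trace ((P * P * (Q * Q)) ^ 2 ^ j) := by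
        rw [conjTranspose_mul, hP.eq, hQ.eq, show Q * P * (P * Q) = Q * (P * P * Q) by
          simp only [mul_assoc], trace_mul_pow_comm]
        simp only [mul_assoc]
      have hs : ∀ N : Matrix ι ι 𝕜, N.IsHermitian → (N * N).IsHermitian := by
        intro N hN; rw [IsHermitian, conjTranspose_mul, hN.eq]
      have h4 := ihL (P * P) (Q * Q) (hs P hP) (hs Q hQ)
      rw [h3] at h2
      rw [hsq P, hsq Q, pow_succ 2 j, pow_mul, pow_two]
      linarith
    · have h1 := ihG (M * M)
      have h2 : trace (((M * M)ᴴ * (M * M)) ^ 2 ^ j)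
          = trace ((M * Mᴴ * (Mᴴ * M)) ^ 2 ^ j) := by
        rw [conjTranspose_mul, show Mᴴ * Mᴴ * (M * M) = (Mᴴ * Mᴴ * M) * M by
          simp only [mul_assoc], trace_mul_pow_comm]
        simp only [mul_assoc]
      have hP : (M * Mᴴ).IsHermitian := isHermitian_mul_conjTranspose_self M
      have hQ : (Mᴴ * M).IsHermitian := isHermitian_conjTranspose_mul_self M
      have h3 := ihL _ _ hP hQ
      have h4 := two_mul_re_trace_mul_le ((M * Mᴴ) ^ 2 ^ j) ((Mᴴ * M) ^ 2 ^ j)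
      have h5 : trace (((M * Mᴴ) ^ 2 ^ j)ᴴ * (M * Mᴴ) ^ 2 ^ j)
          = trace ((Mᴴ * M) ^ 2 ^ (j + 1)) := by
        rw [(hP.pow _).eq, ← pow_add, ← trace_mul_pow_comm]; congr 2; ring
      have h6 : trace (((Mᴴ * M) ^ 2 ^ j)ᴴ * (Mᴴ * M) ^ 2 ^ j)
          = trace ((Mᴴ * M) ^ 2 ^ (j + 1)) := by
        rw [(hQ.pow _).eq, ← pow_add]; congr 2; ring
      rw [h5, h6] at h4
      rw [h2] at h1
      rw [hsq M]
      linarith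

/-- The real normed algebra structure on matrices with the `ℓ²` operator norm. -/
noncomputable abbrev realNormedAlgebra : NormedAlgebra ℝ (Matrix ι ι 𝕜) where
  norm_smul_le r A := by
    rw [RCLike.real_smul_eq_coe_smul (K := 𝕜), norm_smul, RCLike.norm_ofReal, Real.norm_eq_abs]

/-- The Golden–Thompson inequality. -/
theorem re_trace_exp_add_le {A B : Matrix ι ι 𝕜} (hA : A.IsHermitian) (hB : B.IsHermitian) :
    RCLike.re (trace (exp (A + B))) ≤ RCLike.re (trace (exp A * exp B)) := by
  rcases isEmpty_or_nonempty ι with hι | hι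
  · simp [trace]
  let _ : NormedAlgebra ℝ (Matrix ι ι 𝕜) := realNormedAlgebra
  -- The Lie formula along `N = 2 ^ j`, the exponents for which the trace inequality is available;
  -- there its right side no longer depends on `j`.
  have hlim : Tendsto (fun j : ℕ => RCLike.re (trace
      ((exp (((2 ^ j : ℕ) : ℝ)⁻¹ • A) * exp (((2 ^ j : ℕ) : ℝ)⁻¹ • B)) ^ 2 ^ j))) atTop
      (𝓝 (RCLike.re (trace (exp (A + B))))) := by
    have h1 := (tendsto_exp_mul_exp_pow A B).comp
      (tendsto_pow_atTop_atTop_of_one_lt (r := 2) one_lt_two)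
    have hc : Continuous fun M : Matrix ι ι 𝕜 => RCLike.re (trace M) :=
      RCLike.continuous_re.comp (continuous_id.matrix_trace)
    exact (hc.tendsto _).comp h1
  refine le_of_tendsto hlim (Eventually.of_forall fun j => ?_)
  have hh : ∀ C : Matrix ι ι 𝕜, C.IsHermitian →
      (exp (((2 ^ j : ℕ) : ℝ)⁻¹ • C)).IsHermitian := by
    intro C hC
    refine IsHermitian.exp ?_
    rw [IsHermitian, conjTranspose_smul, hC.eq]; simp
  have hp : ∀ C : Matrix ι ι 𝕜, exp (((2 ^ j : ℕ) : ℝ)⁻¹ • C) ^ 2 ^ j = exp C := by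
    intro C
    rw [← Matrix.exp_nsmul, ← Nat.cast_smul_eq_nsmul ℝ, smul_smul, mul_inv_cancel₀ (by positivity),
      one_smul]
  refine ((re_trace_pow_two_pow_le j).1 _ _ (hh A hA) (hh B hB)).trans_eq ?_
  rw [hp, hp]

end TraceInequalities

/-! ### Spectral bounds for the exponential of a Hermitian matrix -/

section MatrixExponential

open Matrix NormedSpace
open scoped Matrix.Norms.L2Operator ComplexOrder

variable {𝕜 : Type*} [RCLike 𝕜] {ι : Type*} [Fintype ι] [DecidableEq ι]

/-- Diagonalization of a Hermitian matrix and of its exponential. -/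
theorem exists_diagonal_exp_of_isHermitian {X : Matrix ι ι 𝕜} (hX : X.IsHermitian) :
    ∃ (U : Matrix ι ι 𝕜) (d : ι → ℝ), Uᴴ * U = 1 ∧ U * Uᴴ = 1 ∧
      X = U * diagonal (fun i => (d i : 𝕜)) * Uᴴ ∧
      exp X = U * diagonal (fun i => ((Real.exp (d i) : ℝ) : 𝕜)) * Uᴴ ∧
      ‖X‖ = ‖d‖ := by
  have hU1 : ((hX.eigenvectorUnitary : Matrix ι ι 𝕜))ᴴ * hX.eigenvectorUnitary = 1 :=
    Unitary.coe_star_mul_self _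
  have hU2 : (hX.eigenvectorUnitary : Matrix ι ι 𝕜) * (hX.eigenvectorUnitary : Matrix ι ι 𝕜)ᴴ = 1 :=
    Unitary.coe_mul_star_self _
  have hspec : X = (hX.eigenvectorUnitary : Matrix ι ι 𝕜) *
      diagonal (fun i => (hX.eigenvalues i : 𝕜)) * (hX.eigenvectorUnitary : Matrix ι ι 𝕜)ᴴ := by
    conv_lhs => rw [hX.spectral_theorem]
    rw [Unitary.conjStarAlgAut_apply]; rfl
  refine ⟨hX.eigenvectorUnitary, hX.eigenvalues, hU1, hU2, hspec, ?_, ?_⟩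
  · conv_lhs => rw [hspec]
    have hunit : IsUnit (hX.eigenvectorUnitary : Matrix ι ι 𝕜) :=
      ⟨⟨_, _, hU2, hU1⟩, rfl⟩
    have hinv : (hX.eigenvectorUnitary : Matrix ι ι 𝕜)⁻¹ =
      (hX.eigenvectorUnitary : Matrix ι ι 𝕜)ᴴ := inv_eq_right_inv hU2
    have h := exp_conj (hX.eigenvectorUnitary : Matrix ι ι 𝕜)
      (diagonal (fun i => (hX.eigenvalues i : 𝕜))) hunit
    rw [hinv] at h
    rw [h, exp_diagonal]
    congr 3
    ext i
    rw [Pi.coe_exp]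
    rw [Real.exp_eq_exp_ℝ]
    exact (algebraMap_exp_comm (𝕂 := ℝ) (𝔸 := 𝕜) _).symm
  · conv_lhs => rw [hspec]
    have h1 : star (hX.eigenvectorUnitary : Matrix ι ι 𝕜) ∈ unitary (Matrix ι ι 𝕜) :=
      Unitary.star_mem hX.eigenvectorUnitary.2
    rw [← star_eq_conjTranspose, CStarRing.norm_mul_mem_unitary _ h1,
      CStarRing.norm_mem_unitary_mul _ hX.eigenvectorUnitary.2, l2_opNorm_diagonal]
    have h2 : ∀ r : ℝ, ‖(r : 𝕜)‖₊ = ‖r‖₊ := fun r => by ext; simp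
    simp only [Pi.norm_def, h2]

theorem re_trace_exp_eq_sum {X U : Matrix ι ι 𝕜} {d : ι → ℝ} (hU : Uᴴ * U = 1)
    (hX : exp X = U * diagonal (fun i => ((Real.exp (d i) : ℝ) : 𝕜)) * Uᴴ) :
    RCLike.re (trace (exp X)) = ∑ i, Real.exp (d i) := by
  rw [hX, trace_mul_comm, ← mul_assoc, hU, one_mul, trace_diagonal, map_sum]
  simp

/-- The norm is `|d i|` for some eigenvalue `d i`, so the left side is a single term of one of the
two sums of exponentials. This reduces a norm tail bound to trace exponentials of `X` and `-X`. -/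
theorem exp_norm_le_re_trace_exp_add [Nonempty ι] {X : Matrix ι ι 𝕜} (hX : X.IsHermitian) :
    Real.exp ‖X‖ ≤ RCLike.re (trace (exp X)) + RCLike.re (trace (exp (-X))) := by
  obtain ⟨U, d, hU, hU', hXd, hexp, hn⟩ := exists_diagonal_exp_of_isHermitian hX
  have hneg : exp (-X) = U * diagonal (fun i => ((Real.exp (-d i) : ℝ) : 𝕜)) * Uᴴ := by
    rw [Matrix.exp_neg, hexp]
    refine inv_eq_right_inv ?_
    calc _ = U * diagonal (fun i => ((Real.exp (d i) : ℝ) : 𝕜)) * (Uᴴ * U) *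
          diagonal (fun i => ((Real.exp (-d i) : ℝ) : 𝕜)) * Uᴴ := by simp only [mul_assoc]
      _ = 1 := by
        rw [hU, mul_one, mul_assoc U, diagonal_mul_diagonal]
        simp_rw [← RCLike.ofReal_mul, ← Real.exp_add, add_neg_cancel, Real.exp_zero,
          RCLike.ofReal_one]
        rw [diagonal_one, mul_one, hU']
  rw [re_trace_exp_eq_sum hU hexp, re_trace_exp_eq_sum hU hneg, hn]
  obtain ⟨i, hi⟩ : ∃ i, ‖d‖ = ‖d i‖ := by
    obtain ⟨i, -, hi⟩ := Finset.exists_mem_eq_sup Finset.univ Finset.univ_nonempty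
      (fun i => ‖d i‖₊)
    exact ⟨i, by rw [Pi.norm_def, hi]; rfl⟩
  rw [hi, Real.norm_eq_abs]
  have h1 : Real.exp (d i) ≤ ∑ i, Real.exp (d i) :=
    Finset.single_le_sum (fun j _ => (Real.exp_pos (d j)).le) (Finset.mem_univ i)
  have h2 : Real.exp (-d i) ≤ ∑ i, Real.exp (-d i) :=
    Finset.single_le_sum (fun j _ => (Real.exp_pos (-d j)).le) (Finset.mem_univ i)
  rcases abs_cases (d i) with h | h <;> rw [h.1] <;>
    linarith [Real.exp_pos (d i), Real.exp_pos (-d i)]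

/-- The scalar bound `exp d ≤ 1 + d + d²` for `|d| ≤ 1`, applied to the eigenvalues, gives `exp X ≤
1 + X + X²` in the Loewner order; conjugating by `R` and taking traces preserves it. The quadratic
term is kept as a Frobenius norm of `X * R`, so that a variance bound on vectors applies to the
columns of `R`. -/
theorem re_trace_mul_exp_mul_le {X R : Matrix ι ι 𝕜} (hX : X.IsHermitian) (hR : R.IsHermitian)
    (hn : ‖X‖ ≤ 1) :
    RCLike.re (trace (R * exp X * R)) ≤ RCLike.re (trace (R * R)) +
      RCLike.re (trace (R * X * R)) + RCLike.re (trace ((X * R)ᴴ * (X * R))) := by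
  obtain ⟨U, d, hU, hU', hXd, hexp, hnd⟩ := exists_diagonal_exp_of_isHermitian hX
  have hpsd : (1 + X + X * X - exp X).PosSemidef := by
    have h1 : 1 + X + X * X - exp X = U * diagonal
        (fun i => ((1 + d i + d i * d i - Real.exp (d i) : ℝ) : 𝕜)) * Uᴴ := by
      have hXX : X * X = U * diagonal (fun i => ((d i * d i : ℝ) : 𝕜)) * Uᴴ := by
        calc X * X = (U * diagonal (fun i => (d i : 𝕜)) * Uᴴ) *
              (U * diagonal (fun i => (d i : 𝕜)) * Uᴴ) := by rw [← hXd]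
          _ = U * diagonal (fun i => (d i : 𝕜)) * (Uᴴ * U) *
              diagonal (fun i => (d i : 𝕜)) * Uᴴ := by
            simp only [mul_assoc]
          _ = _ := by
            rw [hU, mul_one, mul_assoc U, diagonal_mul_diagonal]
            simp_rw [← RCLike.ofReal_mul]
      have h2 : (diagonal fun i => ((1 + d i + d i * d i - Real.exp (d i) : ℝ) : 𝕜)) =
          1 + diagonal (fun i => (d i : 𝕜)) + diagonal (fun i => ((d i * d i : ℝ) : 𝕜)) -
            diagonal (fun i => ((Real.exp (d i) : ℝ) : 𝕜)) := by
        rw [← diagonal_one, diagonal_add, diagonal_add, diagonal_sub]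
        congr 1; ext i; push_cast; rfl
      have h3 : ∀ D₁ D₂ D₃ : Matrix ι ι 𝕜, U * (1 + D₁ + D₂ - D₃) * Uᴴ =
          U * Uᴴ + U * D₁ * Uᴴ + U * D₂ * Uᴴ - U * D₃ * Uᴴ := by
        intros; noncomm_ring
      rw [h2, h3, hU', ← hXd, ← hXX, ← hexp]
    rw [h1]
    refine PosSemidef.mul_mul_conjTranspose_same (posSemidef_diagonal_iff.2 fun i => ?_) U
    have hdi : |d i| ≤ 1 := (norm_le_pi_norm d i).trans (hnd ▸ hn)
    have h3 := Real.norm_exp_sub_one_sub_id_le (x := d i) hdi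
    rw [Real.norm_eq_abs, Real.norm_eq_abs, sq_abs] at h3
    have h4 := (abs_le.1 h3).2
    exact_mod_cast (by nlinarith : 0 ≤ 1 + d i + d i * d i - Real.exp (d i))
  have h := (RCLike.nonneg_iff.1 ((hpsd.mul_mul_conjTranspose_same R).trace_nonneg)).1
  rw [hR.eq] at h
  have h5 : R * (1 + X + X * X - exp X) * R =
      R * R + R * X * R + (X * R)ᴴ * (X * R) - R * exp X * R := by
    rw [conjTranspose_mul, hX.eq, hR.eq]; noncomm_ring
  rw [h5] at h
  simp only [trace_sub, trace_add, map_sub, map_add] at h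
  linarith

end MatrixExponential

/-! ### Fubini for independent random variables -/

section IndependentIntegral

/-- Integration against independent variables, one at a time. -/
theorem integral_comp_of_indepFun {Ω E F G : Type*} [MeasurableSpace Ω] [MeasurableSpace E]
    [MeasurableSpace F] [NormedAddCommGroup G] [NormedSpace ℝ G] {μ : Measure Ω}
    [IsProbabilityMeasure μ] {S : Ω → E} {X : Ω → F} (h : IndepFun S X μ) (hS : Measurable S)
    (hX : Measurable X) {g : E → F → G}
    (hg : AEStronglyMeasurable (Function.uncurry g) ((μ.map S).prod (μ.map X)))
    (hint : Integrable (fun ω => g (S ω) (X ω)) μ) :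
    ∫ ω, g (S ω) (X ω) ∂μ = ∫ ω, ∫ ω', g (S ω) (X ω') ∂μ ∂μ := by
  have := Measure.isProbabilityMeasure_map (μ := μ) hS.aemeasurable
  have := Measure.isProbabilityMeasure_map (μ := μ) hX.aemeasurable
  have hmap := (indepFun_iff_map_prod_eq_prod_map_map hS.aemeasurable hX.aemeasurable).1 h
  have hSX : Measurable fun ω => (S ω, X ω) := hS.prodMk hX
  have hint' : Integrable (Function.uncurry g) ((μ.map S).prod (μ.map X)) := by
    rw [← hmap] at hg ⊢
    exact (integrable_map_measure hg hSX.aemeasurable).2 hint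
  have h1 : ∫ ω, g (S ω) (X ω) ∂μ = ∫ z, Function.uncurry g z ∂(μ.map S).prod (μ.map X) := by
    rw [← hmap] at hg ⊢
    rw [integral_map hSX.aemeasurable hg]
    rfl
  rw [h1, integral_prod _ hint',
    integral_map hS.aemeasurable hint'.integral_prod_left.aestronglyMeasurable]
  have h2 := (ae_of_ae_map hS.aemeasurable hint'.prod_right_ae)
  have h3 := (ae_of_ae_map hS.aemeasurable hg.prodMk_left)
  refine integral_congr_ae (h3.mono fun ω hω => ?_)
  exact integral_map hX.aemeasurable hω

end IndependentIntegral

/-! ### The matrix Bernstein inequality -/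

section MatrixBernstein

open Matrix NormedSpace
open scoped Matrix.Norms.L2Operator ComplexOrder

variable {𝕜 : Type*} [RCLike 𝕜] {ι : Type*}

/-- The product measurable structure on matrices. -/
abbrev matrixMeasurableSpace : MeasurableSpace (Matrix ι ι 𝕜) :=
  inferInstanceAs (MeasurableSpace (ι → ι → 𝕜))

attribute [local instance] matrixMeasurableSpace

theorem measurable_matrix_iff {Ω : Type*} [MeasurableSpace Ω] {X : Ω → Matrix ι ι 𝕜} :
    Measurable X ↔ ∀ i j, Measurable fun ω => X ω i j := by
  refine (measurable_pi_iff (X := fun _ : ι => ι → 𝕜) (g := X)).trans ?_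
  exact forall_congr' fun i => measurable_pi_iff

variable [Fintype ι]

theorem matrixBorelSpace : BorelSpace (Matrix ι ι 𝕜) :=
  inferInstanceAs (BorelSpace (ι → ι → 𝕜))

theorem matrixSecondCountable : SecondCountableTopology (Matrix ι ι 𝕜) :=
  inferInstanceAs (SecondCountableTopology (ι → ι → 𝕜))

attribute [local instance] matrixBorelSpace matrixSecondCountable

theorem re_trace_conjTranspose_mul_self_eq_sum (M : Matrix ι ι 𝕜) :
    RCLike.re (trace (Mᴴ * M)) = ∑ j, ∑ i, ‖M i j‖ ^ 2 := by
  simp only [trace, diag, mul_apply, conjTranspose_apply, map_sum]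
  refine Finset.sum_congr rfl fun j _ => Finset.sum_congr rfl fun i _ => ?_
  rw [RCLike.star_def, RCLike.conj_mul]
  norm_cast

variable [DecidableEq ι]

variable {Ω : Type*} [MeasurableSpace Ω] {μ : Measure Ω} [IsProbabilityMeasure μ]

/-- Continuous functions of bounded random matrices are integrable. -/
theorem integrable_continuous_comp_of_norm_le {E : Type*} [NormedAddCommGroup E]
    [ProperSpace E] [MeasurableSpace E] [BorelSpace E] {S : Ω → E} {r : ℝ} (hS : Measurable S)
    (hr : ∀ ω, ‖S ω‖ ≤ r) {f : E → ℝ} (hf : Continuous f) : Integrable (fun ω => f (S ω)) μ := by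
  obtain ⟨C, hC⟩ := (isCompact_closedBall (0 : E) r).exists_bound_of_continuousOn hf.continuousOn
  refine Integrable.of_bound (hf.measurable.comp hS).aestronglyMeasurable C
    (ae_of_all _ fun ω => ?_)
  exact hC _ (by simpa using hr ω)

theorem continuous_matrix_exp : Continuous (exp : Matrix ι ι 𝕜 → Matrix ι ι 𝕜) := by
  let _ : NormedAlgebra ℝ (Matrix ι ι 𝕜) := realNormedAlgebra
  let _ : NormedAlgebra ℚ (Matrix ι ι 𝕜) := NormedAlgebra.restrictScalars ℚ ℝ _
  convert NormedSpace.exp_continuous (𝔸 := Matrix ι ι 𝕜)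

/-- One step of the matrix Laplace transform method. -/
theorem integral_re_trace_exp_add_le {S X : Ω → Matrix ι ι 𝕜} (hSX : IndepFun S X μ)
    (hS : Measurable S) (hX : Measurable X) (hSh : ∀ ω, (S ω).IsHermitian)
    (hXh : ∀ ω, (X ω).IsHermitian) {r V : ℝ} (hSr : ∀ ω, ‖S ω‖ ≤ r) (hXr : ∀ ω, ‖X ω‖ ≤ 1)
    (hmean : ∀ i j, ∫ ω, X ω i j ∂μ = 0)
    (hvar : ∀ w : ι → 𝕜, ∫ ω, ∑ i, ‖(X ω *ᵥ w) i‖ ^ 2 ∂μ ≤ V * ∑ i, ‖w i‖ ^ 2) :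
    ∫ ω, RCLike.re (trace (exp (S ω + X ω))) ∂μ ≤
      (1 + V) * ∫ ω, RCLike.re (trace (exp (S ω))) ∂μ := by
  have : ProperSpace (Matrix ι ι 𝕜) := FiniteDimensional.proper 𝕜 _
  -- A Hermitian square root of `exp A`, which puts `trace (exp S * exp X)` into the symmetric form
  -- `trace (ρ S * exp X * ρ S)`.
  let ρ : Matrix ι ι 𝕜 → Matrix ι ι 𝕜 := fun A => exp ((2 : 𝕜)⁻¹ • A)
  have hρc : Continuous ρ := continuous_matrix_exp.comp (continuous_const_smul _)
  have hρh : ∀ A : Matrix ι ι 𝕜, A.IsHermitian → (ρ A).IsHermitian := by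
    intro A hA
    refine IsHermitian.exp ?_
    rw [IsHermitian, conjTranspose_smul, hA.eq]; simp
  have hρ2 : ∀ A : Matrix ι ι 𝕜, ρ A * ρ A = exp A := by
    intro A
    have h := Matrix.exp_nsmul 2 ((2 : 𝕜)⁻¹ • A)
    rw [pow_two] at h
    rw [← h, ← Nat.cast_smul_eq_nsmul 𝕜, smul_smul]
    simp
  -- A majorant quadratic in `B`: with `S` frozen, its mean depends on the first two moments of `X`
  -- only.
  let g : Matrix ι ι 𝕜 → Matrix ι ι 𝕜 → ℝ := fun A B =>
    RCLike.re (trace (ρ A * ρ A)) + RCLike.re (trace (ρ A * B * ρ A)) +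
      RCLike.re (trace ((B * ρ A)ᴴ * (B * ρ A)))
  have htr : Continuous fun M : Matrix ι ι 𝕜 => RCLike.re (trace M) :=
    RCLike.continuous_re.comp continuous_id.matrix_trace
  have hgc : Continuous (Function.uncurry g) := by
    have h1 : Continuous fun z : Matrix ι ι 𝕜 × Matrix ι ι 𝕜 => ρ z.1 := hρc.comp continuous_fst
    have h2 : Continuous fun z : Matrix ι ι 𝕜 × Matrix ι ι 𝕜 => z.2 := continuous_snd
    exact ((htr.comp (h1.mul h1)).add (htr.comp ((h1.mul h2).mul h1))).add
      (htr.comp ((h2.mul h1).matrix_conjTranspose.mul (h2.mul h1)))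
  have hgi : Integrable (fun ω => g (S ω) (X ω)) μ := by
    refine integrable_continuous_comp_of_norm_le (S := fun ω => (S ω, X ω)) (r := max r 1)
      (hS.prodMk hX) (fun ω => ?_) hgc
    exact max_le_max (hSr ω) (hXr ω)
  have hexpi : Integrable (fun ω => RCLike.re (trace (exp (S ω)))) μ :=
    integrable_continuous_comp_of_norm_le hS hSr (htr.comp continuous_matrix_exp)
  have hle : ∀ ω ω', RCLike.re (trace (exp (S ω + X ω'))) ≤ g (S ω) (X ω') := by
    intro ω ω'
    refine (re_trace_exp_add_le (hSh ω) (hXh ω')).trans ?_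
    rw [← hρ2 (S ω), mul_assoc, trace_mul_comm]
    exact re_trace_mul_exp_mul_le (hXh ω') (hρh _ (hSh ω)) (hXr ω')
  -- Nonnegativity of the inner integral replaces its integrability in the last comparison of outer
  -- integrals.
  have hnonneg : ∀ ω ω', 0 ≤ g (S ω) (X ω') := by
    intro ω ω'
    refine le_trans ?_ (hle ω ω')
    rw [← hρ2]
    nth_rw 1 [← (hρh _ ((hSh ω).add (hXh ω'))).eq]
    exact re_trace_conjTranspose_mul_self_nonneg _
  have hXi : ∀ f : Matrix ι ι 𝕜 → ℝ, Continuous f → Integrable (fun ω => f (X ω)) μ :=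
    fun f hf => integrable_continuous_comp_of_norm_le hX hXr hf
  have hXij : ∀ i j, Integrable (fun ω => X ω i j) μ := by
    intro i j
    refine (integrable_norm_iff ?_).1 (hXi (fun A => ‖A i j‖) ?_)
    · exact (measurable_matrix_iff.1 hX i j).aestronglyMeasurable
    · exact (continuous_id.matrix_elem i j).norm
  have hinner : ∀ ω, ∫ ω', g (S ω) (X ω') ∂μ ≤ (1 + V) * RCLike.re (trace (exp (S ω))) := by
    intro ω
    set R := ρ (S ω) with hR
    have e1 : ∫ ω', RCLike.re (trace (R * X ω' * R)) ∂μ = 0 := by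
      have h1 : ∀ ω', RCLike.re (trace (R * X ω' * R)) =
          ∑ i, ∑ j, RCLike.re ((R * R) j i * X ω' i j) := by
        intro ω'
        rw [mul_assoc, trace_mul_comm, mul_assoc]
        simp only [trace, diag, mul_apply (M := X ω'), map_sum]
        refine Finset.sum_congr rfl fun i _ => Finset.sum_congr rfl fun j _ => ?_
        rw [mul_comm]
      simp_rw [h1]
      have h2 : ∀ i j, Integrable (fun ω' => (R * R) j i * X ω' i j) μ :=
        fun i j => (hXij i j).const_mul _
      rw [integral_finsetSum _ fun i _ => integrable_finsetSum _ fun j _ => (h2 i j).re]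
      refine Finset.sum_eq_zero fun i _ => ?_
      rw [integral_finsetSum _ fun j _ => (h2 i j).re]
      refine Finset.sum_eq_zero fun j _ => ?_
      rw [integral_re (h2 i j), integral_const_mul, hmean, mul_zero, map_zero]
    have hRR : RCLike.re (trace (exp (S ω))) = ∑ j, ∑ i, ‖R i j‖ ^ 2 := by
      rw [← re_trace_conjTranspose_mul_self_eq_sum, (hρh _ (hSh ω)).eq, hρ2]
    -- The variance hypothesis, used on each column of `R`; the squared column norms add up to
    -- `trace (exp (S ω))`.
    have e2 : ∫ ω', RCLike.re (trace ((X ω' * R)ᴴ * (X ω' * R))) ∂μ ≤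
        V * RCLike.re (trace (exp (S ω))) := by
      simp_rw [re_trace_conjTranspose_mul_self_eq_sum]
      rw [integral_finsetSum, hRR, Finset.mul_sum]
      · refine Finset.sum_le_sum fun j _ => ?_
        exact hvar fun i => R i j
      · intro j _
        refine hXi (fun A => ∑ i, ‖(A * R) i j‖ ^ 2) ?_
        exact continuous_finsetSum _ fun i _ =>
          (((continuous_id.mul continuous_const).matrix_elem i j).norm.pow 2)
    have i1 : Integrable (fun ω' => RCLike.re (trace (R * X ω' * R))) μ :=
      hXi (fun A => RCLike.re (trace (R * A * R))) (htr.comp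
        ((continuous_const.mul continuous_id).mul continuous_const))
    have i2 : Integrable (fun ω' => RCLike.re (trace ((X ω' * R)ᴴ * (X ω' * R)))) μ :=
      hXi (fun A => RCLike.re (trace ((A * R)ᴴ * (A * R)))) (htr.comp
        ((continuous_id.mul continuous_const).matrix_conjTranspose.mul
          (continuous_id.mul continuous_const)))
    have e3 : ∫ ω', g (S ω) (X ω') ∂μ = RCLike.re (trace (exp (S ω))) +
        ∫ ω', RCLike.re (trace (R * X ω' * R)) ∂μ +
        ∫ ω', RCLike.re (trace ((X ω' * R)ᴴ * (X ω' * R))) ∂μ := by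
      have h0 : Integrable (fun _ : Ω => RCLike.re (trace (R * R))) μ := integrable_const _
      have h01 : Integrable (fun ω' => RCLike.re (trace (R * R)) +
          RCLike.re (trace (R * X ω' * R))) μ := h0.add i1
      change ∫ ω', (RCLike.re (trace (R * R)) + RCLike.re (trace (R * X ω' * R)) +
        RCLike.re (trace ((X ω' * R)ᴴ * (X ω' * R)))) ∂μ = _
      rw [integral_add h01 i2, integral_add h0 i1, integral_const, hR, hρ2]
      simp
    rw [e3, e1]
    linarith
  calc ∫ ω, RCLike.re (trace (exp (S ω + X ω))) ∂μ ≤ ∫ ω, g (S ω) (X ω) ∂μ := by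
        refine integral_mono ?_ hgi fun ω => hle ω ω
        refine integrable_continuous_comp_of_norm_le (S := fun ω => S ω + X ω) (r := r + 1)
          (hS.add hX) (fun ω => ?_) (htr.comp continuous_matrix_exp)
        exact (norm_add_le _ _).trans (add_le_add (hSr ω) (hXr ω))
    _ = ∫ ω, ∫ ω', g (S ω) (X ω') ∂μ ∂μ :=
        integral_comp_of_indepFun hSX hS hX hgc.aestronglyMeasurable hgi
    _ ≤ ∫ ω, (1 + V) * RCLike.re (trace (exp (S ω))) ∂μ := by
        exact integral_mono_of_nonneg
          (ae_of_all _ fun ω => integral_nonneg fun ω' => hnonneg ω ω')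
          (hexpi.const_mul _) (ae_of_all _ hinner)
    _ = _ := integral_const_mul _ _

/-- The matrix Laplace transform bound for sums of independent bounded centered matrices. -/
theorem integral_re_trace_exp_sum_le {κ : Type*} {X : κ → Ω → Matrix ι ι 𝕜}
    (hmeas : ∀ k, Measurable (X k)) (hherm : ∀ k ω, (X k ω).IsHermitian)
    (hind : ∀ (s : Finset κ) (a : κ), a ∉ s → IndepFun (fun ω => ∑ k ∈ s, X k ω) (X a) μ)
    {R V : ℝ} (hV : 0 ≤ V) (hR : ∀ k ω, ‖X k ω‖ ≤ R) (hmean : ∀ k i j, ∫ ω, X k ω i j ∂μ = 0)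
    (hvar : ∀ k (w : ι → 𝕜), ∫ ω, ∑ i, ‖(X k ω *ᵥ w) i‖ ^ 2 ∂μ ≤ V * ∑ i, ‖w i‖ ^ 2)
    {θ : ℝ} (hθ : |θ| * R ≤ 1) (s : Finset κ) :
    ∫ ω, RCLike.re (trace (exp ((θ : 𝕜) • ∑ k ∈ s, X k ω))) ∂μ ≤
      Fintype.card ι * Real.exp (s.card * (θ ^ 2 * V)) := by
  classical
  have hsm : ∀ A : Matrix ι ι 𝕜, A.IsHermitian → ((θ : 𝕜) • A).IsHermitian := by
    intro A hA
    rw [IsHermitian, conjTranspose_smul, hA.eq]; simp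
  have hmc : Measurable fun A : Matrix ι ι 𝕜 => (θ : 𝕜) • A :=
    (continuous_const_smul _).measurable
  induction s using Finset.induction_on with
  -- The exponential of the empty sum is the identity, whose trace is the dimensional factor.
  | empty => simp [trace_one]
  | insert a s ha ih =>
    have hsum : ∀ ω, (θ : 𝕜) • ∑ k ∈ insert a s, X k ω =
        (θ : 𝕜) • ∑ k ∈ s, X k ω + (θ : 𝕜) • X a ω := by
      intro ω; rw [Finset.sum_insert ha, smul_add, add_comm]
    simp_rw [hsum]
    have hstep := integral_re_trace_exp_add_le (μ := μ)
      (S := fun ω => (θ : 𝕜) • ∑ k ∈ s, X k ω) (X := fun ω => (θ : 𝕜) • X a ω)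
      (r := |θ| * ∑ k ∈ s, R) (V := θ ^ 2 * V)
      ((hind s a ha).comp hmc hmc) (hmc.comp (Finset.measurable_fun_sum s fun k _ => hmeas k))
      (hmc.comp (hmeas a))
      (fun ω => hsm _ (by
        rw [IsHermitian, conjTranspose_sum]
        exact Finset.sum_congr rfl fun k _ => (hherm k ω).eq))
      (fun ω => hsm _ (hherm a ω))
      (fun ω => by
        rw [norm_smul, RCLike.norm_ofReal]
        gcongr
        exact (norm_sum_le _ _).trans (Finset.sum_le_sum fun k _ => hR k ω))
      (fun ω => by
        rw [norm_smul, RCLike.norm_ofReal]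
        exact (mul_le_mul_of_nonneg_left (hR a ω) (abs_nonneg _)).trans hθ)
      (fun i j => by
        change ∫ ω, (θ : 𝕜) * X a ω i j ∂μ = 0
        rw [integral_const_mul, hmean, mul_zero])
      (fun w => by
        simp only [smul_mulVec, Pi.smul_apply, norm_smul, RCLike.norm_ofReal, mul_pow, sq_abs]
        simp_rw [← Finset.mul_sum]
        rw [integral_const_mul, mul_assoc]
        exact mul_le_mul_of_nonneg_left (hvar a w) (sq_nonneg _))
    refine hstep.trans ?_
    calc (1 + θ ^ 2 * V) * ∫ ω, RCLike.re (trace (exp ((θ : 𝕜) • ∑ k ∈ s, X k ω))) ∂μ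
        ≤ Real.exp (θ ^ 2 * V) * (Fintype.card ι * Real.exp (s.card * (θ ^ 2 * V))) := by
          refine (mul_le_mul_of_nonneg_left ih (by positivity)).trans ?_
          gcongr
          rw [add_comm]
          exact Real.add_one_le_exp _
      _ = _ := by
        rw [Finset.card_insert_of_notMem ha, mul_left_comm, ← Real.exp_add]
        congr 2
        push_cast
        ring

/-- The matrix Bernstein inequality. -/
theorem matrix_bernstein [Nonempty ι] {n : ℕ} (hn : 1 ≤ n) {X : Fin n → Ω → Matrix ι ι 𝕜}
    (hmeas : ∀ k, Measurable (X k)) (hherm : ∀ k ω, (X k ω).IsHermitian)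
    (hind : ∀ (s : Finset (Fin n)) (a : Fin n), a ∉ s →
      IndepFun (fun ω => ∑ k ∈ s, X k ω) (X a) μ)
    {R V : ℝ} (hR0 : 0 < R) (hV : 0 < V) (hR : ∀ k ω, ‖X k ω‖ ≤ R)
    (hmean : ∀ k i j, ∫ ω, X k ω i j ∂μ = 0)
    (hvar : ∀ k (w : ι → 𝕜), ∫ ω, ∑ i, ‖(X k ω *ᵥ w) i‖ ^ 2 ∂μ ≤ V * ∑ i, ‖w i‖ ^ 2)
    {L : ℝ} (hL : 0 < L) :
    μ.real {ω | 2 * √(n * V * L) + 2 * R * L ≤ ‖∑ k, X k ω‖} ≤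
      2 * Fintype.card ι * Real.exp (-L) := by
  have : ProperSpace (Matrix ι ι 𝕜) := FiniteDimensional.proper 𝕜 _
  have hn0 : (0 : ℝ) < n := by exact_mod_cast hn
  set u := 2 * √(n * V * L) + 2 * R * L with hu
  -- The exponent `θ * u - n * θ² * V` has to reach `L` under `θ * R ≤ 1`. If allowed, `θ = L / √(n
  -- * V * L)` is taken: the square root part of `u` gives `2 * L` and the variance costs `L`.
  -- Otherwise `θ = 1 / R`: the linear part of `u` gives `2 * L`, and the variance costs at most `L`
  -- because `√(n * V * L) ≤ L * R`.
  obtain ⟨θ, hθ0, hθR, hθu⟩ : ∃ θ : ℝ, 0 < θ ∧ θ * R ≤ 1 ∧ L ≤ θ * u - n * (θ ^ 2 * V) := by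
    have hsq : √(n * V * L) ^ 2 = n * V * L := Real.sq_sqrt (by positivity)
    have hsp : 0 < √(n * V * L) := Real.sqrt_pos.2 (by positivity)
    rcases le_total (L * R) √(n * V * L) with h | h
    · refine ⟨L / √(n * V * L), by positivity, ?_, ?_⟩
      · rw [div_mul_eq_mul_div, div_le_one hsp]; exact h
      · have h1 : n * ((L / √(n * V * L)) ^ 2 * V) = L := by
          rw [div_pow, hsq]; field_simp
        have h2 : L / √(n * V * L) * u = 2 * L + L / √(n * V * L) * (2 * R * L) := by
          rw [hu, mul_add]; congr 1; field_simp
        rw [h1, h2]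
        have : 0 ≤ L / √(n * V * L) * (2 * R * L) := by positivity
        linarith
    · refine ⟨R⁻¹, by positivity, by rw [inv_mul_cancel₀ hR0.ne'], ?_⟩
      have h1 : n * V * L ≤ (L * R) ^ 2 := by rw [← hsq]; gcongr
      have h2 : n * (R⁻¹ ^ 2 * V) ≤ L := by
        rw [inv_pow, inv_mul_eq_div, ← mul_div_assoc, div_le_iff₀ (by positivity)]
        have : n * V * L ≤ (L * R ^ 2) * L := by nlinarith
        exact le_of_mul_le_mul_right this hL
      have h3 : R⁻¹ * u = 2 * L + R⁻¹ * (2 * √(n * V * L)) := by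
        rw [hu, mul_add, add_comm]; congr 1; field_simp
      rw [h3]
      have : 0 ≤ R⁻¹ * (2 * √(n * V * L)) := by positivity
      linarith
  set F : Ω → ℝ := fun ω => RCLike.re (trace (exp ((θ : 𝕜) • ∑ k, X k ω))) +
    RCLike.re (trace (exp (((-θ : ℝ) : 𝕜) • ∑ k, X k ω))) with hF
  have hSmeas : Measurable fun ω => ∑ k, X k ω :=
    Finset.measurable_fun_sum _ fun k _ => hmeas k
  have hSr : ∀ ω, ‖∑ k, X k ω‖ ≤ ∑ _k : Fin n, R := fun ω =>
    (norm_sum_le _ _).trans (Finset.sum_le_sum fun k _ => hR k ω)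
  have hSh : ∀ ω, (∑ k, X k ω).IsHermitian := fun ω => by
    rw [IsHermitian, conjTranspose_sum]
    exact Finset.sum_congr rfl fun k _ => (hherm k ω).eq
  have hi : ∀ c : 𝕜, Integrable (fun ω => RCLike.re (trace (exp (c • ∑ k, X k ω)))) μ := fun c =>
    integrable_continuous_comp_of_norm_le hSmeas hSr
      (f := fun A => RCLike.re (trace (exp (c • A)))) (RCLike.continuous_re.comp
        (continuous_matrix_exp.comp (continuous_const_smul c)).matrix_trace)
  have hFi : Integrable F μ := (hi _).add (hi _)
  have hexp : ∀ ω, Real.exp (θ * ‖∑ k, X k ω‖) ≤ F ω := by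
    intro ω
    have h1 : ((θ : 𝕜) • ∑ k, X k ω).IsHermitian := by
      rw [IsHermitian, conjTranspose_smul, (hSh ω).eq]; simp
    have h2 := exp_norm_le_re_trace_exp_add h1
    rw [norm_smul, RCLike.norm_ofReal, abs_of_pos hθ0] at h2
    rw [hF]
    simpa using h2
  have hFint : ∫ ω, F ω ∂μ ≤ 2 * Fintype.card ι * Real.exp (n * (θ ^ 2 * V)) := by
    rw [hF, integral_add (hi _) (hi _)]
    have h1 := integral_re_trace_exp_sum_le hmeas hherm hind hV.le hR hmean hvar (θ := θ)
      (by rwa [abs_of_pos hθ0]) Finset.univ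
    have h2 := integral_re_trace_exp_sum_le hmeas hherm hind hV.le hR hmean hvar (θ := -θ)
      (by rwa [abs_neg, abs_of_pos hθ0]) Finset.univ
    rw [Finset.card_univ, Fintype.card_fin] at h1 h2
    rw [neg_sq] at h2
    linarith
  have hmarkov := mul_meas_ge_le_integral_of_nonneg
    (ae_of_all μ fun ω => (Real.exp_pos _).le.trans (hexp ω)) hFi (Real.exp (θ * u))
  have hsub : {ω | u ≤ ‖∑ k, X k ω‖} ⊆ {ω | Real.exp (θ * u) ≤ F ω} := by
    intro ω (hω : u ≤ _)
    refine le_trans ?_ (hexp ω)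
    gcongr
  have hmono : μ.real {ω | u ≤ ‖∑ k, X k ω‖} ≤ μ.real {ω | Real.exp (θ * u) ≤ F ω} :=
    measureReal_mono hsub
  have h1 : Real.exp (θ * u) * μ.real {ω | u ≤ ‖∑ k, X k ω‖} ≤
      2 * Fintype.card ι * Real.exp (n * (θ ^ 2 * V)) :=
    (mul_le_mul_of_nonneg_left hmono (Real.exp_pos _).le).trans (hmarkov.trans hFint)
  have h2 : μ.real {ω | u ≤ ‖∑ k, X k ω‖} ≤
      2 * Fintype.card ι * Real.exp (n * (θ ^ 2 * V)) * Real.exp (-(θ * u)) := by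
    rw [Real.exp_neg, ← div_eq_mul_inv, le_div_iff₀ (Real.exp_pos _)]
    linarith
  refine h2.trans ?_
  rw [mul_assoc, ← Real.exp_add]
  gcongr
  linarith

end MatrixBernstein

/-! ### Perturbation of orthogonal projections -/

section ProjectionDistance

variable {𝕜 E : Type*} [RCLike 𝕜] [NormedAddCommGroup E] [InnerProductSpace 𝕜 E]

local notation "⟪" x "," y "⟫" => inner 𝕜 x y

/-- If `A` is at most `b` on the range of the projection `Q`, and `B` is at least `a` on the range
of the projection `Q'`, then `Q Q'` is at most `‖A - B‖ / (a - b)`. -/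
theorem sub_mul_norm_projection_comp_le [FiniteDimensional 𝕜 E] {A B Q Q' : E →L[𝕜] E} {a b : ℝ}
    (hQ : ∀ x y, ⟪Q x, y⟫ = ⟪x, Q y⟫) (hQ' : ∀ x y, ⟪Q' x, y⟫ = ⟪x, Q' y⟫)
    (hQQ : ∀ x, Q (Q x) = Q x) (hQQ' : ∀ x, Q' (Q' x) = Q' x)
    (hAQ : ∀ x, A (Q x) = Q (A x)) (hBQ' : ∀ x, B (Q' x) = Q' (B x))
    (hA : ∀ x, Q x = x → RCLike.re ⟪x, A x⟫ ≤ b * ‖x‖ ^ 2)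
    (hB : ∀ x, Q' x = x → a * ‖x‖ ^ 2 ≤ RCLike.re ⟪x, B x⟫) :
    ∃ M, 0 ≤ M ∧ (a - b) * M ≤ ‖A - B‖ ∧
      ∀ x, ‖Q (Q' x)‖ ≤ M * ‖x‖ ∧ ‖Q' (Q x)‖ ≤ M * ‖x‖ := by
  have := FiniteDimensional.proper 𝕜 E
  rcases subsingleton_or_nontrivial E with hE | hE
  · refine ⟨0, le_rfl, by simp, fun x => ?_⟩
    rw [Subsingleton.elim (Q (Q' x)) 0, Subsingleton.elim (Q' (Q x)) 0]; simp
  obtain ⟨e, he⟩ := exists_ne (0 : E)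
  -- By compactness the norm `σ` of `Q Q'` is attained; the maximizer is a singular vector.
  obtain ⟨x, hx1, hxmax⟩ := (isCompact_sphere (0 : E) 1).exists_isMaxOn
    (f := fun y => ‖Q (Q' y)‖) ⟨((‖e‖⁻¹ : ℝ) : 𝕜) • e, by simp [norm_smul, he]⟩
    (by fun_prop)
  rw [mem_sphere_zero_iff_norm] at hx1
  set σ := ‖Q (Q' x)‖ with hσ
  have hσ0 : 0 ≤ σ := norm_nonneg _
  have h1 : ∀ y, ‖Q (Q' y)‖ ≤ σ * ‖y‖ := by
    intro y
    rcases eq_or_ne y 0 with rfl | hy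
    · simp
    · have h := hxmax (a := ((‖y‖⁻¹ : ℝ) : 𝕜) • y) (by simp [norm_smul, hy])
      simp only [Set.mem_ofPred_eq, map_smul, norm_smul, RCLike.norm_ofReal, abs_inv,
        abs_norm] at h
      rwa [inv_mul_le_iff₀ (norm_pos_iff.2 hy), mul_comm] at h
  have h2 : ∀ y, ‖Q' (Q y)‖ ≤ σ * ‖y‖ := by
    intro y
    have h3 : ‖Q' (Q y)‖ ^ 2 ≤ (σ * ‖y‖) * ‖Q' (Q y)‖ := by
      calc ‖Q' (Q y)‖ ^ 2 = RCLike.re ⟪Q' (Q y), Q' (Q y)⟫ := (inner_self_eq_norm_sq _).symm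
        _ = RCLike.re ⟪y, Q (Q' (Q' (Q y)))⟫ := by rw [hQ', hQ]
        _ ≤ ‖y‖ * ‖Q (Q' (Q' (Q y)))‖ := re_inner_le_norm _ _
        _ ≤ ‖y‖ * (σ * ‖Q' (Q y)‖) := by gcongr; exact h1 _
        _ = _ := by ring
    rcases (norm_nonneg (Q' (Q y))).eq_or_lt with h0 | h0
    · rw [← h0]; positivity
    · rw [pow_two] at h3; exact le_of_mul_le_mul_right h3 h0
  refine ⟨σ, hσ0, ?_, fun y => ⟨h1 y, h2 y⟩⟩
  rcases hσ0.eq_or_lt with h0 | h0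
  · rw [← h0]; simp
  have hYY : Q' (Q (Q' x)) = ((σ ^ 2 : ℝ) : 𝕜) • x := by
    have h3 : ‖Q' (Q (Q' x))‖ ≤ σ ^ 2 := by
      rw [← hQQ]
      exact (h2 _).trans_eq (by rw [← hσ]; ring)
    have h4 : RCLike.re ⟪Q' (Q (Q' x)), x⟫ = σ ^ 2 := by
      rw [hQ', ← hQQ, hQ, inner_self_eq_norm_sq]
    -- Equality case of Cauchy–Schwarz: expanding the square gives at most `σ⁴ - 2 * σ⁴ + σ⁴`.
    have h5 : ‖Q' (Q (Q' x)) - ((σ ^ 2 : ℝ) : 𝕜) • x‖ ^ 2 ≤ 0 := by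
      rw [norm_sub_sq (𝕜 := 𝕜), inner_smul_right, RCLike.re_ofReal_mul, h4, norm_smul,
        RCLike.norm_ofReal, hx1, mul_one, sq_abs]
      nlinarith [norm_nonneg (Q' (Q (Q' x))), sq_nonneg σ]
    rw [← sub_eq_zero, ← norm_eq_zero]
    exact pow_eq_zero_iff two_ne_zero |>.1 (le_antisymm h5 (sq_nonneg _))
  have hxQ' : Q' x = x := by
    have h3 : ((σ ^ 2 : ℝ) : 𝕜) • Q' x = ((σ ^ 2 : ℝ) : 𝕜) • x := by
      rw [← map_smul, ← hYY, hQQ']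
    exact smul_right_injective E (by exact_mod_cast (pow_pos h0 2).ne') h3
  rw [hxQ'] at hσ hYY
  -- Testing `B - A` between `Q x` and `x`: commutation and `Q' (Q x) = σ² x` reduce the `B` term to
  -- the range of `Q'`, and the `A` term reduces to the range of `Q`. Thus `(a - b) * σ² ≤ σ * ‖A -
  -- B‖`.
  have hBx : a * σ ^ 2 ≤ RCLike.re ⟪Q x, B x⟫ := by
    have h3 : ⟪Q x, B x⟫ = ((σ ^ 2 : ℝ) : 𝕜) * ⟪x, B x⟫ := by
      conv_lhs => rw [← hxQ', hBQ', ← hQ', hxQ', hYY, inner_smul_left, RCLike.conj_ofReal]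
    rw [h3, RCLike.re_ofReal_mul]
    have h4 := hB x hxQ'
    rw [hx1] at h4
    nlinarith [sq_nonneg σ]
  have hAx : RCLike.re ⟪Q x, A x⟫ ≤ b * σ ^ 2 := by
    have h3 : ⟪Q x, A x⟫ = ⟪Q x, A (Q x)⟫ := by
      conv_lhs => rw [← hQQ x, hQ, ← hAQ]
    rw [h3, hσ]
    exact hA _ (hQQ x)
  have hle : RCLike.re ⟪Q x, (B - A) x⟫ ≤ σ * ‖A - B‖ := by
    refine (re_inner_le_norm _ _).trans ?_
    rw [← hσ, norm_sub_rev A B]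
    refine mul_le_mul_of_nonneg_left ?_ hσ0
    exact ((B - A).le_opNorm x).trans_eq (by rw [hx1, mul_one])
  rw [sub_apply, inner_sub_right, map_sub] at hle
  refine le_of_mul_le_mul_left ?_ h0
  nlinarith

/-- The distance of two orthogonal projections is bounded through their two mixed products. -/
theorem norm_projection_sub_le {P P' : E →L[𝕜] E} {η : ℝ} (hη : 0 ≤ η)
    (hP : ∀ x y, ⟪P x, y⟫ = ⟪x, P y⟫) (hP' : ∀ x y, ⟪P' x, y⟫ = ⟪x, P' y⟫)
    (hPP : ∀ x, P (P x) = P x) (hPP' : ∀ x, P' (P' x) = P' x)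
    (h1 : ∀ x, ‖P (x - P' x)‖ ≤ η * ‖x‖) (h2 : ∀ x, ‖P' x - P (P' x)‖ ≤ η * ‖x‖) :
    ‖P - P'‖ ≤ η := by
  have hpyth : ∀ (R : E →L[𝕜] E), (∀ x y, ⟪R x, y⟫ = ⟪x, R y⟫) → (∀ x, R (R x) = R x) →
      ∀ x y, ⟪R x, y - R y⟫ = 0 := by
    intro R hR hRR x y
    rw [hR, map_sub, hRR, sub_self, inner_zero_right]
  refine ContinuousLinearMap.opNorm_le_bound _ hη fun x => ?_
  -- The two pieces lie in the range of `P` and in its orthogonal complement, so their squared norms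
  -- add.
  have e1 : (P - P') x = P (x - P' x) - (P' x - P (P' x)) := by
    rw [sub_apply, map_sub]; abel
  have e2 : ‖(P - P') x‖ ^ 2 = ‖P (x - P' x)‖ ^ 2 + ‖P' x - P (P' x)‖ ^ 2 := by
    rw [e1, norm_sub_sq (𝕜 := 𝕜), hpyth P hP hPP]; simp
  have e3 : ‖x‖ ^ 2 = ‖P' x‖ ^ 2 + ‖x - P' x‖ ^ 2 := by
    conv_lhs => rw [← add_sub_cancel (P' x) x]
    rw [norm_add_sq (𝕜 := 𝕜), hpyth P' hP' hPP']; simp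
  -- Evaluating at the two orthogonal components of `x` sharpens the hypotheses: the squares then
  -- sum to `η² * ‖x‖²`, and no factor `2` is lost.
  have e4 := h1 (x - P' x)
  rw [map_sub P' x, hPP', sub_self, sub_zero] at e4
  have e5 := h2 (P' x)
  rw [hPP'] at e5
  refine le_of_sq_le_sq ?_ (by positivity)
  rw [e2, mul_pow, e3]
  have e6 := pow_le_pow_left₀ (norm_nonneg _) e4 2
  have e7 := pow_le_pow_left₀ (norm_nonneg _) e5 2
  rw [mul_pow] at e6 e7
  linarith

theorem norm_projection_le {P : E →L[𝕜] E} (hP : ∀ x y, ⟪P x, y⟫ = ⟪x, P y⟫)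
    (hPP : ∀ x, P (P x) = P x) (x : E) : ‖P x‖ ≤ ‖x‖ := by
  have h : ‖P x‖ ^ 2 ≤ ‖x‖ * ‖P x‖ := by
    rw [← inner_self_eq_norm_sq (𝕜 := 𝕜), hP, hPP]
    exact re_inner_le_norm _ _
  rcases (norm_nonneg (P x)).eq_or_lt with h0 | h0
  · rw [← h0]; positivity
  · rw [pow_two] at h; exact le_of_mul_le_mul_right h h0

theorem norm_projection_sub_le_one {P P' : E →L[𝕜] E}
    (hP : ∀ x y, ⟪P x, y⟫ = ⟪x, P y⟫) (hP' : ∀ x y, ⟪P' x, y⟫ = ⟪x, P' y⟫)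
    (hPP : ∀ x, P (P x) = P x) (hPP' : ∀ x, P' (P' x) = P' x) : ‖P - P'‖ ≤ 1 := by
  have hc : ∀ R : E →L[𝕜] E, (∀ x y, ⟪R x, y⟫ = ⟪x, R y⟫) → (∀ x, R (R x) = R x) →
      ∀ x, ‖x - R x‖ ≤ ‖x‖ := fun R hR hRR x =>
    norm_projection_le (P := ContinuousLinearMap.id 𝕜 E - R) (fun x y => by
      change ⟪x - R x, y⟫ = ⟪x, y - R y⟫
      rw [inner_sub_left, inner_sub_right, hR]) (fun x => by
      change x - R x - R (x - R x) = x - R x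
      rw [map_sub, hRR, sub_self, sub_zero]) x
  refine norm_projection_sub_le zero_le_one hP hP' hPP hPP' (fun x => ?_) (fun x => ?_)
  · rw [one_mul]
    exact (norm_projection_le hP hPP _).trans (hc P' hP' hPP' x)
  · rw [one_mul]
    exact (hc P hP hPP _).trans (norm_projection_le hP' hPP' x)

/-- Perturbation of spectral projections across gaps of size at least `d`. -/
theorem half_gap_mul_norm_projection_sub_le [FiniteDimensional 𝕜 E] {A B P P' : E →L[𝕜] E}
    {a a' b b' d : ℝ} (hd : 0 < d)
    (hP : ∀ x y, ⟪P x, y⟫ = ⟪x, P y⟫) (hP' : ∀ x y, ⟪P' x, y⟫ = ⟪x, P' y⟫)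
    (hPP : ∀ x, P (P x) = P x) (hPP' : ∀ x, P' (P' x) = P' x)
    (hA : ∀ x, A (P x) = P (A x)) (hB : ∀ x, B (P' x) = P' (B x))
    (hA1 : ∀ x, P x = x → a * ‖x‖ ^ 2 ≤ RCLike.re ⟪x, A x⟫)
    (hA2 : ∀ x, P x = 0 → RCLike.re ⟪x, A x⟫ ≤ a' * ‖x‖ ^ 2)
    (hB1 : ∀ x, P' x = x → b * ‖x‖ ^ 2 ≤ RCLike.re ⟪x, B x⟫)
    (hB2 : ∀ x, P' x = 0 → RCLike.re ⟪x, B x⟫ ≤ b' * ‖x‖ ^ 2)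
    (h1 : d ≤ b - a') (h2 : d ≤ a - b') : d * ‖P - P'‖ ≤ ‖A - B‖ := by
  have hc1 : ∀ R : E →L[𝕜] E, (∀ x y, ⟪R x, y⟫ = ⟪x, R y⟫) →
      ∀ x y, ⟪x - R x, y⟫ = ⟪x, y - R y⟫ := fun R hR x y => by
    rw [inner_sub_left, inner_sub_right, hR]
  have hc2 : ∀ R : E →L[𝕜] E, (∀ x, R (R x) = R x) → ∀ x, x - R x - R (x - R x) = x - R x :=
    fun R hRR x => by rw [map_sub, hRR, sub_self, sub_zero]
  have hc3 : ∀ T R : E →L[𝕜] E, (∀ x, T (R x) = R (T x)) → ∀ x, T (x - R x) = T x - R (T x) :=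
    fun T R h x => by rw [map_sub, h]
  -- The gap `b - a'` controls `(1 - P) P'`, and below the gap `a - b'` controls `(1 - P') P`, whose
  -- adjoint order is the one needed.
  obtain ⟨M₁, hM₁, hM₁', hb₁⟩ := sub_mul_norm_projection_comp_le
    (A := A) (B := B) (Q := ContinuousLinearMap.id 𝕜 E - P) (Q' := P')
    (hc1 P hP) hP' (hc2 P hPP) hPP' (hc3 A P hA) hB
    (fun x hx => hA2 x (sub_eq_self.1 hx)) hB1
  obtain ⟨M₂, hM₂, hM₂', hb₂⟩ := sub_mul_norm_projection_comp_le
    (A := B) (B := A) (Q := ContinuousLinearMap.id 𝕜 E - P') (Q' := P)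
    (hc1 P' hP') hP (hc2 P' hPP') hPP (hc3 B P' hB) hA
    (fun x hx => hB2 x (sub_eq_self.1 hx)) hA1
  rw [norm_sub_rev] at hM₂'
  have hη1 : M₁ ≤ ‖A - B‖ / d := by
    rw [le_div_iff₀ hd]; nlinarith [mul_le_mul_of_nonneg_right h1 hM₁]
  have hη2 : M₂ ≤ ‖A - B‖ / d := by
    rw [le_div_iff₀ hd]; nlinarith [mul_le_mul_of_nonneg_right h2 hM₂]
  rw [mul_comm, ← le_div_iff₀ hd]
  refine norm_projection_sub_le (by positivity) hP hP' hPP hPP' (fun x => ?_) (fun x => ?_)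
  · exact (hb₂ x).2.trans (by gcongr)
  · exact (hb₁ x).1.trans (by gcongr)

end ProjectionDistance

/-! ### Weyl's inequality and the Davis–Kahan theorem -/

section Eigenvalues

open Matrix

variable {𝕜 : Type*} [RCLike 𝕜] {p : ℕ}

local notation "⟪" x "," y "⟫" => inner 𝕜 x y

local notation "𝓣" => Matrix.toEuclideanCLM (n := Fin p) (𝕜 := 𝕜)

/-- `eigval` counts from one and `Fin p` from zero, hence the shift by one here and below. -/
theorem eigval_succ_antitone {A : Matrix (Fin p) (Fin p) 𝕜} (hA : A.IsHermitian) {i j : Fin p}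
    (hij : i ≤ j) : eigval A (j + 1) ≤ eigval A (i + 1) := by
  have h1 : A.IsHermitian ∧ 1 ≤ (i : ℕ) + 1 ∧ (i : ℕ) + 1 ≤ p := ⟨hA, by omega, by omega⟩
  have h2 : A.IsHermitian ∧ 1 ≤ (j : ℕ) + 1 ∧ (j : ℕ) + 1 ≤ p := ⟨hA, by omega, by omega⟩
  rw [eigval, eigval, dif_pos h1, dif_pos h2]
  exact hA.eigenvalues₀_antitone hij

/-- An orthonormal basis of eigenvectors in decreasing order of the eigenvalues. -/
theorem exists_orthonormalBasis_eigval {A : Matrix (Fin p) (Fin p) 𝕜} (hA : A.IsHermitian) :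
    ∃ b : OrthonormalBasis (Fin p) 𝕜 (EuclideanSpace 𝕜 (Fin p)),
      ∀ i, 𝓣 A (b i) = (eigval A (i + 1) : 𝕜) • b i := by
  refine ⟨((isSymmetric_toEuclideanLin_iff.mpr hA).eigenvectorBasis
    finrank_euclideanSpace).reindex (finCongr (Fintype.card_fin p)), fun i => ?_⟩
  have h1 : A.IsHermitian ∧ 1 ≤ (i : ℕ) + 1 ∧ (i : ℕ) + 1 ≤ p := ⟨hA, by omega, by omega⟩
  rw [eigval, dif_pos h1, OrthonormalBasis.reindex_apply]
  exact (isSymmetric_toEuclideanLin_iff.mpr hA).apply_eigenvectorBasis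
    finrank_euclideanSpace _

theorem inner_toEuclideanCLM_left {A : Matrix (Fin p) (Fin p) 𝕜} (hA : A.IsHermitian)
    (x y : EuclideanSpace 𝕜 (Fin p)) : ⟪𝓣 A x, y⟫ = ⟪x, 𝓣 A y⟫ :=
  (isSymmetric_toEuclideanLin_iff.mpr hA) x y

theorem re_inner_toEuclideanCLM_eq_sum {A : Matrix (Fin p) (Fin p) 𝕜} (hA : A.IsHermitian)
    {b : OrthonormalBasis (Fin p) 𝕜 (EuclideanSpace 𝕜 (Fin p))}
    (hb : ∀ i, 𝓣 A (b i) = (eigval A (i + 1) : 𝕜) • b i) (x : EuclideanSpace 𝕜 (Fin p)) :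
    RCLike.re ⟪x, 𝓣 A x⟫ = ∑ i : Fin p, eigval A (i + 1) * ‖⟪b i, x⟫‖ ^ 2 := by
  rw [← b.sum_inner_mul_inner, map_sum]
  refine Finset.sum_congr rfl fun i _ => ?_
  rw [← inner_toEuclideanCLM_left hA, hb, inner_smul_left, RCLike.conj_ofReal, mul_left_comm,
    RCLike.re_ofReal_mul, inner_mul_symm_re_eq_norm, norm_mul, norm_inner_symm x, pow_two]

/-- Monotonicity of the ordered eigenvalues with respect to the quadratic form. -/
theorem eigval_le_eigval_add_of_le {A B : Matrix (Fin p) (Fin p) 𝕜} (hA : A.IsHermitian)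
    (hB : B.IsHermitian) {c : ℝ}
    (h : ∀ x, RCLike.re ⟪x, 𝓣 A x⟫ ≤ RCLike.re ⟪x, 𝓣 B x⟫ + c * ‖x‖ ^ 2) (k : Fin p) :
    eigval A (k + 1) ≤ eigval B (k + 1) + c := by
  obtain ⟨b, hb⟩ := exists_orthonormalBasis_eigval hA
  obtain ⟨c, hc⟩ := exists_orthonormalBasis_eigval hB
  -- Courant–Fischer by dimension count: `p - 1` linear conditions leave a nonzero `x` orthogonal to
  -- the eigenvectors of `B` before `k` and to those of `A` after `k`. On it the form of `A` is at
  -- least its eigenvalue at `k`, and that of `B` at most its own.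
  let f : EuclideanSpace 𝕜 (Fin p) →ₗ[𝕜] ({i : Fin p // i ≠ k} → 𝕜) :=
    LinearMap.pi fun i => (innerSL 𝕜 (if i.1 < k then c i.1 else b i.1)).toLinearMap
  obtain ⟨x, hx, hx0⟩ := (Submodule.ne_bot_iff _).1 (LinearMap.ker_ne_bot_of_finrank_lt (f := f)
    (by
      rw [Module.finrank_fintype_fun_eq_card, finrank_euclideanSpace, Fintype.card_subtype_compl,
        Fintype.card_subtype_eq, Fintype.card_fin]
      have := k.2
      omega))
  have hfx : ∀ i : Fin p, i ≠ k → ⟪if i < k then c i else b i, x⟫ = 0 := fun i hi =>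
    congrFun (LinearMap.mem_ker.1 hx) ⟨i, hi⟩
  have hxpos : 0 < ‖x‖ ^ 2 := by positivity
  have h1 : eigval A (k + 1) * ‖x‖ ^ 2 ≤ RCLike.re ⟪x, 𝓣 A x⟫ := by
    rw [re_inner_toEuclideanCLM_eq_sum hA hb, ← b.sum_sq_norm_inner_right, Finset.mul_sum]
    refine Finset.sum_le_sum fun i _ => ?_
    rcases le_or_gt i k with h | h
    · exact mul_le_mul_of_nonneg_right (eigval_succ_antitone hA h) (by positivity)
    · have := hfx i h.ne'
      rw [if_neg h.le.not_gt] at this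
      rw [this]; simp
  have h2 : RCLike.re ⟪x, 𝓣 B x⟫ ≤ eigval B (k + 1) * ‖x‖ ^ 2 := by
    rw [re_inner_toEuclideanCLM_eq_sum hB hc, ← c.sum_sq_norm_inner_right, Finset.mul_sum]
    refine Finset.sum_le_sum fun i _ => ?_
    rcases lt_or_ge i k with h | h
    · have := hfx i h.ne
      rw [if_pos h] at this
      rw [this]; simp
    · exact mul_le_mul_of_nonneg_right (eigval_succ_antitone hB h) (by positivity)
  have h3 := h x
  refine le_of_mul_le_mul_right ?_ hxpos
  linarith

/-- Weyl's inequality. -/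
theorem eigval_le_eigval_add {A B : Matrix (Fin p) (Fin p) 𝕜} (hA : A.IsHermitian)
    (hB : B.IsHermitian) (k : Fin p) :
    eigval A (k + 1) ≤ eigval B (k + 1) + ‖𝓣 A - 𝓣 B‖ := by
  refine eigval_le_eigval_add_of_le hA hB (fun x => ?_) k
  have h3 : RCLike.re ⟪x, (𝓣 A - 𝓣 B) x⟫ ≤ ‖𝓣 A - 𝓣 B‖ * ‖x‖ ^ 2 := by
    refine (re_inner_le_norm _ _).trans ?_
    refine (mul_le_mul_of_nonneg_left ((𝓣 A - 𝓣 B).le_opNorm x) (norm_nonneg _)).trans_eq ?_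
    ring
  rw [_root_.sub_apply, inner_sub_right, map_sub] at h3
  linarith

theorem isHermitian_add_smul_one {A : Matrix (Fin p) (Fin p) 𝕜} (hA : A.IsHermitian) (c : ℝ) :
    (A + (c : 𝕜) • (1 : Matrix (Fin p) (Fin p) 𝕜)).IsHermitian := by
  rw [IsHermitian, conjTranspose_add, hA.eq, conjTranspose_smul]; simp

/-- White noise adds a multiple of the identity to the covariance. The shift is common to all
eigenvalues, so the eigengap is not changed. -/
theorem eigval_add_smul_one {A : Matrix (Fin p) (Fin p) 𝕜} (hA : A.IsHermitian) (c : ℝ)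
    (k : Fin p) : eigval (A + (c : 𝕜) • (1 : Matrix (Fin p) (Fin p) 𝕜)) (k + 1) =
      eigval A (k + 1) + c := by
  have h : ∀ x, RCLike.re ⟪x, 𝓣 (A + (c : 𝕜) • (1 : Matrix (Fin p) (Fin p) 𝕜)) x⟫ =
      RCLike.re ⟪x, 𝓣 A x⟫ + c * ‖x‖ ^ 2 := by
    intro x
    have h1 : 𝓣 (A + (c : 𝕜) • (1 : Matrix (Fin p) (Fin p) 𝕜)) x = 𝓣 A x + (c : 𝕜) • x := by
      rw [map_add, map_smul, map_one]; rfl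
    rw [h1, inner_add_right, inner_smul_right, map_add, RCLike.re_ofReal_mul,
      inner_self_eq_norm_sq]
  refine le_antisymm (eigval_le_eigval_add_of_le (isHermitian_add_smul_one hA c) hA
    (fun x => (h x).le) k) ?_
  have := eigval_le_eigval_add_of_le hA (isHermitian_add_smul_one hA c) (c := -c)
    (fun x => by rw [h]; linarith) k
  linarith

theorem IsLeadingBasis.add_smul_one {s : ℕ} {A : Matrix (Fin p) (Fin p) 𝕜}
    (hA : A.IsHermitian) {U : Matrix (Fin p) (Fin s) 𝕜} (hU : IsLeadingBasis A U) (hsp : s ≤ p)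
    (c : ℝ) : IsLeadingBasis (A + (c : 𝕜) • (1 : Matrix (Fin p) (Fin p) 𝕜)) U := by
  obtain ⟨h1, V, hV1, hAV, hspan⟩ := hU
  refine ⟨h1, V, hV1, fun j => ?_, hspan⟩
  have h := eigval_add_smul_one hA c ⟨j, by omega⟩
  rw [h, add_mulVec, hAV, smul_mulVec, one_mulVec, RCLike.ofReal_add, add_smul]

theorem toEuclideanCLM_mul_conjTranspose_isSymm {s : ℕ} (U : Matrix (Fin p) (Fin s) 𝕜)
    (x y : EuclideanSpace 𝕜 (Fin p)) : ⟪𝓣 (U * Uᴴ) x, y⟫ = ⟪x, 𝓣 (U * Uᴴ) y⟫ :=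
  inner_toEuclideanCLM_left (isHermitian_mul_conjTranspose_self U) x y

theorem toEuclideanCLM_mul_conjTranspose_idem {s : ℕ} {U : Matrix (Fin p) (Fin s) 𝕜}
    (hU : Uᴴ * U = 1) (x : EuclideanSpace 𝕜 (Fin p)) :
    𝓣 (U * Uᴴ) (𝓣 (U * Uᴴ) x) = 𝓣 (U * Uᴴ) x := by
  rw [← mul_apply_eq_comp, ← map_mul, Matrix.mul_assoc, ← Matrix.mul_assoc Uᴴ, hU,
    Matrix.one_mul]

theorem orthonormal_col {s : ℕ} {U : Matrix (Fin p) (Fin s) 𝕜} (hU : Uᴴ * U = 1) :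
    Orthonormal 𝕜 fun j => WithLp.toLp 2 (U.col j) := by
  rw [orthonormal_iff_ite]
  intro i j
  have h := congrFun (congrFun hU i) j
  rw [Matrix.one_apply] at h
  rw [← h, EuclideanSpace.inner_eq_star_dotProduct, mul_apply, dotProduct]
  exact Finset.sum_congr rfl fun k _ => mul_comm _ _

/-- If there is an eigengap, then the projection onto a leading eigenspace is the projection onto
the span of the first vectors of an ordered eigenbasis. -/
theorem IsLeadingBasis.projection_apply {s : ℕ} {A : Matrix (Fin p) (Fin p) 𝕜}
    (hA : A.IsHermitian) {U : Matrix (Fin p) (Fin s) 𝕜} (hU : IsLeadingBasis A U)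
    (hs : 1 ≤ s) (hsp : s < p) (hgap : eigval A (s + 1) < eigval A s)
    {b : OrthonormalBasis (Fin p) 𝕜 (EuclideanSpace 𝕜 (Fin p))}
    (hb : ∀ i, 𝓣 A (b i) = (eigval A (i + 1) : 𝕜) • b i) (i : Fin p) :
    𝓣 (U * Uᴴ) (b i) = if (i : ℕ) < s then b i else 0 := by
  obtain ⟨hU1, V, hV1, hAV, hspan⟩ := hU
  -- Eigenvectors on the two sides of the gap have distinct eigenvalues, hence are orthogonal; the
  -- zero-based `s ≤ i` means an eigenvalue of rank at least `s + 1`.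
  have hV : ∀ (i : Fin p) (j : Fin s), s ≤ i → ⟪b i, WithLp.toLp 2 (V.col j)⟫ = 0 := by
    intro i j hi
    have h1 : 𝓣 A (WithLp.toLp 2 (V.col j)) =
        (eigval A (j + 1) : 𝕜) • WithLp.toLp 2 (V.col j) := by
      rw [toEuclideanCLM_toLp, hAV]; rfl
    have h2 : ⟪𝓣 A (b i), WithLp.toLp 2 (V.col j)⟫ = ⟪b i, 𝓣 A (WithLp.toLp 2 (V.col j))⟫ :=
      inner_toEuclideanCLM_left hA _ _
    rw [hb, h1, inner_smul_left, inner_smul_right, RCLike.conj_ofReal, ← sub_eq_zero,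
      ← sub_mul, ← RCLike.ofReal_sub] at h2
    have h3 : eigval A (i + 1) ≤ eigval A (s + 1) :=
      eigval_succ_antitone hA (i := ⟨s, hsp⟩) (j := i) hi
    have h4 : eigval A s ≤ eigval A (j + 1) := by
      have := eigval_succ_antitone hA (i := ⟨j, by omega⟩) (j := ⟨s - 1, by omega⟩)
        (Fin.mk_le_mk.2 (by omega))
      simpa [Nat.sub_add_cancel hs] using this
    rcases mul_eq_zero.1 h2 with h | h
    · rw [RCLike.ofReal_eq_zero] at h; linarith
    · exact h
  have hUspan : ∀ j, U.col j ∈ Submodule.span 𝕜 (Set.range V.col) := fun j =>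
    hspan ▸ Submodule.subset_span ⟨j, rfl⟩
  have hUb : ∀ (i : Fin p) (j : Fin s), s ≤ i → ⟪b i, WithLp.toLp 2 (U.col j)⟫ = 0 := by
    intro i j hi
    refine Submodule.span_induction (p := fun v _ => ⟪b i, WithLp.toLp 2 v⟫ = 0) ?_ ?_ ?_ ?_
      (hUspan j)
    · rintro _ ⟨l, rfl⟩; exact hV i l hi
    · simp
    · intro v w _ _ hv hw; rw [WithLp.toLp_add, inner_add_right, hv, hw, add_zero]
    · intro c v _ hv; rw [WithLp.toLp_smul, inner_smul_right, hv, mul_zero]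
  have hzero : ∀ x : EuclideanSpace 𝕜 (Fin p), (∀ j, ⟪x, WithLp.toLp 2 (U.col j)⟫ = 0) →
      𝓣 (U * Uᴴ) x = 0 := by
    intro x hx
    have h1 : Uᴴ *ᵥ (WithLp.ofLp x) = 0 := by
      ext j
      have h2 := hx j
      rw [← inner_conj_symm, EuclideanSpace.inner_eq_star_dotProduct, map_eq_zero] at h2
      rw [mulVec, dotProduct_comm]
      exact h2
    have h3 : 𝓣 (U * Uᴴ) x = WithLp.toLp 2 ((U * Uᴴ) *ᵥ WithLp.ofLp x) := rfl
    rw [h3, ← mulVec_mulVec, h1, mulVec_zero]; rfl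
  rcases lt_or_ge (i : ℕ) s with hi | hi
  · rw [if_pos hi]
    have hfix : ∀ x ∈ Submodule.span 𝕜 (Set.range fun j => WithLp.toLp 2 (U.col j)),
        𝓣 (U * Uᴴ) x = x := by
      intro x hx
      refine Submodule.span_induction (p := fun v _ => 𝓣 (U * Uᴴ) v = v) ?_ ?_ ?_ ?_ hx
      · rintro _ ⟨j, rfl⟩
        rw [toEuclideanCLM_toLp]
        congr 1
        have h := congrFun (congrArg Matrix.transpose
          (show U * Uᴴ * U = U by rw [Matrix.mul_assoc, hU1, Matrix.mul_one])) j
        exact h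
      · exact map_zero _
      · intro v w _ _ hv hw; rw [map_add, hv, hw]
      · intro c v _ hv; rw [map_smul, hv]
    have hle : Submodule.span 𝕜 (Set.range fun j => WithLp.toLp 2 (U.col j)) ≤
        Submodule.span 𝕜 (Set.range fun j : Fin s => b ⟨j, by omega⟩) := by
      rw [Submodule.span_le]
      rintro _ ⟨j, rfl⟩
      change WithLp.toLp 2 (U.col j) ∈ _
      rw [← b.sum_repr' (WithLp.toLp 2 (U.col j))]
      refine Submodule.sum_mem _ fun i _ => ?_
      rcases lt_or_ge (i : ℕ) s with h | h
      · exact Submodule.smul_mem _ _ (Submodule.subset_span ⟨⟨i, h⟩, rfl⟩)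
      · rw [hUb i j h, zero_smul]; exact Submodule.zero_mem _
    have hb' : Orthonormal 𝕜 fun j : Fin s => b ⟨j, by omega⟩ :=
      b.orthonormal.comp _ fun j l h => Fin.ext (by simpa using h)
    -- Both spans have dimension `s`, so the inclusion is an equality.
    have heq := Submodule.eq_of_le_of_finrank_eq hle (by
      rw [finrank_span_eq_card (orthonormal_col hU1).linearIndependent,
        finrank_span_eq_card hb'.linearIndependent])
    exact hfix _ (heq ▸ Submodule.subset_span ⟨⟨i, hi⟩, rfl⟩)
  · rw [if_neg hi.not_gt]
    exact hzero _ fun j => hUb i j hi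

/-- In an ordered eigenbasis the projection keeps the first `s` coordinates, from which all three
properties can be read off. They are the hypotheses of `half_gap_mul_norm_projection_sub_le`. -/
theorem IsLeadingBasis.projection_spec {s : ℕ} {A : Matrix (Fin p) (Fin p) 𝕜}
    (hA : A.IsHermitian) {U : Matrix (Fin p) (Fin s) 𝕜} (hU : IsLeadingBasis A U)
    (hs : 1 ≤ s) (hsp : s < p) (hgap : eigval A (s + 1) < eigval A s) :
    (∀ x, 𝓣 A (𝓣 (U * Uᴴ) x) = 𝓣 (U * Uᴴ) (𝓣 A x)) ∧
    (∀ x, 𝓣 (U * Uᴴ) x = x → eigval A s * ‖x‖ ^ 2 ≤ RCLike.re ⟪x, 𝓣 A x⟫) ∧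
    (∀ x, 𝓣 (U * Uᴴ) x = 0 → RCLike.re ⟪x, 𝓣 A x⟫ ≤ eigval A (s + 1) * ‖x‖ ^ 2) := by
  obtain ⟨b, hb⟩ := exists_orthonormalBasis_eigval hA
  have hP := hU.projection_apply hA hs hsp hgap hb
  have hsymm := toEuclideanCLM_mul_conjTranspose_isSymm U
  have hinner : ∀ (x : EuclideanSpace 𝕜 (Fin p)) i,
      ⟪b i, 𝓣 (U * Uᴴ) x⟫ = if (i : ℕ) < s then ⟪b i, x⟫ else 0 := by
    intro x i
    rw [← hsymm, hP]
    split_ifs <;> simp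
  refine ⟨fun x => ?_, fun x hx => ?_, fun x hx => ?_⟩
  · refine b.repr.injective (PiLp.ext fun i => ?_)
    rw [b.repr_apply_apply, b.repr_apply_apply, hinner, ← inner_toEuclideanCLM_left hA,
      ← inner_toEuclideanCLM_left hA, hb,
      inner_smul_left, hinner, inner_smul_left]
    split_ifs <;> simp
  · rw [re_inner_toEuclideanCLM_eq_sum hA hb, ← b.sum_sq_norm_inner_right, Finset.mul_sum]
    refine Finset.sum_le_sum fun i _ => ?_
    have h := hinner x i
    rw [hx] at h
    rcases lt_or_ge (i : ℕ) s with hi | hi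
    · refine mul_le_mul_of_nonneg_right ?_ (by positivity)
      have := eigval_succ_antitone hA (i := i) (j := ⟨s - 1, by omega⟩)
        (Fin.mk_le_mk.2 (by omega))
      simpa [Nat.sub_add_cancel hs] using this
    · rw [if_neg hi.not_gt] at h
      rw [h]; simp
  · rw [re_inner_toEuclideanCLM_eq_sum hA hb, ← b.sum_sq_norm_inner_right, Finset.mul_sum]
    refine Finset.sum_le_sum fun i _ => ?_
    have h := hinner x i
    rw [hx, inner_zero_right] at h
    rcases lt_or_ge (i : ℕ) s with hi | hi
    · rw [if_pos hi] at h
      rw [← h]; simp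
    · exact mul_le_mul_of_nonneg_right
        (eigval_succ_antitone hA (i := ⟨s, hsp⟩) (j := i) hi) (by positivity)

/-- The Davis–Kahan theorem. -/
theorem sinThetaDist_le {s : ℕ} {A B : Matrix (Fin p) (Fin p) 𝕜} (hA : A.IsHermitian)
    (hB : B.IsHermitian) {U U' : Matrix (Fin p) (Fin s) 𝕜} (hU : IsLeadingBasis A U)
    (hU' : IsLeadingBasis B U') (hs : 1 ≤ s) (hsp : s < p)
    (hgap : eigval A (s + 1) < eigval A s) {ε : ℝ} (hε : opNorm (B - A) ≤ ε) :
    sinThetaDist U' U ≤ min 1 (2 * ε / (eigval A s - eigval A (s + 1))) := by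
  set δ := eigval A s - eigval A (s + 1) with hδ
  have hδ0 : 0 < δ := sub_pos.2 hgap
  have hε' : ‖𝓣 A - 𝓣 B‖ ≤ ε := by
    rw [norm_sub_rev, ← map_sub]; exact hε
  have hε0 : 0 ≤ ε := (norm_nonneg _).trans hε'
  have hdist : sinThetaDist U' U = ‖𝓣 (U' * U'ᴴ) - 𝓣 (U * Uᴴ)‖ := by
    rw [← map_sub]; rfl
  have hP := toEuclideanCLM_mul_conjTranspose_isSymm U
  have hP' := toEuclideanCLM_mul_conjTranspose_isSymm U'
  have hPP := toEuclideanCLM_mul_conjTranspose_idem hU.1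
  have hPP' := toEuclideanCLM_mul_conjTranspose_idem hU'.1
  have hone : sinThetaDist U' U ≤ 1 := by
    rw [hdist, norm_sub_rev]
    exact norm_projection_sub_le_one hP hP' hPP hPP'
  refine le_min hone ?_
  -- For `δ ≤ 2 * ε` the claimed bound is at least `1`. Otherwise Weyl's inequality gives `B` an
  -- eigengap too, and the mixed gaps are at least `δ - ε`, hence at least `δ / 2`; this is the
  -- origin of the factor `2`.
  rcases le_or_gt δ (2 * ε) with hle | hlt
  · exact hone.trans ((one_le_div hδ0).2 hle)
  have hW1 : eigval A s ≤ eigval B s + ε := by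
    have := eigval_le_eigval_add hA hB ⟨s - 1, by omega⟩
    simp only [Nat.sub_add_cancel hs] at this
    linarith
  have hW2 : eigval B (s + 1) ≤ eigval A (s + 1) + ε := by
    have := eigval_le_eigval_add hB hA ⟨s, hsp⟩
    rw [norm_sub_rev] at this
    simp only at this
    linarith
  have hgap' : eigval B (s + 1) < eigval B s := by linarith
  obtain ⟨hA1, hA2, hA3⟩ := hU.projection_spec hA hs hsp hgap
  obtain ⟨hB1, hB2, hB3⟩ := hU'.projection_spec hB hs hsp hgap'
  rw [hdist, norm_sub_rev, le_div_iff₀ hδ0]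
  have h1 : δ / 2 ≤ eigval B s - eigval A (s + 1) := by linarith
  have h2 : δ / 2 ≤ eigval A s - eigval B (s + 1) := by linarith
  have h := half_gap_mul_norm_projection_sub_le (half_pos hδ0) hP hP' hPP hPP' hA1 hB1
    hA2 hA3 hB2 hB3 h1 h2
  linarith

end Eigenvalues

/-! ### Moments of dithered signs -/

section Dither

/-- Truncation to the interval `[-lam, lam]`. -/
noncomputable def clipReal (lam a : ℝ) : ℝ := max (-lam) (min a lam)

/-- Truncation of the real and of the imaginary part to the interval `[-lam, lam]`. -/
noncomputable def clipField {𝕜 : Type*} [RCLike 𝕜] (lam : ℝ) (z : 𝕜) : 𝕜 :=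
  (clipReal lam (RCLike.re z) : 𝕜) + (clipReal lam (RCLike.im z) : 𝕜) * RCLike.I

theorem isProbabilityMeasure_uniformInterval {lam : ℝ} (hlam : 0 < lam) :
    IsProbabilityMeasure (uniformInterval lam) := by
  refine cond_isProbabilityMeasure_of_finite ?_ ?_ <;> rw [Real.volume_Icc] <;> simp; linarith

theorem measurable_signReal : Measurable signReal :=
  Measurable.ite measurableSet_Ici measurable_const measurable_const

theorem abs_signReal (a : ℝ) : |signReal a| = 1 := by
  unfold signReal; split_ifs <;> simp

/-- The sign is `2` times the indicator of `u ≥ -a`, minus `1`, so its mean is affine in the length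
of an interval. That length saturates once `a` leaves `[-lam, lam]`, which is the source of the
clipping. -/
theorem integral_signReal_add {lam : ℝ} (hlam : 0 < lam) (a : ℝ) :
    ∫ u, signReal (a + u) ∂uniformInterval lam = clipReal lam a / lam := by
  have h1 : ∀ u, signReal (a + u) = (Set.Ici (-a)).indicator (fun _ => (2 : ℝ)) u - 1 := by
    intro u
    unfold signReal Set.indicator
    by_cases h : 0 ≤ a + u
    · rw [if_pos h, if_pos (by simp; linarith)]; norm_num
    · rw [if_neg h, if_neg (by simp; linarith)]; norm_num
  have := isProbabilityMeasure_uniformInterval hlam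
  simp_rw [h1]
  rw [integral_sub ((integrable_const _).indicator measurableSet_Ici) (integrable_const _),
    integral_indicator_const _ measurableSet_Ici, integral_const, probReal_univ]
  have h2 : (uniformInterval lam).real (Set.Ici (-a)) =
      max 0 (lam - max (-lam) (-a)) / (2 * lam) := by
    rw [measureReal_def, uniformInterval, cond_apply measurableSet_Icc, Real.volume_Icc]
    have : Set.Icc (-lam) lam ∩ Set.Ici (-a) = Set.Icc (max (-lam) (-a)) lam := by
      ext u; simp; tauto
    rw [this, Real.volume_Icc, ENNReal.toReal_mul, ENNReal.toReal_inv,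
      ENNReal.toReal_ofReal (by linarith), ENNReal.toReal_ofReal', max_comm 0]
    rw [show lam - -lam = 2 * lam by ring, inv_mul_eq_div]
  rw [h2, clipReal, smul_eq_mul, smul_eq_mul, eq_div_iff hlam.ne']
  have h3 : ∀ m : ℝ, (m / (2 * lam) * 2 - 1 * 1) * lam = m - lam := by
    intro m; field_simp
  rw [h3]
  simp only [max_def, min_def]
  split_ifs <;> linarith

theorem abs_clipReal_le {lam : ℝ} (hlam : 0 < lam) (a : ℝ) : |clipReal lam a| ≤ lam := by
  rw [abs_le, clipReal]
  exact ⟨le_max_left _ _, max_le (by linarith) (min_le_right _ _)⟩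

theorem abs_clipReal_le_abs {lam : ℝ} (hlam : 0 < lam) (a : ℝ) : |clipReal lam a| ≤ |a| := by
  rw [clipReal]
  simp only [max_def, min_def]
  split_ifs <;> cases abs_cases a <;> rw [abs_le] <;> constructor <;> linarith

theorem abs_clipReal_sub_le_abs {lam : ℝ} (hlam : 0 < lam) (a : ℝ) :
    |clipReal lam a - a| ≤ |a| := by
  rw [clipReal]
  simp only [max_def, min_def]
  split_ifs <;> cases abs_cases a <;> rw [abs_le] <;> constructor <;> linarith

theorem clipReal_eq_self {lam a : ℝ} (h : |a| ≤ lam) : clipReal lam a = a := by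
  rw [abs_le] at h
  rw [clipReal, min_eq_left h.2, max_eq_right h.1]

theorem measurable_clipReal (lam : ℝ) : Measurable (clipReal lam) :=
  measurable_const.max (measurable_id.min measurable_const)

variable {𝕜 : Type*} [RCLike 𝕜]

theorem measurable_signField : Measurable (signField : 𝕜 → 𝕜) :=
  (RCLike.measurable_ofReal.comp (measurable_signReal.comp RCLike.measurable_re)).add
    ((RCLike.measurable_ofReal.comp (measurable_signReal.comp RCLike.measurable_im)).mul_const _)

theorem measurable_clipField (lam : ℝ) : Measurable (clipField lam : 𝕜 → 𝕜) :=
  (RCLike.measurable_ofReal.comp ((measurable_clipReal lam).comp RCLike.measurable_re)).add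
    ((RCLike.measurable_ofReal.comp
      ((measurable_clipReal lam).comp RCLike.measurable_im)).mul_const _)

/-- Only an inequality, since over `ℝ` the second term vanishes with `RCLike.I`. -/
theorem norm_sq_add_mul_I_le (a b : ℝ) : ‖(a : 𝕜) + (b : 𝕜) * RCLike.I‖ ^ 2 ≤ a ^ 2 + b ^ 2 := by
  rw [← RCLike.normSq_eq_def', RCLike.normSq_apply]
  rcases RCLike.I_eq_zero_or_im_I_eq_one (K := 𝕜) with h | h
  · simp only [h, mul_zero, add_zero, RCLike.ofReal_re, RCLike.ofReal_im]
    nlinarith [sq_nonneg b]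
  · simp [h]
    nlinarith

theorem norm_sq_eq_re_add_im (z : 𝕜) : ‖z‖ ^ 2 = RCLike.re z ^ 2 + RCLike.im z ^ 2 := by
  rw [← RCLike.normSq_eq_def', RCLike.normSq_apply]; ring

theorem norm_signField_sq_le (z : 𝕜) : ‖signField z‖ ^ 2 ≤ 2 := by
  refine (norm_sq_add_mul_I_le _ _).trans ?_
  rw [← sq_abs, abs_signReal, ← sq_abs (signReal (RCLike.im z)), abs_signReal]
  norm_num

theorem norm_clipField_sq_le {lam : ℝ} (hlam : 0 < lam) (z : 𝕜) :
    ‖clipField lam z‖ ^ 2 ≤ 2 * lam ^ 2 := by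
  refine (norm_sq_add_mul_I_le _ _).trans ?_
  have h1 := sq_le_sq.2 ((abs_clipReal_le hlam (RCLike.re z)).trans (le_abs_self lam))
  have h2 := sq_le_sq.2 ((abs_clipReal_le hlam (RCLike.im z)).trans (le_abs_self lam))
  linarith

theorem norm_clipField_le {lam : ℝ} (hlam : 0 < lam) (z : 𝕜) : ‖clipField lam z‖ ≤ ‖z‖ := by
  refine le_of_sq_le_sq ((norm_sq_add_mul_I_le _ _).trans ?_) (norm_nonneg _)
  rw [norm_sq_eq_re_add_im]
  exact add_le_add (sq_le_sq.2 (abs_clipReal_le_abs hlam _))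
    (sq_le_sq.2 (abs_clipReal_le_abs hlam _))

theorem norm_clipField_sub_le {lam : ℝ} (hlam : 0 < lam) (z : 𝕜) :
    ‖clipField lam z - z‖ ≤ ‖z‖ := by
  have h : clipField lam z - z = ((clipReal lam (RCLike.re z) - RCLike.re z : ℝ) : 𝕜) +
      ((clipReal lam (RCLike.im z) - RCLike.im z : ℝ) : 𝕜) * RCLike.I := by
    nth_rw 2 [← RCLike.re_add_im z]
    rw [clipField]
    push_cast
    ring
  rw [h]
  refine le_of_sq_le_sq ((norm_sq_add_mul_I_le _ _).trans ?_) (norm_nonneg _)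
  rw [norm_sq_eq_re_add_im]
  exact add_le_add (sq_le_sq.2 (abs_clipReal_sub_le_abs hlam _))
    (sq_le_sq.2 (abs_clipReal_sub_le_abs hlam _))

theorem clipField_eq_self {lam : ℝ} {z : 𝕜} (h : ‖z‖ ≤ lam) : clipField lam z = z := by
  rw [clipField, clipReal_eq_self ((RCLike.abs_re_le_norm z).trans h),
    clipReal_eq_self ((RCLike.abs_im_le_norm z).trans h), RCLike.re_add_im]

theorem signField_add_mul_I (z : 𝕜) (a b : ℝ) :
    signField (z + ((a : 𝕜) + (b : 𝕜) * RCLike.I)) = (signReal (RCLike.re z + a) : 𝕜) +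
      (signReal (RCLike.im z + b) : 𝕜) * RCLike.I := by
  unfold signField
  rcases RCLike.I_eq_zero_or_im_I_eq_one (K := 𝕜) with h | h
  · simp [h]
  · simp [h]

/-- The dither law as the image of a product measure of independent real coordinates. -/
theorem ditherLaw_eq_map_pi {lam : ℝ} (hlam : 0 < lam) (p : ℕ) :
    ditherLaw 𝕜 p lam = (Measure.pi fun _ : Fin p ⊕ Fin p => uniformInterval lam).map
      (fun w i => (w (Sum.inl i) : 𝕜) + (w (Sum.inr i) : 𝕜) * RCLike.I) := by
  have := isProbabilityMeasure_uniformInterval hlam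
  have h := measurePreserving_sumPiEquivProdPi (fun _ : Fin p ⊕ Fin p => uniformInterval lam)
  rw [ditherLaw, ← h.map_eq, Measure.map_map _ h.measurable]
  · rfl
  · refine measurable_pi_lambda _ fun i => ?_
    have h1 : Measurable fun w : (Fin p → ℝ) × (Fin p → ℝ) => w.1 i :=
      (measurable_pi_apply i).comp measurable_fst
    have h2 : Measurable fun w : (Fin p → ℝ) × (Fin p → ℝ) => w.2 i :=
      (measurable_pi_apply i).comp measurable_snd
    exact (RCLike.measurable_ofReal.comp h1).add ((RCLike.measurable_ofReal.comp h2).mul_const _)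

theorem measurable_coord_add_mul_I {p : ℕ} (i : Fin p) :
    Measurable fun w : Fin p ⊕ Fin p → ℝ =>
      (w (Sum.inl i) : 𝕜) + (w (Sum.inr i) : 𝕜) * RCLike.I :=
  (RCLike.measurable_ofReal.comp (measurable_pi_apply _)).add
    ((RCLike.measurable_ofReal.comp (measurable_pi_apply _)).mul_const _)

theorem measurable_signField_add {p : ℕ} (z : 𝕜) (i : Fin p) :
    Measurable fun v : Fin p → 𝕜 => signField (z + v i) :=
  measurable_signField.comp ((measurable_const_add z).comp (measurable_pi_apply i))

theorem integral_signField_add_ditherLaw {lam : ℝ} (hlam : 0 < lam) {p : ℕ} (z : 𝕜) (i : Fin p) :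
    ∫ v, signField (z + v i) ∂ditherLaw 𝕜 p lam = clipField lam z / lam := by
  have := isProbabilityMeasure_uniformInterval hlam
  rw [ditherLaw_eq_map_pi hlam, integral_map
    (measurable_pi_lambda _ fun i => measurable_coord_add_mul_I i).aemeasurable
    (measurable_signField_add z i).aestronglyMeasurable]
  simp_rw [signField_add_mul_I]
  have hm : ∀ (a : ℝ) (l : Fin p ⊕ Fin p),
      ∫ w : Fin p ⊕ Fin p → ℝ, signReal (a + w l)
        ∂(Measure.pi fun _ : Fin p ⊕ Fin p => uniformInterval lam) = clipReal lam a / lam := by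
    intro a l
    have hmp := measurePreserving_eval (fun _ : Fin p ⊕ Fin p => uniformInterval lam) l
    have h := integral_map (μ := Measure.pi fun _ : Fin p ⊕ Fin p => uniformInterval lam)
      (f := fun u => signReal (a + u)) hmp.measurable.aemeasurable
      (measurable_signReal.comp (measurable_const_add a)).aestronglyMeasurable
    rw [hmp.map_eq, integral_signReal_add hlam] at h
    exact h.symm
  have hi : ∀ (a : ℝ) (l : Fin p ⊕ Fin p),
      Integrable (fun w : Fin p ⊕ Fin p → ℝ => (signReal (a + w l) : 𝕜))
        (Measure.pi fun _ : Fin p ⊕ Fin p => uniformInterval lam) := by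
    intro a l
    refine Integrable.of_bound (RCLike.measurable_ofReal.comp (measurable_signReal.comp
      ((measurable_const_add a).comp (measurable_pi_apply l)))).aestronglyMeasurable 1
      (ae_of_all _ fun w => ?_)
    rw [RCLike.norm_ofReal, abs_signReal]
  rw [integral_add (hi _ _) ((hi _ _).mul_const _), integral_mul_const, integral_ofReal,
    integral_ofReal, hm, hm, clipField]
  push_cast
  ring

theorem integral_star_signField_add_ditherLaw {lam : ℝ} (hlam : 0 < lam) {p : ℕ} (z : 𝕜)
    (i : Fin p) : ∫ v, star (signField (z + v i)) ∂ditherLaw 𝕜 p lam =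
      star (clipField lam z / lam) := by
  rw [← integral_signField_add_ditherLaw hlam z i]
  exact integral_conj

/-- Distinct entries of one dither involve four distinct independent real coordinates, so the mean
factors. On the diagonal the same coordinates occur twice and this argument fails, whence the second
dither in the estimator. -/
theorem integral_signField_add_mul_star_ditherLaw {lam : ℝ} (hlam : 0 < lam) {p : ℕ} (z z' : 𝕜)
    {i j : Fin p} (hij : i ≠ j) :
    ∫ v, signField (z + v i) * star (signField (z' + v j)) ∂ditherLaw 𝕜 p lam =
      clipField lam z / lam * star (clipField lam z' / lam) := by
  have := isProbabilityMeasure_uniformInterval hlam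
  let Φ : (Fin p ⊕ Fin p → ℝ) → Fin p → 𝕜 :=
    fun w i => (w (Sum.inl i) : 𝕜) + (w (Sum.inr i) : 𝕜) * RCLike.I
  have hΦ : Measurable Φ := measurable_pi_lambda _ fun i => measurable_coord_add_mul_I i
  have hlaw : ditherLaw 𝕜 p lam = Measure.map Φ _ := ditherLaw_eq_map_pi hlam p
  have hf := measurable_signField_add (p := p) z i
  have hg : Measurable fun v : Fin p → 𝕜 => star (signField (z' + v j)) :=
    continuous_star.measurable.comp (measurable_signField_add z' j)
  have hcoord := iIndepFun_pi (μ := fun _ : Fin p ⊕ Fin p => uniformInterval lam)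
    (X := fun _ (u : ℝ) => u) fun _ => aemeasurable_id
  have hind := hcoord.indepFun_prodMk_prodMk (fun l => measurable_pi_apply l)
    (Sum.inl i) (Sum.inr i) (Sum.inl j) (Sum.inr j) (by simpa using hij) (by simp) (by simp)
    (by simpa using hij)
  have hcm : Measurable fun u : ℝ × ℝ => (u.1 : 𝕜) + (u.2 : 𝕜) * RCLike.I :=
    (RCLike.measurable_ofReal.comp measurable_fst).add
      ((RCLike.measurable_ofReal.comp measurable_snd).mul_const _)
  have hind' := hind.comp
    (measurable_signField.comp ((measurable_const_add z).comp hcm))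
    (continuous_star.measurable.comp (measurable_signField.comp
      ((measurable_const_add z').comp hcm)))
  have h := hind'.integral_fun_mul_eq_mul_integral (hf.comp hΦ).aestronglyMeasurable
    (hg.comp hΦ).aestronglyMeasurable
  have e1 := integral_signField_add_ditherLaw hlam z i
  have e2 := integral_star_signField_add_ditherLaw hlam z' j
  rw [hlaw, integral_map hΦ.aemeasurable hf.aestronglyMeasurable] at e1
  rw [hlaw, integral_map hΦ.aemeasurable hg.aestronglyMeasurable] at e2
  have hfg : Measurable fun v : Fin p → 𝕜 => signField (z + v i) * star (signField (z' + v j)) :=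
    hf.mul hg
  rw [← e1, ← e2, hlaw, integral_map hΦ.aemeasurable hfg.aestronglyMeasurable]
  exact h

end Dither

/-! ### Mean and variance of one summand of the estimator -/

section DitheredSample

open Matrix
open scoped Matrix.Norms.L2Operator

attribute [local instance] matrixMeasurableSpace matrixBorelSpace matrixSecondCountable

variable {𝕜 : Type*} [RCLike 𝕜] {p : ℕ}

/-- A random vector together with two independent dithers. -/
structure IsDithered {Ω : Type*} [MeasurableSpace Ω] (lam : ℝ) (y τ τ' : Ω → Fin p → 𝕜)
    (μ : Measure Ω) : Prop where
  measurable : Measurable y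
  measurable_fst : Measurable τ
  measurable_snd : Measurable τ'
  law_fst : μ.map τ = ditherLaw 𝕜 p lam
  law_snd : μ.map τ' = ditherLaw 𝕜 p lam
  indep : IndepFun y (fun ω => (τ ω, τ' ω)) μ
  indep_dithers : IndepFun τ τ' μ

/-- The one-bit quantization of a dithered vector. -/
noncomputable def quantize (y t : Fin p → 𝕜) : Fin p → 𝕜 := fun i => signField (y i + t i)

/-- The second moment matrix of a truncated random vector. -/
noncomputable def clippedMoment {Ω : Type*} [MeasurableSpace Ω] (lam : ℝ) (y : Ω → Fin p → 𝕜)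
    (μ : Measure Ω) : Matrix (Fin p) (Fin p) 𝕜 :=
  Matrix.of fun i j => ∫ ω, clipField lam (y ω i) * star (clipField lam (y ω j)) ∂μ

/-- The symmetrized product of two quantized vectors. -/
noncomputable def symQuantized (lam : ℝ) (q q' : Fin p → 𝕜) : Matrix (Fin p) (Fin p) 𝕜 :=
  Matrix.of fun i j => ((lam ^ 2 / 2 : ℝ) : 𝕜) * (q i * star (q' j) + q' i * star (q j))

theorem symQuantized_isHermitian (lam : ℝ) (q q' : Fin p → 𝕜) :
    (symQuantized lam q q').IsHermitian := by
  ext i j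
  simp only [symQuantized, conjTranspose_apply, of_apply, star_mul', star_add,
    RCLike.star_def, RCLike.conj_ofReal]
  rw [RCLike.conj_conj, RCLike.conj_conj]
  ring

/-- Cauchy–Schwarz in each row. It serves both for the uniform bound of the summands and for the
truncation bias. -/
theorem norm_le_of_entry_le {A : Matrix (Fin p) (Fin p) 𝕜} {m : ℝ} (hm : 0 ≤ m)
    (h : ∀ i j, ‖A i j‖ ≤ m) : ‖A‖ ≤ p * m := by
  rw [cstar_norm_def]
  refine ContinuousLinearMap.opNorm_le_bound _ (by positivity) fun x => ?_
  refine le_of_sq_le_sq ?_ (by positivity)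
  rw [EuclideanSpace.norm_sq_eq, mul_pow, EuclideanSpace.norm_sq_eq x]
  have h1 : ∀ i, ‖(toEuclideanCLM (n := Fin p) (𝕜 := 𝕜) A x) i‖ ^ 2 ≤
      p * m ^ 2 * ∑ j, ‖x j‖ ^ 2 := by
    intro i
    have h2 : ‖(toEuclideanCLM (n := Fin p) (𝕜 := 𝕜) A x) i‖ ≤ ∑ j, m * ‖x j‖ := by
      change ‖∑ j, A i j * x j‖ ≤ _
      refine (norm_sum_le _ _).trans (Finset.sum_le_sum fun j _ => ?_)
      rw [norm_mul]
      exact mul_le_mul_of_nonneg_right (h i j) (norm_nonneg _)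
    have h3 := sq_sum_le_card_mul_sum_sq (s := Finset.univ) (f := fun j => m * ‖x j‖)
    rw [Finset.card_univ, Fintype.card_fin] at h3
    refine (pow_le_pow_left₀ (norm_nonneg _) h2 2).trans (h3.trans_eq ?_)
    simp only [mul_pow, ← Finset.mul_sum]
    ring
  refine (Finset.sum_le_sum fun i _ => h1 i).trans_eq ?_
  rw [Finset.sum_const, Finset.card_univ, Fintype.card_fin, nsmul_eq_mul]
  ring

theorem re_star_dotProduct_mulVec_le (A : Matrix (Fin p) (Fin p) 𝕜) (w : Fin p → 𝕜) :
    RCLike.re (∑ i, star (w i) * (A *ᵥ w) i) ≤ ‖A‖ * ∑ i, ‖w i‖ ^ 2 := by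
  have h := re_inner_le_norm (𝕜 := 𝕜) (WithLp.toLp 2 w)
    (toEuclideanCLM (n := Fin p) (𝕜 := 𝕜) A (WithLp.toLp 2 w))
  have h1 : inner 𝕜 (WithLp.toLp 2 w) (toEuclideanCLM (n := Fin p) (𝕜 := 𝕜) A (WithLp.toLp 2 w)) =
      ∑ i, star (w i) * (A *ᵥ w) i := by
    rw [PiLp.inner_apply]
    exact Finset.sum_congr rfl fun i _ => mul_comm _ _
  rw [h1] at h
  refine h.trans ?_
  have h2 := (toEuclideanCLM (n := Fin p) (𝕜 := 𝕜) A).le_opNorm (WithLp.toLp 2 w)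
  refine (mul_le_mul_of_nonneg_left h2 (norm_nonneg _)).trans_eq ?_
  rw [cstar_norm_def, mul_left_comm, ← pow_two, EuclideanSpace.norm_sq_eq]

theorem norm_quantize_le (y t : Fin p → 𝕜) (i : Fin p) : ‖quantize y t i‖ ≤ √2 :=
  Real.le_sqrt_of_sq_le (norm_signField_sq_le _)

theorem norm_mul_star_quantize_le (y t y' t' : Fin p → 𝕜) (i j : Fin p) :
    ‖quantize y t i * star (quantize y' t' j)‖ ≤ 2 := by
  rw [norm_mul, norm_star]
  calc _ ≤ √2 * √2 := by gcongr <;> exact norm_quantize_le _ _ _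
    _ = 2 := Real.mul_self_sqrt (by norm_num)

theorem norm_symQuantized_le (lam : ℝ) (y t t' : Fin p → 𝕜) (i j : Fin p) :
    ‖symQuantized lam (quantize y t) (quantize y t') i j‖ ≤ 2 * lam ^ 2 := by
  rw [symQuantized, of_apply, norm_mul, RCLike.norm_ofReal, abs_of_nonneg (by positivity)]
  calc _ ≤ lam ^ 2 / 2 * (2 + 2) := by
        gcongr
        exact (norm_add_le _ _).trans (add_le_add (norm_mul_star_quantize_le _ _ _ _ _ _)
          (norm_mul_star_quantize_le _ _ _ _ _ _))
    _ = _ := by ring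

theorem measurable_quantize : Measurable fun z : (Fin p → 𝕜) × (Fin p → 𝕜) => quantize z.1 z.2 :=
  measurable_pi_lambda _ fun i => measurable_signField.comp
    (((measurable_pi_apply i).comp measurable_fst).add
      ((measurable_pi_apply i).comp measurable_snd))

variable {Ω : Type*} [MeasurableSpace Ω] {μ : Measure Ω} [IsProbabilityMeasure μ] {lam : ℝ}
  {y τ τ' : Ω → Fin p → 𝕜}

theorem clippedMoment_isHermitian (lam : ℝ) (y : Ω → Fin p → 𝕜) (μ : Measure Ω) :
    (clippedMoment lam y μ).IsHermitian := by
  ext i j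
  simp only [clippedMoment, conjTranspose_apply, of_apply]
  refine (integral_conj (𝕜 := 𝕜)).symm.trans ?_
  congr 1
  ext ω
  rw [RCLike.star_def, map_mul, RCLike.conj_conj, mul_comm]

theorem norm_mul_star_clipField_le (hlam : 0 < lam) (z z' : 𝕜) :
    ‖clipField lam z * star (clipField lam z')‖ ≤ 2 * lam ^ 2 := by
  rw [norm_mul, norm_star]
  nlinarith [norm_clipField_sq_le hlam z, norm_clipField_sq_le hlam z',
    sq_nonneg (‖clipField lam z‖ - ‖clipField lam z'‖)]

theorem norm_clippedMoment_le (hlam : 0 < lam) (i j : Fin p) :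
    ‖clippedMoment lam y μ i j‖ ≤ 2 * lam ^ 2 := by
  rw [clippedMoment, of_apply]
  refine (norm_integral_le_of_norm_le_const (ae_of_all _ fun ω =>
    norm_mul_star_clipField_le hlam (y ω i) (y ω j))).trans_eq ?_
  rw [probReal_univ, mul_one]

theorem measurable_quantize_apply (hy : Measurable y) (hτ : Measurable τ) (i : Fin p) :
    Measurable fun ω => quantize (y ω) (τ ω) i :=
  (measurable_pi_apply i).comp (measurable_quantize.comp (hy.prodMk hτ))

theorem measurable_mul_star_quantize (hy : Measurable y) (hτ : Measurable τ) (hτ' : Measurable τ')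
    (i j : Fin p) :
    Measurable fun ω => quantize (y ω) (τ ω) i * star (quantize (y ω) (τ' ω) j) :=
  (measurable_quantize_apply hy hτ i).mul
    (continuous_star.measurable.comp (measurable_quantize_apply hy hτ' j))

theorem integrable_mul_star_quantize (hy : Measurable y) (hτ : Measurable τ) (hτ' : Measurable τ')
    (i j : Fin p) :
    Integrable (fun ω => quantize (y ω) (τ ω) i * star (quantize (y ω) (τ' ω) j)) μ :=
  Integrable.of_bound (measurable_mul_star_quantize hy hτ hτ' i j).aestronglyMeasurable 2
    (ae_of_all _ fun _ => norm_mul_star_quantize_le _ _ _ _ _ _)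

/-- The variance is the second moment minus the squared norm of the mean. -/
theorem integral_norm_sq_sub_integral_le {f : Ω → 𝕜} (hf : Measurable f) {C : ℝ}
    (hC : ∀ ω, ‖f ω‖ ≤ C) : ∫ ω, ‖f ω - ∫ ω', f ω' ∂μ‖ ^ 2 ∂μ ≤ ∫ ω, ‖f ω‖ ^ 2 ∂μ := by
  set m := ∫ ω', f ω' ∂μ with hm
  have hi : Integrable f μ := Integrable.of_bound hf.aestronglyMeasurable C (ae_of_all _ hC)
  have hi2 : Integrable (fun ω => ‖f ω‖ ^ 2) μ :=
    Integrable.of_bound (hf.norm.pow_const 2).aestronglyMeasurable (C ^ 2) (ae_of_all _ fun ω => by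
      rw [norm_pow, norm_norm]
      exact pow_le_pow_left₀ (norm_nonneg _) (hC ω) 2)
  have hii : Integrable (fun ω => inner 𝕜 m (f ω)) μ := hi.const_inner m
  have h1 : ∀ ω, ‖f ω - m‖ ^ 2 = ‖m‖ ^ 2 - 2 * RCLike.re (inner 𝕜 m (f ω)) + ‖f ω‖ ^ 2 := by
    intro ω; rw [norm_sub_rev, norm_sub_sq (𝕜 := 𝕜)]
  simp_rw [h1]
  have hi3 : Integrable (fun ω => ‖m‖ ^ 2 - 2 * RCLike.re (inner 𝕜 m (f ω))) μ :=
    (integrable_const _).sub (hii.re.const_mul 2)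
  rw [integral_add hi3 hi2, integral_sub (integrable_const _) (hii.re.const_mul 2),
    integral_const_mul, integral_re hii, integral_inner hi, ← hm, inner_self_eq_norm_sq,
    integral_const, probReal_univ, one_smul]
  nlinarith [sq_nonneg ‖m‖]

namespace IsDithered

theorem swap {μ : Measure Ω} (h : IsDithered lam y τ τ' μ) : IsDithered lam y τ' τ μ where
  measurable := h.measurable
  measurable_fst := h.measurable_snd
  measurable_snd := h.measurable_fst
  law_fst := h.law_snd
  law_snd := h.law_fst
  indep := h.indep.comp measurable_id measurable_swap
  indep_dithers := h.indep_dithers.symm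

theorem integral_comp_fst {μ : Measure Ω} (h : IsDithered lam y τ τ' μ) {f : (Fin p → 𝕜) → 𝕜}
    (hf : Measurable f) :
    ∫ ω, f (τ ω) ∂μ = ∫ v, f v ∂ditherLaw 𝕜 p lam := by
  rw [← h.law_fst, integral_map h.measurable_fst.aemeasurable hf.aestronglyMeasurable]

theorem integral_quantize_mul_star_const {μ : Measure Ω} (h : IsDithered lam y τ τ' μ)
    (hlam : 0 < lam) (v : Fin p → 𝕜) (i j : Fin p) :
    ∫ ω, quantize v (τ ω) i * star (quantize v (τ' ω) j) ∂μ =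
      clipField lam (v i) / lam * star (clipField lam (v j) / lam : 𝕜) := by
  have hf := measurable_signField_add (v i) i
  have hg : Measurable fun t : Fin p → 𝕜 => star (signField (v j + t j)) :=
    continuous_star.measurable.comp (measurable_signField_add _ j)
  have h1 := h.indep_dithers.integral_fun_comp_mul_comp (𝕜 := 𝕜)
    (f := fun t : Fin p → 𝕜 => signField (v i + t i))
    (g := fun t : Fin p → 𝕜 => star (signField (v j + t j)))
    h.measurable_fst.aemeasurable h.measurable_snd.aemeasurable
    hf.aestronglyMeasurable hg.aestronglyMeasurable
  rw [h.integral_comp_fst hf, h.swap.integral_comp_fst hg, integral_signField_add_ditherLaw hlam,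
    integral_star_signField_add_ditherLaw hlam] at h1
  exact h1

theorem sq_mul_div_mul_star_div (hlam : 0 < lam) (z z' : 𝕜) :
    ((lam ^ 2 : ℝ) : 𝕜) * (z / lam * star (z' / lam)) = z * star z' := by
  have hl : (lam : 𝕜) ≠ 0 := by exact_mod_cast hlam.ne'
  rw [star_div₀, RCLike.star_def, RCLike.conj_ofReal]
  push_cast
  field_simp

/-- Freeze `y` and average over the two independent dithers; the factors `1 / lam` of the two means
cancel `lam²`. Diagonal entries need no exception. -/
theorem integral_quantize_mul_star (h : IsDithered lam y τ τ' μ) (hlam : 0 < lam) (i j : Fin p) :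
    ((lam ^ 2 : ℝ) : 𝕜) * ∫ ω, quantize (y ω) (τ ω) i * star (quantize (y ω) (τ' ω) j) ∂μ =
      clippedMoment lam y μ i j := by
  have hm : Measurable fun z : (Fin p → 𝕜) × (Fin p → 𝕜) × (Fin p → 𝕜) =>
      quantize z.1 z.2.1 i * star (quantize z.1 z.2.2 j) :=
    measurable_mul_star_quantize _root_.measurable_fst
      (_root_.measurable_fst.comp _root_.measurable_snd)
      (_root_.measurable_snd.comp _root_.measurable_snd) i j
  have h1 := integral_comp_of_indepFun h.indep h.measurable
    (h.measurable_fst.prodMk h.measurable_snd)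
    (g := fun v t => quantize v t.1 i * star (quantize v t.2 j)) hm.aestronglyMeasurable
    (integrable_mul_star_quantize h.measurable h.measurable_fst h.measurable_snd i j)
  simp only [h.integral_quantize_mul_star_const hlam] at h1
  rw [h1, clippedMoment, of_apply, ← integral_const_mul]
  simp only [sq_mul_div_mul_star_div hlam]

/-- The counterpart for a single dither, which enters the variance; it holds off the diagonal only.
-/
theorem integral_quantize_mul_star_self (h : IsDithered lam y τ τ' μ)
    (hlam : 0 < lam) {i j : Fin p} (hij : i ≠ j) :
    ((lam ^ 2 : ℝ) : 𝕜) * ∫ ω, quantize (y ω) (τ ω) i * star (quantize (y ω) (τ ω) j) ∂μ =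
      clippedMoment lam y μ i j := by
  have hm : Measurable (Function.uncurry fun (v t : Fin p → 𝕜) =>
      quantize v t i * star (quantize v t j)) :=
    measurable_mul_star_quantize _root_.measurable_fst _root_.measurable_snd
      _root_.measurable_snd i j
  have hind : IndepFun y τ μ := h.indep.comp measurable_id _root_.measurable_fst
  rw [integral_comp_of_indepFun hind h.measurable h.measurable_fst
    (g := fun v t => quantize v t i * star (quantize v t j)) hm.aestronglyMeasurable
    (integrable_mul_star_quantize h.measurable h.measurable_fst h.measurable_fst i j),
    clippedMoment, of_apply, ← integral_const_mul]
  congr 1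
  ext ω
  have hg : Measurable fun v : Fin p → 𝕜 =>
      signField (y ω i + v i) * star (signField (y ω j + v j)) :=
    (measurable_signField_add _ i).mul
      (continuous_star.measurable.comp (measurable_signField_add _ j))
  have h1 := h.integral_comp_fst hg
  rw [integral_signField_add_mul_star_ditherLaw hlam _ _ hij] at h1
  exact (congrArg _ h1).trans (sq_mul_div_mul_star_div hlam _ _)

theorem integral_symQuantized (h : IsDithered lam y τ τ' μ) (hlam : 0 < lam) (i j : Fin p) :
    ∫ ω, symQuantized lam (quantize (y ω) (τ ω)) (quantize (y ω) (τ' ω)) i j ∂μ =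
      clippedMoment lam y μ i j := by
  simp only [symQuantized, of_apply]
  rw [integral_const_mul, integral_add
    (integrable_mul_star_quantize h.measurable h.measurable_fst h.measurable_snd i j)
    (integrable_mul_star_quantize h.measurable h.measurable_snd h.measurable_fst i j), mul_add]
  have h1 := h.integral_quantize_mul_star hlam i j
  have h2 := h.swap.integral_quantize_mul_star hlam i j
  have h3 : ((lam ^ 2 / 2 : ℝ) : 𝕜) = (2 : 𝕜)⁻¹ * ((lam ^ 2 : ℝ) : 𝕜) := by
    push_cast; ring
  rw [h3, mul_assoc, mul_assoc, h1, h2, ← mul_add, ← two_mul, inv_mul_cancel_left₀ two_ne_zero]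

/-- The second moment matrix of one quantized vector, scaled by `lam²`, agrees with the clipped
moment off the diagonal. On the diagonal it exceeds it by at most `2 * lam²`, as `‖q i‖² ≤ 2` and
the clipped moment has a nonnegative diagonal. -/
theorem integral_norm_sq_sum_star_quantize_le (h : IsDithered lam y τ τ' μ)
    (hlam : 0 < lam) (w : Fin p → 𝕜) :
    lam ^ 2 * ∫ ω, ‖∑ j, star (quantize (y ω) (τ ω) j) * w j‖ ^ 2 ∂μ ≤
      (‖clippedMoment lam y μ‖ + 2 * lam ^ 2) * ∑ i, ‖w i‖ ^ 2 := by
  set G := clippedMoment lam y μ with hG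
  have hi := fun i j => integrable_mul_star_quantize (μ := μ) h.measurable h.measurable_fst
    h.measurable_fst i j
  have hexp : ∀ ω, ((‖∑ j, star (quantize (y ω) (τ ω) j) * w j‖ ^ 2 : ℝ) : 𝕜) =
      ∑ i, ∑ j, star (w i) * w j * (quantize (y ω) (τ ω) i * star (quantize (y ω) (τ ω) j)) := by
    intro ω
    rw [RCLike.ofReal_pow, ← RCLike.conj_mul, map_sum, Finset.sum_mul_sum]
    refine Finset.sum_congr rfl fun i _ => Finset.sum_congr rfl fun j _ => ?_
    rw [map_mul, RCLike.star_def, RCLike.conj_conj]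
    ring
  have hint : ((lam ^ 2 * ∫ ω, ‖∑ j, star (quantize (y ω) (τ ω) j) * w j‖ ^ 2 ∂μ : ℝ) : 𝕜) =
      ∑ i, ∑ j, star (w i) * w j * (((lam ^ 2 : ℝ) : 𝕜) *
        ∫ ω, quantize (y ω) (τ ω) i * star (quantize (y ω) (τ ω) j) ∂μ) := by
    rw [RCLike.ofReal_mul, ← integral_ofReal]
    simp_rw [hexp]
    rw [integral_finsetSum _ fun i _ => integrable_finsetSum _ fun j _ => (hi i j).const_mul _,
      Finset.mul_sum]
    refine Finset.sum_congr rfl fun i _ => ?_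
    rw [integral_finsetSum _ fun j _ => (hi i j).const_mul _, Finset.mul_sum]
    refine Finset.sum_congr rfl fun j _ => ?_
    rw [integral_const_mul]
    ring
  set H : Fin p → Fin p → 𝕜 := fun i j => ((lam ^ 2 : ℝ) : 𝕜) *
        ∫ ω, quantize (y ω) (τ ω) i * star (quantize (y ω) (τ ω) j) ∂μ with hH
  have hsplit : ∑ i, ∑ j, star (w i) * w j * H i j =
      ∑ i, star (w i) * (G *ᵥ w) i + ∑ i, ((‖w i‖ ^ 2 : ℝ) : 𝕜) * (H i i - G i i) := by
    rw [← Finset.sum_add_distrib]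
    refine Finset.sum_congr rfl fun i _ => ?_
    have h1 : ∑ j, star (w i) * w j * (H i j - G i j) =
        ((‖w i‖ ^ 2 : ℝ) : 𝕜) * (H i i - G i i) := by
      rw [Finset.sum_eq_single i]
      · rw [RCLike.star_def, RCLike.conj_mul, RCLike.ofReal_pow]
      · intro j _ hj
        rw [show H i j = G i j from h.integral_quantize_mul_star_self hlam hj.symm, sub_self,
          mul_zero]
      · simp
    rw [← h1, mulVec, dotProduct, Finset.mul_sum, ← Finset.sum_add_distrib]
    refine Finset.sum_congr rfl fun j _ => ?_
    ring
  have hGii : ∀ i, 0 ≤ RCLike.re (G i i) := by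
    intro i
    rw [hG, clippedMoment, of_apply]
    have h1 : ∀ ω, clipField lam (y ω i) * star (clipField lam (y ω i)) =
        ((‖clipField lam (y ω i)‖ ^ 2 : ℝ) : 𝕜) := by
      intro ω; rw [RCLike.star_def, RCLike.mul_conj, RCLike.ofReal_pow]
    simp_rw [h1]
    rw [integral_ofReal, RCLike.ofReal_re]
    exact integral_nonneg fun ω => by positivity
  have hHii : ∀ i, RCLike.re (H i i) ≤ 2 * lam ^ 2 := by
    intro i
    rw [hH, RCLike.re_ofReal_mul, mul_comm]
    refine mul_le_mul_of_nonneg_right ((RCLike.re_le_norm _).trans ?_) (by positivity)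
    refine (norm_integral_le_of_norm_le_const (ae_of_all _ fun ω =>
      norm_mul_star_quantize_le _ _ _ _ _ _)).trans_eq ?_
    rw [probReal_univ, mul_one]
  have hre := congrArg RCLike.re (hint.trans hsplit)
  rw [RCLike.ofReal_re] at hre
  rw [hre, map_add, add_mul]
  refine add_le_add (re_star_dotProduct_mulVec_le G w) ?_
  rw [Finset.mul_sum, map_sum]
  refine Finset.sum_le_sum fun i _ => ?_
  rw [RCLike.re_ofReal_mul, map_sub, mul_comm]
  exact mul_le_mul_of_nonneg_right (by linarith [hGii i, hHii i]) (by positivity)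

/-- Centring can only decrease second moments. Each row of the symmetrized product applied to `w` is
a combination, with coefficients of norm at most `√2`, of the two scalars `⟨q, w⟩` and `⟨q', w⟩`,
whose second moments are controlled by the clipped moment. Summing over the rows gives the factor
`p`. -/
theorem integral_norm_sq_symQuantized_sub_le (h : IsDithered lam y τ τ' μ)
    (hlam : 0 < lam) (w : Fin p → 𝕜) :
    ∫ ω, ∑ i, ‖((symQuantized lam (quantize (y ω) (τ ω)) (quantize (y ω) (τ' ω)) -
        clippedMoment lam y μ) *ᵥ w) i‖ ^ 2 ∂μ ≤
      2 * p * lam ^ 2 * (‖clippedMoment lam y μ‖ + 2 * lam ^ 2) * ∑ i, ‖w i‖ ^ 2 := by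
  set Z : Ω → Matrix (Fin p) (Fin p) 𝕜 := fun ω =>
    symQuantized lam (quantize (y ω) (τ ω)) (quantize (y ω) (τ' ω)) with hZ
  set G := clippedMoment lam y μ with hG
  have hmv : ∀ (A : Matrix (Fin p) (Fin p) 𝕜) i, (A *ᵥ w) i = ∑ j, A i j * w j := fun _ _ => rfl
  have hZm : ∀ i j, Measurable fun ω => Z ω i j := fun i j =>
    ((measurable_mul_star_quantize h.measurable h.measurable_fst h.measurable_snd i j).add
      (measurable_mul_star_quantize h.measurable h.measurable_snd h.measurable_fst i j)).const_mul _
  have hZi : ∀ i j, Integrable (fun ω => Z ω i j * w j) μ := fun i j =>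
    (Integrable.of_bound (hZm i j).aestronglyMeasurable (2 * lam ^ 2)
      (ae_of_all _ fun _ => norm_symQuantized_le _ _ _ _ _ _)).mul_const _
  have hZwm : ∀ i, Measurable fun ω => (Z ω *ᵥ w) i := fun i => by
    simp_rw [hmv]
    exact Finset.measurable_fun_sum _ fun j _ => (hZm i j).mul_const _
  have hZwb : ∀ i ω, ‖(Z ω *ᵥ w) i‖ ≤ ∑ j, 2 * lam ^ 2 * ‖w j‖ := fun i ω => by
    rw [hmv]
    refine (norm_sum_le _ _).trans (Finset.sum_le_sum fun j _ => ?_)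
    rw [norm_mul]
    exact mul_le_mul_of_nonneg_right (norm_symQuantized_le _ _ _ _ _ _) (norm_nonneg _)
  have hmean : ∀ i, ∫ ω, (Z ω *ᵥ w) i ∂μ = (G *ᵥ w) i := by
    intro i
    simp_rw [hmv]
    refine (integral_finsetSum _ fun j _ => hZi i j).trans (Finset.sum_congr rfl fun j _ => ?_)
    rw [integral_mul_const, h.integral_symQuantized hlam]
  have hamb : ∀ t : Ω → Fin p → 𝕜, Measurable t →
      Integrable (fun ω => ‖∑ j, star (quantize (y ω) (t ω) j) * w j‖ ^ 2) μ := by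
    intro t ht
    have hm : Measurable fun ω => ∑ j, star (quantize (y ω) (t ω) j) * w j :=
      Finset.measurable_fun_sum _ fun j _ => (continuous_star.measurable.comp
        (measurable_quantize_apply h.measurable ht j)).mul_const _
    refine Integrable.of_bound (hm.norm.pow_const 2).aestronglyMeasurable
      ((∑ j, √2 * ‖w j‖) ^ 2) (ae_of_all _ fun ω => ?_)
    rw [norm_pow, norm_norm]
    gcongr
    refine (norm_sum_le _ _).trans (Finset.sum_le_sum fun j _ => ?_)
    rw [norm_mul, norm_star]
    exact mul_le_mul_of_nonneg_right (norm_quantize_le _ _ _) (norm_nonneg _)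
  have hpt : ∀ ω i, ‖(Z ω *ᵥ w) i‖ ^ 2 ≤
      lam ^ 2 * (lam ^ 2 * ‖∑ j, star (quantize (y ω) (τ ω) j) * w j‖ ^ 2) +
      lam ^ 2 * (lam ^ 2 * ‖∑ j, star (quantize (y ω) (τ' ω) j) * w j‖ ^ 2) := by
    intro ω i
    set a := ∑ j, star (quantize (y ω) (τ ω) j) * w j
    set a' := ∑ j, star (quantize (y ω) (τ' ω) j) * w j
    have h1 : (Z ω *ᵥ w) i = ((lam ^ 2 / 2 : ℝ) : 𝕜) *
        (quantize (y ω) (τ ω) i * a' + quantize (y ω) (τ' ω) i * a) := by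
      rw [hmv, Finset.mul_sum, Finset.mul_sum, ← Finset.sum_add_distrib, Finset.mul_sum]
      refine Finset.sum_congr rfl fun j _ => ?_
      rw [hZ]
      simp only [symQuantized, of_apply]
      ring
    have h2 : ‖quantize (y ω) (τ ω) i * a' + quantize (y ω) (τ' ω) i * a‖ ≤
        √2 * ‖a'‖ + √2 * ‖a‖ := by
      refine (norm_add_le _ _).trans (add_le_add ?_ ?_) <;> rw [norm_mul] <;>
        exact mul_le_mul_of_nonneg_right (norm_quantize_le _ _ _) (norm_nonneg _)
    have h3 := pow_le_pow_left₀ (norm_nonneg _) h2 2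
    have h4 : (√2 * ‖a'‖ + √2 * ‖a‖) ^ 2 ≤ 4 * (‖a‖ ^ 2 + ‖a'‖ ^ 2) := by
      have h5 : √2 ^ 2 = 2 := Real.sq_sqrt (by norm_num)
      rw [← mul_add, mul_pow, h5]
      nlinarith [sq_nonneg (‖a‖ - ‖a'‖)]
    rw [h1, norm_mul, RCLike.norm_ofReal, abs_of_nonneg (by positivity), mul_pow]
    calc _ ≤ (lam ^ 2 / 2) ^ 2 * (4 * (‖a‖ ^ 2 + ‖a'‖ ^ 2)) := by
          gcongr; exact h3.trans h4
      _ = _ := by ring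
  have hsub : ∀ ω i, ((Z ω - G) *ᵥ w) i = (Z ω *ᵥ w) i - (G *ᵥ w) i := by
    intro ω i; rw [sub_mulVec]; rfl
  change ∫ ω, ∑ i, ‖((Z ω - G) *ᵥ w) i‖ ^ 2 ∂μ ≤ _
  simp_rw [hsub]
  rw [integral_finsetSum]
  swap
  · intro i _
    refine Integrable.of_bound (((hZwm i).sub_const _).norm.pow_const 2).aestronglyMeasurable
      ((∑ j, 2 * lam ^ 2 * ‖w j‖ + ‖(G *ᵥ w) i‖) ^ 2) (ae_of_all _ fun ω => ?_)
    rw [norm_pow, norm_norm]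
    gcongr
    exact (norm_sub_le _ _).trans (add_le_add (hZwb i ω) le_rfl)
  have hA := h.integral_norm_sq_sum_star_quantize_le hlam w
  have hA' := h.swap.integral_norm_sq_sum_star_quantize_le hlam w
  have hbound : ∀ i, ∫ ω, ‖(Z ω *ᵥ w) i - (G *ᵥ w) i‖ ^ 2 ∂μ ≤
      lam ^ 2 * ((‖G‖ + 2 * lam ^ 2) * ∑ i, ‖w i‖ ^ 2) +
      lam ^ 2 * ((‖G‖ + 2 * lam ^ 2) * ∑ i, ‖w i‖ ^ 2) := by
    intro i
    rw [← hmean]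
    refine (integral_norm_sq_sub_integral_le (hZwm i) (hZwb i)).trans ?_
    have i1 := ((hamb τ h.measurable_fst).const_mul (lam ^ 2)).const_mul (lam ^ 2)
    have i2 := ((hamb τ' h.measurable_snd).const_mul (lam ^ 2)).const_mul (lam ^ 2)
    refine (integral_mono_of_nonneg (ae_of_all _ fun ω => by positivity) (i1.add i2)
      (ae_of_all _ fun ω => hpt ω i)).trans ?_
    rw [integral_add' i1 i2]
    simp_rw [integral_const_mul]
    gcongr
  refine (Finset.sum_le_sum fun i _ => hbound i).trans_eq ?_
  rw [Finset.sum_const, Finset.card_univ, Fintype.card_fin, nsmul_eq_mul]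
  ring

end IsDithered

end DitheredSample

/-! ### Subgaussian tails and the truncation bias -/

section Subgaussian

variable {Ω : Type*} [MeasurableSpace Ω] {μ : Measure Ω}

/-- The strict inequality yields an admissible `t < T`, so the infimum need not be attained. -/
theorem lintegral_exp_sq_div_le_of_psi2Norm_lt {X : Ω → ℝ} {T : ℝ}
    (h : psi2Norm X μ < ENNReal.ofReal T) :
    ∫⁻ ω, ENNReal.ofReal (Real.exp (X ω ^ 2 / T ^ 2)) ∂μ ≤ 2 := by
  rw [psi2Norm] at h
  simp only [iInf_lt_iff] at h
  obtain ⟨t, ht, hle, htT⟩ := h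
  have htT' : t < T := ((ENNReal.ofReal_lt_ofReal_iff_of_nonneg ht.le).1 htT)
  refine (lintegral_mono fun ω => ?_).trans hle
  gcongr

theorem ofReal_mul_eLpNorm_lt {X : Ω → ℝ} (hX : MemLp X 2 μ) {K T : ℝ} (hT : 0 < T)
    (h : K ^ 2 * ∫ ω, X ω ^ 2 ∂μ < T ^ 2) :
    ENNReal.ofReal K * eLpNorm X 2 μ < ENNReal.ofReal T := by
  have h1 : eLpNorm X 2 μ = ENNReal.ofReal (√(∫ ω, X ω ^ 2 ∂μ)) := by
    rw [hX.eLpNorm_eq_integral_rpow_norm two_ne_zero ENNReal.ofNat_ne_top, Real.sqrt_eq_rpow]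
    simp
  rw [h1]
  rcases le_or_gt K 0 with hK | hK
  · rw [ENNReal.ofReal_of_nonpos hK, zero_mul]
    exact ENNReal.ofReal_pos.2 hT
  rw [← ENNReal.ofReal_mul hK.le, ENNReal.ofReal_lt_ofReal_iff hT]
  refine lt_of_pow_lt_pow_left₀ 2 hT.le ?_
  rw [mul_pow, Real.sq_sqrt (integral_nonneg fun ω => sq_nonneg _)]
  exact h

theorem IsSubgaussianReal.lintegral_exp_le {p : ℕ} {K : ℝ} {y : Ω → Fin p → ℝ}
    (hy : IsSubgaussianReal K y μ) {T : ℝ} (hT : 0 < T) (i : Fin p)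
    (h : K ^ 2 * ∫ ω, y ω i ^ 2 ∂μ < T ^ 2) :
    ∫⁻ ω, ENNReal.ofReal (Real.exp (y ω i ^ 2 / T ^ 2)) ∂μ ≤ 2 := by
  refine lintegral_exp_sq_div_le_of_psi2Norm_lt ?_
  have h1 := hy.bound (Pi.single i 1)
  simp only [dotProduct_single, mul_one] at h1
  exact h1.trans_lt (ofReal_mul_eLpNorm_lt (hy.memLp i) hT h)

variable {𝕜 : Type*} [RCLike 𝕜] {p : ℕ}

theorem IsSubgaussianVec.memLp {K : ℝ} {y : Ω → Fin p → 𝕜} (hy : IsSubgaussianVec K y μ)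
    (i : Fin p) : MemLp (fun ω => y ω i) 2 μ :=
  memLp_re_im_iff.1 ⟨hy.1.memLp i, hy.2.memLp i⟩

theorem IsSubgaussianVec.integral_eq_zero [IsProbabilityMeasure μ] {K : ℝ} {y : Ω → Fin p → 𝕜}
    (hy : IsSubgaussianVec K y μ) (i : Fin p) : ∫ ω, y ω i ∂μ = 0 := by
  have hi : Integrable (fun ω => y ω i) μ := (hy.memLp i).integrable one_le_two
  have h1 := hy.1.mean_zero i
  have h2 := hy.2.mean_zero i
  rw [integral_re hi] at h1
  rw [integral_im hi] at h2
  rw [← RCLike.re_add_im (∫ ω, y ω i ∂μ), h1, h2]; simp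

/-- A quadratic exponential moment of a sum of two scalars. -/
theorem exp_norm_add_sq_div_le (a b : 𝕜) (T : ℝ) :
    Real.exp (‖a + b‖ ^ 2 / T ^ 2) ≤
      (Real.exp (8 * RCLike.re a ^ 2 / T ^ 2) + Real.exp (8 * RCLike.im a ^ 2 / T ^ 2) +
        (Real.exp (8 * RCLike.re b ^ 2 / T ^ 2) + Real.exp (8 * RCLike.im b ^ 2 / T ^ 2))) / 4 := by
  have hmid : ∀ u v : ℝ, Real.exp ((u + v) / 2) ≤ (Real.exp u + Real.exp v) / 2 := by
    intro u v
    have h1 : Real.exp u = Real.exp (u / 2) ^ 2 := by rw [← Real.exp_nat_mul]; congr 1; ring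
    have h2 : Real.exp v = Real.exp (v / 2) ^ 2 := by rw [← Real.exp_nat_mul]; congr 1; ring
    rw [add_div, Real.exp_add, h1, h2]
    nlinarith [sq_nonneg (Real.exp (u / 2) - Real.exp (v / 2))]
  -- The right side is the mean of the four squares, each multiplied by `8`, so midpoint convexity
  -- of `exp`, used twice, finishes.
  have h1 : ‖a + b‖ ^ 2 ≤ 2 * (RCLike.re a ^ 2 + RCLike.im a ^ 2) +
      2 * (RCLike.re b ^ 2 + RCLike.im b ^ 2) := by
    rw [norm_sq_eq_re_add_im, map_add, map_add]
    nlinarith [sq_nonneg (RCLike.re a - RCLike.re b), sq_nonneg (RCLike.im a - RCLike.im b)]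
  calc Real.exp (‖a + b‖ ^ 2 / T ^ 2)
      ≤ Real.exp (((8 * RCLike.re a ^ 2 / T ^ 2 + 8 * RCLike.im a ^ 2 / T ^ 2) / 2 +
        (8 * RCLike.re b ^ 2 / T ^ 2 + 8 * RCLike.im b ^ 2 / T ^ 2) / 2) / 2) := by
        refine Real.exp_le_exp.2 ?_
        have h2 := div_le_div_of_nonneg_right h1 (sq_nonneg T)
        refine h2.trans_eq ?_
        ring
    _ ≤ _ := by
      refine (hmid _ _).trans ?_
      linarith [hmid (8 * RCLike.re a ^ 2 / T ^ 2) (8 * RCLike.im a ^ 2 / T ^ 2),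
        hmid (8 * RCLike.re b ^ 2 / T ^ 2) (8 * RCLike.im b ^ 2 / T ^ 2)]

theorem IsSubgaussianVec.lintegral_exp_le {K : ℝ} {y : Ω → Fin p → 𝕜}
    (hy : IsSubgaussianVec K y μ) {T : ℝ} (hT : 0 < T) (i : Fin p)
    (h : 8 * (K ^ 2 * ∫ ω, ‖y ω i‖ ^ 2 ∂μ) < T ^ 2) :
    ∫⁻ ω, ENNReal.ofReal (Real.exp (8 * RCLike.re (y ω i) ^ 2 / T ^ 2)) ∂μ ≤ 2 ∧
      ∫⁻ ω, ENNReal.ofReal (Real.exp (8 * RCLike.im (y ω i) ^ 2 / T ^ 2)) ∂μ ≤ 2 := by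
  have hi : Integrable (fun ω => ‖y ω i‖ ^ 2) μ := (hy.memLp i).integrable_norm_pow two_ne_zero
  have h8 : √8 ^ 2 = 8 := Real.sq_sqrt (by norm_num)
  -- The factor `8` in the exponent amounts to the scale `T / √8` for the real and imaginary parts.
  have hT8 : 0 < T / √8 := by positivity
  have key : ∀ f : Ω → ℝ, (∀ ω, f ω ^ 2 ≤ ‖y ω i‖ ^ 2) →
      K ^ 2 * ∫ ω, f ω ^ 2 ∂μ < (T / √8) ^ 2 := by
    intro f hf
    have h1 : ∫ ω, f ω ^ 2 ∂μ ≤ ∫ ω, ‖y ω i‖ ^ 2 ∂μ :=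
      integral_mono_of_nonneg (ae_of_all _ fun ω => sq_nonneg _) hi (ae_of_all _ hf)
    rw [div_pow, h8, lt_div_iff₀ (by norm_num)]
    nlinarith [mul_le_mul_of_nonneg_left h1 (sq_nonneg K)]
  have hdiv : ∀ u : ℝ, u ^ 2 / (T / √8) ^ 2 = 8 * u ^ 2 / T ^ 2 := by
    intro u; rw [div_pow, h8]; field_simp
  constructor
  · have := hy.1.lintegral_exp_le hT8 i (key _ fun ω => by
      rw [norm_sq_eq_re_add_im]; nlinarith [sq_nonneg (RCLike.im (y ω i))])
    simpa only [hdiv] using this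
  · have := hy.2.lintegral_exp_le hT8 i (key _ fun ω => by
      rw [norm_sq_eq_re_add_im]; nlinarith [sq_nonneg (RCLike.re (y ω i))])
    simpa only [hdiv] using this

/-- The part of `‖z‖²` beyond the dithering range. -/
noncomputable def excess (lam : ℝ) (z : 𝕜) : ℝ := if ‖z‖ ≤ lam then 0 else ‖z‖ ^ 2

theorem excess_nonneg (lam : ℝ) (z : 𝕜) : 0 ≤ excess lam z := by
  unfold excess; split_ifs <;> positivity

/-- Half of the exponent `‖z‖² / T²` absorbs the polynomial factor through `u ≤ exp u`; the other
half, beyond the range, yields the small prefactor. -/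
theorem excess_le {lam T : ℝ} (hlam : 0 < lam) (hT : 0 < T) (z : 𝕜) :
    excess lam z ≤ 2 * T ^ 2 * Real.exp (-(lam ^ 2 / (2 * T ^ 2))) *
      Real.exp (‖z‖ ^ 2 / T ^ 2) := by
  unfold excess
  split_ifs with h
  · positivity
  · push Not at h
    have h1 : ‖z‖ ^ 2 / (2 * T ^ 2) ≤ Real.exp (‖z‖ ^ 2 / (2 * T ^ 2)) :=
      (by linarith [Real.add_one_le_exp (‖z‖ ^ 2 / (2 * T ^ 2))])
    rw [div_le_iff₀ (by positivity)] at h1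
    have h2 : Real.exp (‖z‖ ^ 2 / (2 * T ^ 2)) ≤
        Real.exp (-(lam ^ 2 / (2 * T ^ 2))) * Real.exp (‖z‖ ^ 2 / T ^ 2) := by
      rw [← Real.exp_add]
      gcongr
      have h3 : lam ^ 2 / (2 * T ^ 2) ≤ ‖z‖ ^ 2 / (2 * T ^ 2) := by gcongr
      have h4 : ‖z‖ ^ 2 / T ^ 2 = ‖z‖ ^ 2 / (2 * T ^ 2) + ‖z‖ ^ 2 / (2 * T ^ 2) := by
        field_simp; norm_num
      linarith
    calc ‖z‖ ^ 2 ≤ _ := h1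
      _ ≤ (Real.exp (-(lam ^ 2 / (2 * T ^ 2))) * Real.exp (‖z‖ ^ 2 / T ^ 2)) * (2 * T ^ 2) := by
        gcongr
      _ = _ := by ring

/-- Change one factor at a time. The clipping error of `u` vanishes for `‖u‖ ≤ lam`; otherwise `‖u‖
* ‖v‖` is at most the larger of the two squares, and the larger vector is also beyond the range. -/
theorem norm_clipField_mul_star_sub_le {lam : ℝ} (hlam : 0 < lam) (a b : 𝕜) :
    ‖clipField lam a * star (clipField lam b) - a * star b‖ ≤
      2 * (excess lam a + excess lam b) := by
  have hcross : ∀ u v : 𝕜, ‖clipField lam u - u‖ * ‖v‖ ≤ excess lam u + excess lam v := by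
    intro u v
    unfold excess
    rcases le_or_gt ‖u‖ lam with h | h
    · rw [clipField_eq_self h, if_pos h, sub_self, norm_zero, zero_mul, zero_add]
      split_ifs <;> positivity
    · rw [if_neg h.not_ge]
      have h1 := mul_le_mul_of_nonneg_right (norm_clipField_sub_le hlam u) (norm_nonneg v)
      rcases le_total ‖v‖ ‖u‖ with h2 | h2
      · have : 0 ≤ (if ‖v‖ ≤ lam then 0 else ‖v‖ ^ 2) := by split_ifs <;> positivity
        nlinarith [norm_nonneg u, norm_nonneg v]
      · rw [if_neg (h.trans_le h2).not_ge]
        nlinarith [norm_nonneg u, norm_nonneg v]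
  have h1 : clipField lam a * star (clipField lam b) - a * star b =
      (clipField lam a - a) * star (clipField lam b) + star (clipField lam b - b) * a := by
    rw [star_sub]; ring
  rw [h1]
  refine (norm_add_le _ _).trans ?_
  rw [norm_mul, norm_mul, norm_star, norm_star]
  have h2 := mul_le_mul_of_nonneg_left (norm_clipField_le hlam b)
    (norm_nonneg (clipField lam a - a))
  linarith [hcross a b, hcross b a]

theorem measurable_excess (lam : ℝ) : Measurable (excess lam : 𝕜 → ℝ) :=
  Measurable.ite (measurableSet_le measurable_norm measurable_const) measurable_const
    (measurable_norm.pow_const 2)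

theorem integral_excess_le {z : Ω → 𝕜} (hz : Measurable z) {lam T M : ℝ} (hlam : 0 < lam)
    (hT : 0 < T) (hM : 0 ≤ M)
    (h : ∫⁻ ω, ENNReal.ofReal (Real.exp (‖z ω‖ ^ 2 / T ^ 2)) ∂μ ≤ ENNReal.ofReal M) :
    ∫ ω, excess lam (z ω) ∂μ ≤ 2 * T ^ 2 * Real.exp (-(lam ^ 2 / (2 * T ^ 2))) * M := by
  rw [integral_eq_lintegral_of_nonneg_ae (ae_of_all _ fun ω => excess_nonneg _ _)
    ((measurable_excess lam).comp hz).aestronglyMeasurable]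
  refine ENNReal.toReal_le_of_le_ofReal (by positivity) ?_
  rw [ENNReal.ofReal_mul (by positivity)]
  calc ∫⁻ ω, ENNReal.ofReal (excess lam (z ω)) ∂μ
      ≤ ∫⁻ ω, ENNReal.ofReal (2 * T ^ 2 * Real.exp (-(lam ^ 2 / (2 * T ^ 2)))) *
          ENNReal.ofReal (Real.exp (‖z ω‖ ^ 2 / T ^ 2)) ∂μ := by
        refine lintegral_mono fun ω => ?_
        rw [← ENNReal.ofReal_mul (by positivity)]
        exact ENNReal.ofReal_le_ofReal (excess_le hlam hT _)
    _ = _ := lintegral_const_mul' _ _ ENNReal.ofReal_ne_top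
    _ ≤ _ := by gcongr

/-- The truncation bias of second moments. -/
theorem norm_clippedMoment_sub_secondMoment_le {y : Ω → Fin p → 𝕜} {lam D : ℝ}
    [IsProbabilityMeasure μ] (hlam : 0 < lam) (hy : Measurable y)
    (hL : ∀ i, MemLp (fun ω => y ω i) 2 μ)
    (hD : ∀ i, ∫ ω, excess lam (y ω i) ∂μ ≤ D) (i j : Fin p) :
    ‖(clippedMoment lam y μ - secondMoment y μ) i j‖ ≤ 4 * D := by
  have hyi : ∀ i, Measurable fun ω => y ω i := fun i => (measurable_pi_apply i).comp hy
  have hex : ∀ i, Integrable (fun ω => excess lam (y ω i)) μ := fun i => by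
    refine ((hL i).integrable_norm_pow two_ne_zero).mono
      ((measurable_excess lam).comp (hyi i)).aestronglyMeasurable (ae_of_all _ fun ω => ?_)
    unfold excess
    split_ifs <;> simp
  have hc : Integrable (fun ω => clipField lam (y ω i) * star (clipField lam (y ω j))) μ := by
    refine Integrable.of_bound (Measurable.aestronglyMeasurable ?_) (2 * lam ^ 2)
      (ae_of_all _ fun ω => norm_mul_star_clipField_le hlam _ _)
    exact ((measurable_clipField lam).comp (hyi i)).mul
      (continuous_star.measurable.comp ((measurable_clipField lam).comp (hyi j)))
  have hy2 : Integrable (fun ω => y ω i * star (y ω j)) μ := (hL i).integrable_mul (hL j).star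
  have h1 : (clippedMoment lam y μ - secondMoment y μ) i j =
      ∫ ω, (clipField lam (y ω i) * star (clipField lam (y ω j)) - y ω i * star (y ω j)) ∂μ := by
    rw [integral_sub hc hy2]; rfl
  rw [h1]
  refine (norm_integral_le_integral_norm _).trans ?_
  calc _ ≤ ∫ ω, 2 * (excess lam (y ω i) + excess lam (y ω j)) ∂μ :=
        integral_mono_of_nonneg (ae_of_all _ fun ω => norm_nonneg _)
          (((hex i).add (hex j)).const_mul 2)
          (ae_of_all _ fun ω => norm_clipField_mul_star_sub_le hlam _ _)
    _ = 2 * (∫ ω, excess lam (y ω i) ∂μ + ∫ ω, excess lam (y ω j) ∂μ) := by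
        rw [integral_const_mul, integral_add (hex i) (hex j)]
    _ ≤ 4 * D := by linarith [hD i, hD j]

end Subgaussian

/-! ### Second moments and tails of the observations -/

section Observation

variable {Ω : Type*} [MeasurableSpace Ω] {μ : Measure Ω} {𝕜 : Type*} [RCLike 𝕜] {n p : ℕ}
  {K ν lam : ℝ} {x e τ τ' : Fin n → Ω → Fin p → 𝕜} {Sx : Matrix (Fin p) (Fin p) 𝕜}

theorem secondMoment_apply (y : Ω → Fin p → 𝕜) (i j : Fin p) :
    secondMoment y μ i j = ∫ ω, y ω i * star (y ω j) ∂μ := rfl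

theorem secondMoment_apply_self (y : Ω → Fin p → 𝕜) (i : Fin p) :
    secondMoment y μ i i = ((∫ ω, ‖y ω i‖ ^ 2 ∂μ : ℝ) : 𝕜) := by
  rw [secondMoment_apply, ← integral_ofReal]
  congr 1
  ext ω
  rw [RCLike.star_def, RCLike.mul_conj, RCLike.ofReal_pow]

theorem secondMoment_isHermitian (y : Ω → Fin p → 𝕜) (μ : Measure Ω) :
    (secondMoment y μ).IsHermitian := by
  ext i j
  rw [Matrix.conjTranspose_apply, secondMoment_apply, secondMoment_apply]
  refine (integral_conj (𝕜 := 𝕜)).symm.trans ?_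
  congr 1
  ext ω
  rw [RCLike.star_def, map_mul, RCLike.conj_conj, mul_comm]

theorem norm_le_maxNorm (A : Matrix (Fin p) (Fin p) 𝕜) (i j : Fin p) : ‖A i j‖ ≤ maxNorm A :=
  (le_ciSup (Set.finite_range fun j => ‖A i j‖).bddAbove j).trans
    (le_ciSup (Set.finite_range fun i => ⨆ j, ‖A i j‖).bddAbove i)

theorem integral_norm_sq_le_Cinf (y : Fin n → Ω → Fin p → 𝕜) (k : Fin n) (i : Fin p) :
    ∫ ω, ‖y k ω i‖ ^ 2 ∂μ ≤ Cinf y μ := by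
  refine le_trans ?_
    (le_ciSup (Set.finite_range fun k => maxNorm (secondMoment (y k) μ)).bddAbove k)
  refine le_trans ?_ (norm_le_maxNorm _ i i)
  rw [secondMoment_apply_self, RCLike.norm_ofReal]
  exact le_abs_self _

theorem opNorm_secondMoment_le_Cop (y : Fin n → Ω → Fin p → 𝕜) (k : Fin n) :
    opNorm (secondMoment (y k) μ) ≤ Cop y μ :=
  le_ciSup (Set.finite_range fun k => opNorm (secondMoment (y k) μ)).bddAbove k

namespace ObservationModel

theorem memLp_noise (h : ObservationModel K ν x e Sx μ) (k : Fin n) (i : Fin p) :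
    MemLp (fun ω => e k ω i) 2 μ := (h.noise.subgaussian k).memLp i

theorem memLp_signal [IsProbabilityMeasure μ] (h : ObservationModel K ν x e Sx μ) (k : Fin n)
    (i : Fin p) : MemLp (fun ω => x k ω i) 2 μ := by
  rcases h.signal with ⟨c, hc, -⟩ | hx
  · simp only [hc]
    exact memLp_const _
  · exact (hx.subgaussian k).memLp i

theorem measurable_observation (h : ObservationModel K ν x e Sx μ) (k : Fin n) :
    Measurable (observation x e k) := (h.measurable_signal k).add (h.measurable_noise k)

theorem memLp_observation [IsProbabilityMeasure μ] (h : ObservationModel K ν x e Sx μ) (k : Fin n)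
    (i : Fin p) : MemLp (fun ω => observation x e k ω i) 2 μ :=
  (h.memLp_signal k i).add (h.memLp_noise k i)

theorem indepFun_signal_noise (h : ObservationModel K ν x e Sx μ) (k l : Fin n) :
    IndepFun (x k) (e l) μ :=
  h.indep.indepFun (i := Sum.inl k) (j := Sum.inr l) Sum.inl_ne_inr

theorem integral_signal_mul_star_noise [IsProbabilityMeasure μ]
    (h : ObservationModel K ν x e Sx μ) (k : Fin n) (i j : Fin p) :
    ∫ ω, x k ω i * star (e k ω j) ∂μ = 0 := by
  have h1 := (h.indepFun_signal_noise k k).integral_fun_comp_mul_comp (𝕜 := 𝕜)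
    (f := fun v : Fin p → 𝕜 => v i) (g := fun v : Fin p → 𝕜 => star (v j))
    (h.measurable_signal k).aemeasurable (h.measurable_noise k).aemeasurable
    (measurable_pi_apply i).aestronglyMeasurable
    (continuous_star.measurable.comp (measurable_pi_apply j)).aestronglyMeasurable
  rw [h1]
  have h2 : ∫ ω, star (e k ω j) ∂μ = 0 := by
    refine (integral_conj (𝕜 := 𝕜)).trans ?_
    rw [(h.noise.subgaussian k).integral_eq_zero j, map_zero]
  rw [h2, mul_zero]

theorem integral_noise_mul_star_signal [IsProbabilityMeasure μ]
    (h : ObservationModel K ν x e Sx μ) (k : Fin n) (i j : Fin p) :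
    ∫ ω, e k ω i * star (x k ω j) ∂μ = 0 := by
  have h1 := congrArg (starRingEnd 𝕜) (h.integral_signal_mul_star_noise k j i)
  rw [map_zero, ← integral_conj] at h1
  rw [← h1]
  congr 1
  ext ω
  simp only [RCLike.star_def, map_mul, RCLike.conj_conj]
  rw [mul_comm]

theorem secondMoment_noise (h : ObservationModel K ν x e Sx μ) (k : Fin n) :
    secondMoment (e k) μ = ((ν ^ 2 : ℝ) : 𝕜) • (1 : Matrix (Fin p) (Fin p) 𝕜) := by
  ext i j
  rw [Matrix.smul_apply, Matrix.one_apply]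
  split_ifs with hij
  · subst hij
    rw [secondMoment_apply_self, h.noise.variance, smul_eq_mul, mul_one]
  · rw [secondMoment_apply, h.noise.uncorrelated k i j hij, smul_zero]

/-- The cross terms vanish by independence and the zero mean of the noise alone, so deterministic
signals are covered as well. -/
theorem secondMoment_observation [IsProbabilityMeasure μ] (h : ObservationModel K ν x e Sx μ)
    (k : Fin n) : secondMoment (observation x e k) μ =
      secondMoment (x k) μ + ((ν ^ 2 : ℝ) : 𝕜) • (1 : Matrix (Fin p) (Fin p) 𝕜) := by
  rw [← h.secondMoment_noise k]
  ext i j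
  rw [Matrix.add_apply]
  simp only [secondMoment_apply]
  have hxx : Integrable (fun ω => x k ω i * star (x k ω j)) μ :=
    (h.memLp_signal k i).integrable_mul (h.memLp_signal k j).star
  have hxe : Integrable (fun ω => x k ω i * star (e k ω j)) μ :=
    (h.memLp_signal k i).integrable_mul (h.memLp_noise k j).star
  have hex : Integrable (fun ω => e k ω i * star (x k ω j)) μ :=
    (h.memLp_noise k i).integrable_mul (h.memLp_signal k j).star
  have hee : Integrable (fun ω => e k ω i * star (e k ω j)) μ :=
    (h.memLp_noise k i).integrable_mul (h.memLp_noise k j).star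
  have h1 : ∀ ω, observation x e k ω i * star (observation x e k ω j) =
      (x k ω i * star (x k ω j) + x k ω i * star (e k ω j)) +
        (e k ω i * star (x k ω j) + e k ω i * star (e k ω j)) := by
    intro ω
    simp only [observation, Pi.add_apply, star_add]
    ring
  have hx2 : Integrable (fun ω => x k ω i * star (x k ω j) + x k ω i * star (e k ω j)) μ :=
    hxx.add hxe
  have he2 : Integrable (fun ω => e k ω i * star (x k ω j) + e k ω i * star (e k ω j)) μ :=
    hex.add hee
  simp_rw [h1]
  rw [integral_add hx2 he2, integral_add hxx hxe, integral_add hex hee,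
    h.integral_signal_mul_star_noise, h.integral_noise_mul_star_signal, add_zero, zero_add]

theorem integral_norm_sq_observation [IsProbabilityMeasure μ] (h : ObservationModel K ν x e Sx μ)
    (k : Fin n) (i : Fin p) :
    ∫ ω, ‖observation x e k ω i‖ ^ 2 ∂μ = ∫ ω, ‖x k ω i‖ ^ 2 ∂μ + ∫ ω, ‖e k ω i‖ ^ 2 ∂μ := by
  have h1 := congrFun (congrFun (h.secondMoment_observation k) i) i
  rw [← h.secondMoment_noise k, Matrix.add_apply] at h1
  simp only [secondMoment_apply_self] at h1
  exact_mod_cast h1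

/-- Here the deterministic and the stochastic signal models merge: from now on only this average
matters for the target matrix. -/
theorem average_secondMoment_signal [IsProbabilityMeasure μ] (hn : 1 ≤ n)
    (h : ObservationModel K ν x e Sx μ) : (n : 𝕜)⁻¹ • ∑ k, secondMoment (x k) μ = Sx := by
  rcases h.signal with ⟨c, hc, hS⟩ | hx
  · rw [hS]
    congr 1
    refine Finset.sum_congr rfl fun k _ => ?_
    ext i j
    rw [secondMoment_apply]
    simp only [hc]
    rw [integral_const, probReal_univ, one_smul]
    rfl
  · have hn0 : (n : 𝕜) ≠ 0 := by exact_mod_cast (by omega : n ≠ 0)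
    rw [Finset.sum_congr rfl fun k _ => (hx.covariance k).symm, Finset.sum_const,
      Finset.card_univ, Fintype.card_fin, ← Nat.cast_smul_eq_nsmul 𝕜, smul_smul,
      inv_mul_cancel₀ hn0, one_smul]

theorem average_secondMoment_observation [IsProbabilityMeasure μ] (hn : 1 ≤ n)
    (h : ObservationModel K ν x e Sx μ) :
    (n : 𝕜)⁻¹ • ∑ k, secondMoment (observation x e k) μ =
      Sx + ((ν ^ 2 : ℝ) : 𝕜) • (1 : Matrix (Fin p) (Fin p) 𝕜) := by
  have hn0 : (n : 𝕜) ≠ 0 := by exact_mod_cast (by omega : n ≠ 0)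
  rw [Finset.sum_congr rfl fun k _ => h.secondMoment_observation k, Finset.sum_add_distrib,
    smul_add, h.average_secondMoment_signal hn, Finset.sum_const,
    Finset.card_univ, Fintype.card_fin, ← Nat.cast_smul_eq_nsmul 𝕜, smul_smul,
    inv_mul_cancel₀ hn0, one_smul]

theorem isHermitian_covariance [IsProbabilityMeasure μ] (hn : 1 ≤ n)
    (h : ObservationModel K ν x e Sx μ) : Sx.IsHermitian := by
  rw [← h.average_secondMoment_signal hn]
  refine IsSelfAdjoint.smul ?_ (sum_mem (S := selfAdjoint (Matrix (Fin p) (Fin p) 𝕜))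
    fun k _ => secondMoment_isHermitian _ _)
  rw [isSelfAdjoint_iff, star_inv₀, star_natCast]

/-- The summand `1` in `K ^ 2 + 1` serves deterministic signals, to which the subgaussian hypothesis
does not apply: it bounds the exponent by `1`, and `exp 1 < 3`. Stochastic signals even have the
bound `2`. -/
theorem lintegral_exp_signal_le [IsProbabilityMeasure μ] (h : ObservationModel K ν x e Sx μ)
    {T : ℝ} (hT : 0 < T) (k : Fin n) (i : Fin p)
    (hle : 8 * (K ^ 2 + 1) * ∫ ω, ‖x k ω i‖ ^ 2 ∂μ < T ^ 2) :
    ∫⁻ ω, ENNReal.ofReal (Real.exp (8 * RCLike.re (x k ω i) ^ 2 / T ^ 2)) ∂μ ≤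
        ENNReal.ofReal 3 ∧
      ∫⁻ ω, ENNReal.ofReal (Real.exp (8 * RCLike.im (x k ω i) ^ 2 / T ^ 2)) ∂μ ≤
        ENNReal.ofReal 3 := by
  have hpos : 0 ≤ ∫ ω, ‖x k ω i‖ ^ 2 ∂μ := integral_nonneg fun ω => by positivity
  rcases h.signal with ⟨c, hc, -⟩ | hx
  · simp only [hc] at hle hpos ⊢
    rw [integral_const, probReal_univ, one_smul] at hle hpos
    simp only [lintegral_const, measure_univ, mul_one]
    have h1 := norm_sq_eq_re_add_im (c k i)
    have h2 : 8 * ‖c k i‖ ^ 2 ≤ T ^ 2 := by nlinarith [mul_nonneg (sq_nonneg K) hpos]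
    have key : ∀ u : ℝ, u ^ 2 ≤ ‖c k i‖ ^ 2 →
        ENNReal.ofReal (Real.exp (8 * u ^ 2 / T ^ 2)) ≤ ENNReal.ofReal 3 := by
      intro u hu
      refine ENNReal.ofReal_le_ofReal (le_trans (Real.exp_le_exp.2 ?_) Real.exp_one_lt_three.le)
      rw [div_le_one (by positivity)]
      linarith
    exact ⟨key _ (by nlinarith [sq_nonneg (RCLike.im (c k i))]),
      key _ (by nlinarith [sq_nonneg (RCLike.re (c k i))])⟩
  · have h23 : (2 : ENNReal) ≤ ENNReal.ofReal 3 := by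
      rw [show (2 : ENNReal) = ENNReal.ofReal 2 by simp]
      exact ENNReal.ofReal_le_ofReal (by norm_num)
    have h1 := (hx.subgaussian k).lintegral_exp_le hT i (by nlinarith)
    exact ⟨h1.1.trans h23, h1.2.trans h23⟩

theorem lintegral_exp_observation_le [IsProbabilityMeasure μ] (h : ObservationModel K ν x e Sx μ)
    {T : ℝ} (hT : 0 < T) (k : Fin n) (i : Fin p)
    (hle : 8 * (K ^ 2 + 1) * ∫ ω, ‖observation x e k ω i‖ ^ 2 ∂μ < T ^ 2) :
    ∫⁻ ω, ENNReal.ofReal (Real.exp (‖observation x e k ω i‖ ^ 2 / T ^ 2)) ∂μ ≤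
      ENNReal.ofReal 3 := by
  rw [h.integral_norm_sq_observation] at hle
  have hx0 : 0 ≤ ∫ ω, ‖x k ω i‖ ^ 2 ∂μ := integral_nonneg fun ω => by positivity
  have he0 : 0 ≤ ∫ ω, ‖e k ω i‖ ^ 2 ∂μ := integral_nonneg fun ω => by positivity
  have hK := sq_nonneg K
  have hKx := mul_nonneg hK hx0
  have hKe := mul_nonneg hK he0
  obtain ⟨h1, h2⟩ := h.lintegral_exp_signal_le hT k i (by nlinarith)
  obtain ⟨h3, h4⟩ := (h.noise.subgaussian k).lintegral_exp_le hT i (by nlinarith)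
  have h23 : (2 : ENNReal) ≤ ENNReal.ofReal 3 := by
    rw [show (2 : ENNReal) = ENNReal.ofReal 2 by simp]
    exact ENNReal.ofReal_le_ofReal (by norm_num)
  have hmx : Measurable fun ω => x k ω i := (measurable_pi_apply i).comp (h.measurable_signal k)
  have hme : Measurable fun ω => e k ω i := (measurable_pi_apply i).comp (h.measurable_noise k)
  have hm : ∀ f : Ω → ℝ, Measurable f →
      Measurable fun ω => ENNReal.ofReal (Real.exp (8 * f ω ^ 2 / T ^ 2)) := fun f hf =>
    (Real.measurable_exp.comp (((hf.pow_const 2).const_mul 8).div_const _)).ennreal_ofReal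
  have hm1 := hm (fun ω => RCLike.re (x k ω i)) (RCLike.measurable_re.comp hmx)
  have hm2 := hm (fun ω => RCLike.im (x k ω i)) (RCLike.measurable_im.comp hmx)
  have hm3 := hm (fun ω => RCLike.re (e k ω i)) (RCLike.measurable_re.comp hme)
  have hm12 : Measurable fun ω =>
      ENNReal.ofReal (Real.exp (8 * RCLike.re (x k ω i) ^ 2 / T ^ 2)) +
        ENNReal.ofReal (Real.exp (8 * RCLike.im (x k ω i) ^ 2 / T ^ 2)) := hm1.add hm2
  calc ∫⁻ ω, ENNReal.ofReal (Real.exp (‖observation x e k ω i‖ ^ 2 / T ^ 2)) ∂μ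
      ≤ ∫⁻ ω, ENNReal.ofReal (1 / 4) *
          ((ENNReal.ofReal (Real.exp (8 * RCLike.re (x k ω i) ^ 2 / T ^ 2)) +
            ENNReal.ofReal (Real.exp (8 * RCLike.im (x k ω i) ^ 2 / T ^ 2))) +
          (ENNReal.ofReal (Real.exp (8 * RCLike.re (e k ω i) ^ 2 / T ^ 2)) +
            ENNReal.ofReal (Real.exp (8 * RCLike.im (e k ω i) ^ 2 / T ^ 2)))) ∂μ := by
        refine lintegral_mono fun ω => ?_
        rw [← ENNReal.ofReal_add (by positivity) (by positivity),
          ← ENNReal.ofReal_add (by positivity) (by positivity),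
          ← ENNReal.ofReal_add (by positivity) (by positivity),
          ← ENNReal.ofReal_mul (by positivity)]
        refine ENNReal.ofReal_le_ofReal
          ((exp_norm_add_sq_div_le (x k ω i) (e k ω i) T).trans_eq ?_)
        ring
    _ = ENNReal.ofReal (1 / 4) *
          ((∫⁻ ω, ENNReal.ofReal (Real.exp (8 * RCLike.re (x k ω i) ^ 2 / T ^ 2)) ∂μ +
            ∫⁻ ω, ENNReal.ofReal (Real.exp (8 * RCLike.im (x k ω i) ^ 2 / T ^ 2)) ∂μ) +
          (∫⁻ ω, ENNReal.ofReal (Real.exp (8 * RCLike.re (e k ω i) ^ 2 / T ^ 2)) ∂μ +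
            ∫⁻ ω, ENNReal.ofReal (Real.exp (8 * RCLike.im (e k ω i) ^ 2 / T ^ 2)) ∂μ)) := by
        rw [lintegral_const_mul' _ _ ENNReal.ofReal_ne_top, lintegral_add_left hm12,
          lintegral_add_left hm1, lintegral_add_left hm3]
    _ ≤ ENNReal.ofReal (1 / 4) * ((ENNReal.ofReal 3 + ENNReal.ofReal 3) +
          (ENNReal.ofReal 3 + ENNReal.ofReal 3)) := by
        gcongr
        · exact h3.trans h23
        · exact h4.trans h23
    _ = ENNReal.ofReal 3 := by
        rw [← ENNReal.ofReal_add (by norm_num) (by norm_num),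
          ← ENNReal.ofReal_add (by norm_num) (by norm_num), ← ENNReal.ofReal_mul (by norm_num)]
        norm_num

/-- With `T² = lam² / (2 * log n)` the tail factor `exp (-lam² / (2 * T²))` is exactly `1 / n`, and
the prefactor `3 / log n` is at most `5` because `log n ≥ 0.6`. The constant `17` exceeds `16 = 2 *
8` to make the moment condition strict. -/
theorem integral_excess_observation_le [IsProbabilityMeasure μ]
    (h : ObservationModel K ν x e Sx μ) (hlam : 0 < lam)
    (hcase : (2 ≤ n ∧ 17 * (K ^ 2 + 1) * Real.log n * Cinf (observation x e) μ ≤ lam ^ 2) ∨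
      ∀ k, ∀ᵐ ω ∂μ, ∀ i, ‖observation x e k ω i‖ ≤ lam) (k : Fin n) (i : Fin p) :
    ∫ ω, excess lam (observation x e k ω i) ∂μ ≤ 5 * lam ^ 2 / n := by
  rcases hcase with ⟨hn, hB⟩ | hbd
  · have hn2 : (2 : ℝ) ≤ n := by exact_mod_cast hn
    have hlog : 0.6 ≤ Real.log n := by
      have := Real.log_le_log two_pos hn2
      linarith [Real.log_two_gt_d9]
    set ℓ := Real.log n with hℓ
    have hℓ0 : 0 < ℓ := by linarith
    have hl2 : 0 < lam ^ 2 := by positivity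
    set T := √(lam ^ 2 / (2 * ℓ)) with hT
    have hT0 : 0 < T := Real.sqrt_pos.2 (by positivity)
    have hT2 : T ^ 2 = lam ^ 2 / (2 * ℓ) := Real.sq_sqrt (by positivity)
    have hm : 8 * (K ^ 2 + 1) * ∫ ω, ‖observation x e k ω i‖ ^ 2 ∂μ < T ^ 2 := by
      rw [hT2, lt_div_iff₀ (by positivity)]
      have h1 := integral_norm_sq_le_Cinf (μ := μ) (observation x e) k i
      have h2 := mul_le_mul_of_nonneg_left h1 (by positivity : 0 ≤ 17 * (K ^ 2 + 1) * ℓ)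
      nlinarith
    have hmeas : Measurable fun ω => observation x e k ω i :=
      (measurable_pi_apply i).comp (h.measurable_observation k)
    refine (integral_excess_le hmeas hlam hT0 (by norm_num)
      (h.lintegral_exp_observation_le hT0 k i hm)).trans ?_
    have hexp : Real.exp (-(lam ^ 2 / (2 * T ^ 2))) = 1 / n := by
      have : lam ^ 2 / (2 * T ^ 2) = ℓ := by rw [hT2]; field_simp
      rw [this, Real.exp_neg, hℓ, Real.exp_log (by linarith), one_div]
    rw [hexp, hT2]
    have : 2 * (lam ^ 2 / (2 * ℓ)) * (1 / n) * 3 = (3 / ℓ) * (lam ^ 2 / n) := by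
      field_simp
    rw [this, mul_div_assoc]
    gcongr
    rw [div_le_iff₀ hℓ0]
    linarith
  · have h1 : (fun ω => excess lam (observation x e k ω i)) =ᵐ[μ] 0 := by
      filter_upwards [hbd k] with ω hω
      rw [excess, if_pos (hω i)]; rfl
    rw [integral_congr_ae h1]
    simp only [Pi.zero_apply, integral_zero]
    positivity

end ObservationModel

end Observation

/-! ### Concentration of the estimator -/

section Estimator

open Matrix
open scoped Matrix.Norms.L2Operator

attribute [local instance] matrixMeasurableSpace matrixBorelSpace matrixSecondCountable

variable {Ω : Type*} {𝕜 : Type*} [RCLike 𝕜] {n p : ℕ}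
  {K ν lam : ℝ} {x e τ τ' : Fin n → Ω → Fin p → 𝕜} {Sx : Matrix (Fin p) (Fin p) 𝕜}

/-- The summand of the estimator that belongs to the signal `v.1.1`, the noise `v.1.2` and the
dithers `v.2`. -/
noncomputable def estimatorTerm (lam : ℝ) (v : ((Fin p → 𝕜) × (Fin p → 𝕜)) ×
    ((Fin p → 𝕜) × (Fin p → 𝕜))) : Matrix (Fin p) (Fin p) 𝕜 :=
  symQuantized lam (quantize (v.1.1 + v.1.2) v.2.1) (quantize (v.1.1 + v.1.2) v.2.2)

theorem measurable_estimatorTerm (lam : ℝ) :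
    Measurable (estimatorTerm lam : ((Fin p → 𝕜) × (Fin p → 𝕜)) ×
      ((Fin p → 𝕜) × (Fin p → 𝕜)) → Matrix (Fin p) (Fin p) 𝕜) := by
  refine measurable_matrix_iff.2 fun i j => ?_
  have hy : Measurable fun v : ((Fin p → 𝕜) × (Fin p → 𝕜)) × ((Fin p → 𝕜) × (Fin p → 𝕜)) =>
      v.1.1 + v.1.2 :=
    (measurable_fst.comp measurable_fst).add (measurable_snd.comp measurable_fst)
  exact ((measurable_mul_star_quantize hy (measurable_fst.comp measurable_snd)
    (measurable_snd.comp measurable_snd) i j).add (measurable_mul_star_quantize hy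
    (measurable_snd.comp measurable_snd) (measurable_fst.comp measurable_snd) i j)).const_mul _

/-- The `k`-th summand of the estimator. -/
noncomputable def sampleTerm (lam : ℝ) (x e τ τ' : Fin n → Ω → Fin p → 𝕜) (k : Fin n) (ω : Ω) :
    Matrix (Fin p) (Fin p) 𝕜 :=
  estimatorTerm lam ((x k ω, e k ω), (τ k ω, τ' k ω))

theorem sampleTerm_eq (k : Fin n) (ω : Ω) : sampleTerm lam x e τ τ' k ω =
    symQuantized lam (quantize (observation x e k ω) (τ k ω))
      (quantize (observation x e k ω) (τ' k ω)) := rfl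

theorem symEstimator_eq_sum (ω : Ω) : symEstimator lam (observation x e) τ τ' ω =
    (n : 𝕜)⁻¹ • ∑ k, sampleTerm lam x e τ τ' k ω := by
  ext i j
  simp only [symEstimator, asymEstimator, sampleTerm_eq, symQuantized, Matrix.add_apply,
    Matrix.smul_apply, Matrix.sum_apply, conjTranspose_apply, of_apply, smul_eq_mul, star_mul',
    star_sum]
  have h1 : ∀ k, outerProd (quantized (observation x e) τ k ω)
      (quantized (observation x e) τ' k ω) i j =
      quantize (observation x e k ω) (τ k ω) i * star (quantize (observation x e k ω) (τ' k ω) j) :=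
    fun _ => rfl
  have h2 : ∀ k, star (outerProd (quantized (observation x e) τ k ω)
      (quantized (observation x e) τ' k ω) j i) =
      quantize (observation x e k ω) (τ' k ω) i *
        star (quantize (observation x e k ω) (τ k ω) j) := by
    intro k
    refine (star_mul' _ _).trans ?_
    rw [Pi.star_apply, star_star, mul_comm]
    rfl
  simp_rw [h1, h2]
  rw [RCLike.star_def, RCLike.conj_ofReal, ← Finset.mul_sum, Finset.sum_add_distrib]
  push_cast
  ring

variable [MeasurableSpace Ω] {μ : Measure Ω}

namespace RectangularDither

theorem measurable_all (hd : RectangularDither lam x e τ τ' μ) (h : ObservationModel K ν x e Sx μ) :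
    ∀ i, Measurable (Sum.elim (Sum.elim x e) (Sum.elim τ τ') i) := by
  rintro ((k | k) | (k | k))
  · exact h.measurable_signal k
  · exact h.measurable_noise k
  · exact hd.measurable_fst k
  · exact hd.measurable_snd k

theorem isDithered (hd : RectangularDither lam x e τ τ' μ) (h : ObservationModel K ν x e Sx μ)
    (k : Fin n) : IsDithered lam (observation x e k) (τ k) (τ' k) μ where
  measurable := h.measurable_observation k
  measurable_fst := hd.measurable_fst k
  measurable_snd := hd.measurable_snd k
  law_fst := hd.law_fst k
  law_snd := hd.law_snd k
  indep := (hd.indep.indepFun_prodMk_prodMk (hd.measurable_all h) (Sum.inl (Sum.inl k))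
    (Sum.inl (Sum.inr k)) (Sum.inr (Sum.inl k)) (Sum.inr (Sum.inr k)) (by simp) (by simp)
    (by simp) (by simp)).comp (_root_.measurable_fst.add _root_.measurable_snd) measurable_id
  indep_dithers := hd.indep.indepFun (i := Sum.inr (Sum.inl k)) (j := Sum.inr (Sum.inr k))
    (by simp)

theorem measurable_sampleTerm (hd : RectangularDither lam x e τ τ' μ)
    (h : ObservationModel K ν x e Sx μ) (k : Fin n) : Measurable (sampleTerm lam x e τ τ' k) :=
  (measurable_estimatorTerm lam).comp
    (((h.measurable_signal k).prodMk (h.measurable_noise k)).prodMk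
      ((hd.measurable_fst k).prodMk (hd.measurable_snd k)))

/-- The two sides are measurable functions of disjoint blocks of the independent family of signals,
noise vectors and dithers. -/
theorem indepFun_sum_sampleTerm (hd : RectangularDither lam x e τ τ' μ)
    (h : ObservationModel K ν x e Sx μ) (G : Fin n → Matrix (Fin p) (Fin p) 𝕜)
    (s : Finset (Fin n)) {a : Fin n} (ha : a ∉ s) :
    IndepFun (fun ω => ∑ k ∈ s, (sampleTerm lam x e τ τ' k ω - G k))
      (fun ω => sampleTerm lam x e τ τ' a ω - G a) μ := by
  classical
  let idx : (Fin n ⊕ Fin n) ⊕ (Fin n ⊕ Fin n) → Fin n := Sum.elim (Sum.elim id id) (Sum.elim id id)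
  let block : Finset (Fin n) → Finset ((Fin n ⊕ Fin n) ⊕ (Fin n ⊕ Fin n)) := fun r =>
    Finset.univ.filter fun i => idx i ∈ r
  -- Extension by zero lets the term of every index be written down; only indices in the block are
  -- evaluated.
  let extend : (r : Finset (Fin n)) → (block r → Fin p → 𝕜) →
      ((Fin n ⊕ Fin n) ⊕ (Fin n ⊕ Fin n)) → Fin p → 𝕜 := fun r z i =>
    if hi : i ∈ block r then z ⟨i, hi⟩ else 0
  let F : (r : Finset (Fin n)) → (block r → Fin p → 𝕜) → Matrix (Fin p) (Fin p) 𝕜 := fun r z =>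
    ∑ k ∈ r, (estimatorTerm lam ((extend r z (Sum.inl (Sum.inl k)),
      extend r z (Sum.inl (Sum.inr k))), (extend r z (Sum.inr (Sum.inl k)),
      extend r z (Sum.inr (Sum.inr k)))) - G k)
  have hext : ∀ r i, Measurable fun z => extend r z i := by
    intro r i
    by_cases hi : i ∈ block r
    · simp only [extend, dif_pos hi]
      exact measurable_pi_apply _
    · simp only [extend, dif_neg hi]
      exact measurable_const
  have hF : ∀ r, Measurable (F r) := fun r =>
    Finset.measurable_fun_sum _ fun k _ => ((measurable_estimatorTerm lam).comp
      (((hext r _).prodMk (hext r _)).prodMk ((hext r _).prodMk (hext r _)))).sub_const _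
  have hFeq : ∀ r ω, F r (fun i => Sum.elim (Sum.elim x e) (Sum.elim τ τ') i ω) =
      ∑ k ∈ r, (sampleTerm lam x e τ τ' k ω - G k) := by
    intro r ω
    refine Finset.sum_congr rfl fun k hk => ?_
    have hmem : ∀ i, idx i = k → i ∈ block r := fun i hi => by simp [block, hi, hk]
    simp only [extend]
    rw [dif_pos (hmem _ rfl), dif_pos (hmem _ rfl), dif_pos (hmem _ rfl), dif_pos (hmem _ rfl)]
    rfl
  have hdisj : Disjoint (block s) (block {a}) := by
    rw [Finset.disjoint_left]
    intro i hi hi'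
    simp only [block, Finset.mem_filter, Finset.mem_univ, true_and, Finset.mem_singleton] at hi hi'
    exact ha (hi' ▸ hi)
  have h1 := (hd.indep.indepFun_finset (block s) (block {a}) hdisj (hd.measurable_all h)).comp
    (hF s) (hF {a})
  have e1 : F s ∘ (fun ω (i : block s) => Sum.elim (Sum.elim x e) (Sum.elim τ τ') i ω) =
      fun ω => ∑ k ∈ s, (sampleTerm lam x e τ τ' k ω - G k) := funext (hFeq s)
  have e2 : F {a} ∘ (fun ω (i : block {a}) => Sum.elim (Sum.elim x e) (Sum.elim τ τ') i ω) =
      fun ω => sampleTerm lam x e τ τ' a ω - G a :=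
    funext fun ω => (hFeq {a} ω).trans (Finset.sum_singleton _ _)
  rw [e1, e2] at h1
  exact h1

/-- Concentration of the sum of the centred summands. -/
theorem measureReal_norm_sum_ge_le [IsProbabilityMeasure μ] [Nonempty (Fin p)] (hn : 1 ≤ n)
    (hlam : 0 < lam) (hd : RectangularDither lam x e τ τ' μ) (h : ObservationModel K ν x e Sx μ)
    {m : ℝ} (hm : ∀ k, ‖clippedMoment lam (observation x e k) μ‖ ≤ m) {L : ℝ} (hL : 0 < L) :
    μ.real {ω | 2 * √(n * (2 * p * lam ^ 2 * (m + 2 * lam ^ 2)) * L) +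
        2 * (p * (4 * lam ^ 2)) * L ≤
        ‖∑ k, (sampleTerm lam x e τ τ' k ω - clippedMoment lam (observation x e k) μ)‖} ≤
      2 * p * Real.exp (-L) := by
  have hp : (0 : ℝ) < p := by exact_mod_cast Fin.pos_iff_nonempty.2 ‹_›
  have hm0 : 0 ≤ m := (norm_nonneg _).trans (hm ⟨0, hn⟩)
  have hb := matrix_bernstein (μ := μ) hn
    (X := fun k ω => sampleTerm lam x e τ τ' k ω - clippedMoment lam (observation x e k) μ)
    (fun k => (hd.measurable_sampleTerm h k).sub_const _)
    (fun k ω => (symQuantized_isHermitian _ _ _).sub (clippedMoment_isHermitian _ _ _))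
    (fun s a ha => hd.indepFun_sum_sampleTerm h
      (fun k => clippedMoment lam (observation x e k) μ) s ha)
    (R := p * (4 * lam ^ 2)) (V := 2 * p * lam ^ 2 * (m + 2 * lam ^ 2)) (by positivity)
    (by positivity) ?_ ?_ ?_ hL
  · rwa [Fintype.card_fin] at hb
  · intro k ω
    refine norm_le_of_entry_le (by positivity) fun i j => ?_
    rw [Matrix.sub_apply]
    refine (norm_sub_le _ _).trans ?_
    linarith [norm_symQuantized_le lam (observation x e k ω) (τ k ω) (τ' k ω) i j,
      norm_clippedMoment_le (y := observation x e k) (μ := μ) hlam i j,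
      congrArg (fun A => ‖A i j‖) (sampleTerm_eq (lam := lam) (x := x) (e := e) (τ := τ) (τ' := τ')
        k ω)]
  · intro k i j
    have h1 := (hd.isDithered h k).integral_symQuantized hlam i j
    have h2 : Integrable (fun ω => sampleTerm lam x e τ τ' k ω i j) μ :=
      Integrable.of_bound (measurable_matrix_iff.1 (hd.measurable_sampleTerm h k) i
        j).aestronglyMeasurable (2 * lam ^ 2)
        (ae_of_all _ fun ω => norm_symQuantized_le _ _ _ _ _ _)
    simp only [Matrix.sub_apply]
    rw [integral_sub h2 (integrable_const _), integral_const, probReal_univ, one_smul, sub_eq_zero]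
    exact h1
  · intro k w
    refine ((hd.isDithered h k).integral_norm_sq_symQuantized_sub_le hlam w).trans ?_
    gcongr
    exact hm k

end RectangularDither

/-- The error splits into the averaged fluctuation around the clipped moments and the averaged
truncation bias. -/
theorem opNorm_symEstimator_sub_le [IsProbabilityMeasure μ] (hn : 1 ≤ n)
    (h : ObservationModel K ν x e Sx μ) {u b : ℝ} {ω : Ω}
    (hu : ‖∑ k, (sampleTerm lam x e τ τ' k ω - clippedMoment lam (observation x e k) μ)‖ ≤ u)
    (hb : ∀ k, ‖clippedMoment lam (observation x e k) μ - secondMoment (observation x e k) μ‖ ≤ b) :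
    opNorm (symEstimator lam (observation x e) τ τ' ω -
      (Sx + ((ν ^ 2 : ℝ) : 𝕜) • (1 : Matrix (Fin p) (Fin p) 𝕜))) ≤ u / n + b := by
  change ‖symEstimator lam (observation x e) τ τ' ω -
      (Sx + ((ν ^ 2 : ℝ) : 𝕜) • (1 : Matrix (Fin p) (Fin p) 𝕜))‖ ≤ u / n + b
  have hn0 : (0 : ℝ) < n := by exact_mod_cast hn
  rw [← h.average_secondMoment_observation hn, symEstimator_eq_sum, ← smul_sub,
    ← Finset.sum_sub_distrib, norm_smul, norm_inv, RCLike.norm_natCast]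
  have h1 : ∑ k, (sampleTerm lam x e τ τ' k ω - secondMoment (observation x e k) μ) =
      ∑ k, (sampleTerm lam x e τ τ' k ω - clippedMoment lam (observation x e k) μ) +
      ∑ k, (clippedMoment lam (observation x e k) μ - secondMoment (observation x e k) μ) := by
    rw [← Finset.sum_add_distrib]
    simp only [sub_add_sub_cancel]
  have h2 : ‖∑ k, (clippedMoment lam (observation x e k) μ -
      secondMoment (observation x e k) μ)‖ ≤ n * b := by
    refine (norm_sum_le_of_le _ fun k _ => hb k).trans_eq ?_
    rw [Finset.sum_const, Finset.card_univ, Fintype.card_fin, nsmul_eq_mul]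
  rw [h1, inv_mul_le_iff₀ hn0]
  refine (norm_add_le_of_le hu h2).trans_eq ?_
  field_simp

/-- The arithmetic behind the error bound. -/
theorem deviation_le {n p lam c t L ℓ : ℝ} (hn : 0 < n) (hp : 0 < p) (hlam : 0 < lam) (hc : 0 ≤ c)
    (ht : 0 ≤ t) (hℓ : 1 / 2 ≤ ℓ) (hL0 : 0 ≤ L) (hL : L ≤ 2 * (ℓ + t)) :
    2 * ((2 * √(n * (2 * p * lam ^ 2 * ((c + 20 * p * lam ^ 2 / n) + 2 * lam ^ 2)) * L) +
        2 * (p * (4 * lam ^ 2)) * L) / n + 20 * p * lam ^ 2 / n) ≤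
      168 * (lam * (√c + lam)) * √(p * (ℓ + t) / n) + 168 * lam ^ 2 * (p * (ℓ + t) / n) := by
  set Q := p * (ℓ + t) / n with hQ
  have hQ0 : 0 ≤ Q := by have : 0 ≤ ℓ := by linarith
                         positivity
  have hpL : p * L / n ≤ 2 * Q := by
    rw [hQ, ← mul_div_assoc, mul_left_comm]
    exact div_le_div_of_nonneg_right (mul_le_mul_of_nonneg_left hL hp.le) hn.le
  -- Since `ℓ ≥ 1 / 2`, the bias of order `p / n` is absorbed by the linear term.
  have hpn : p / n ≤ 2 * Q := by
    rw [hQ, ← mul_div_assoc, mul_left_comm]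
    exact div_le_div_of_nonneg_right (le_mul_of_one_le_right hp.le (by linarith)) hn.le
  have hpn0 : 0 ≤ p / n := by positivity
  have hpL0 : 0 ≤ p * L / n := by positivity
  have hr := Real.sq_sqrt hQ0
  have hr0 := Real.sqrt_nonneg Q
  have hd := Real.sq_sqrt hc
  have hd0 := Real.sqrt_nonneg c
  set r := √Q
  set d := √c
  -- The bias inside the variance contributes `160 * lam⁴ * r⁴`, covered by `14² = 196`. In the end
  -- `lam² * Q` has the coefficient `2 * (28 + 16 + 40) = 168`: variance, linear Bernstein term,
  -- bias.
  have hsq : √(n * (2 * p * lam ^ 2 * ((c + 20 * p * lam ^ 2 / n) + 2 * lam ^ 2)) * L) ≤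
      n * (4 * lam * (d + lam) * r + 14 * lam ^ 2 * r ^ 2) := by
    refine Real.sqrt_le_iff.2 ⟨by positivity, ?_⟩
    have e1 : n * (2 * p * lam ^ 2 * ((c + 20 * p * lam ^ 2 / n) + 2 * lam ^ 2)) * L =
        n ^ 2 * (2 * lam ^ 2 * (c + 20 * lam ^ 2 * (p / n) + 2 * lam ^ 2) * (p * L / n)) := by
      field_simp
    rw [e1, mul_pow]
    refine mul_le_mul_of_nonneg_left ?_ (by positivity)
    calc 2 * lam ^ 2 * (c + 20 * lam ^ 2 * (p / n) + 2 * lam ^ 2) * (p * L / n)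
        ≤ 2 * lam ^ 2 * (c + 20 * lam ^ 2 * (2 * Q) + 2 * lam ^ 2) * (2 * Q) := by gcongr
      _ = lam ^ 2 * r ^ 2 * (4 * d ^ 2 + 8 * lam ^ 2 + 160 * lam ^ 2 * r ^ 2) := by
          rw [hr, hd]; ring
      _ ≤ lam ^ 2 * r ^ 2 * (4 * (d + lam) + 14 * lam * r) ^ 2 := by
          refine mul_le_mul_of_nonneg_left ?_ (by positivity)
          have h1 : 0 ≤ d * lam := by positivity
          have h2 : 0 ≤ d * (lam * r) := by positivity
          have h3 : 0 ≤ lam * (lam * r) := by positivity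
          nlinarith [sq_nonneg d, sq_nonneg lam, sq_nonneg (lam * r)]
      _ = _ := by ring
  have e2 : 2 * (p * (4 * lam ^ 2)) * L / n = 8 * lam ^ 2 * (p * L / n) := by ring
  have e3 : 20 * p * lam ^ 2 / n = 20 * lam ^ 2 * (p / n) := by ring
  have h1 : 2 * √(n * (2 * p * lam ^ 2 * ((c + 20 * p * lam ^ 2 / n) + 2 * lam ^ 2)) * L) / n ≤
      2 * (4 * lam * (d + lam) * r + 14 * lam ^ 2 * r ^ 2) := by
    rw [div_le_iff₀ hn]; linarith
  have h2 : 8 * lam ^ 2 * (p * L / n) ≤ 8 * lam ^ 2 * (2 * Q) := by gcongr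
  have h3 : 20 * lam ^ 2 * (p / n) ≤ 20 * lam ^ 2 * (2 * Q) := by gcongr
  have h4 : 0 ≤ lam * (d + lam) * r := by positivity
  rw [add_div, e2]
  rw [e3] at h1 ⊢
  rw [hr] at h1
  linarith

theorem Cop_nonneg (y : Fin n → Ω → Fin p → 𝕜) (μ : Measure Ω) : 0 ≤ Cop y μ :=
  Real.iSup_nonneg fun _ => norm_nonneg _

end Estimator

/-! ### The main theorem -/

theorem theorem1 (K : ℝ) (hK : 0 < K) :
    ∃ B C : ℝ, 0 < B ∧ 0 < C ∧
      ∀ (𝕜 : Type*) [RCLike 𝕜] (Ω : Type*) [MeasurableSpace Ω] (μ : Measure Ω)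
        [IsProbabilityMeasure μ] (n p s : ℕ) (ν lam t : ℝ)
        (x e τ τ' : Fin n → Ω → Fin p → 𝕜) (Sx : Matrix (Fin p) (Fin p) 𝕜)
        (U : Matrix (Fin p) (Fin s) 𝕜),
        1 ≤ n → 1 ≤ s → s < p → 0 < lam → 0 ≤ t →
        ObservationModel K ν x e Sx μ →
        RectangularDither lam x e τ τ' μ →
        eigval Sx (s + 1) < eigval Sx s →
        IsLeadingBasis Sx U →
        ((2 ≤ n ∧ B * Real.log n * Cinf (observation x e) μ ≤ lam ^ 2) ∨
          (∀ k, ∀ᵐ ω ∂μ, ∀ i, ‖observation x e k ω i‖ ≤ lam)) →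
        ENNReal.ofReal (1 - Real.exp (-t)) ≤
          μ {ω | ∀ U' : Matrix (Fin p) (Fin s) 𝕜,
            IsLeadingBasis (symEstimator lam (observation x e) τ τ' ω) U' →
              sinThetaDist U' U ≤
                errorBound C (Cop (observation x e) μ) lam
                  (eigval Sx s - eigval Sx (s + 1)) n p t} := by
  refine ⟨17 * (K ^ 2 + 1), 168, by positivity, by norm_num, ?_⟩
  intro 𝕜 _ Ω _ μ _ n p s ν lam t x e τ τ' Sx U hn hs hsp hlam ht hobs hd hgap hU hcase
  have hn0 : (0 : ℝ) < n := by exact_mod_cast hn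
  have hp2 : (2 : ℝ) ≤ p := by exact_mod_cast (by omega : 2 ≤ p)
  have hp0 : (0 : ℝ) < p := by linarith
  have : Nonempty (Fin p) := ⟨⟨0, by omega⟩⟩
  have hlog2 : 1 / 2 ≤ Real.log 2 := by linarith [Real.log_two_gt_d9]
  have hlogp : Real.log 2 ≤ Real.log p := Real.log_le_log two_pos hp2
  set c := Cop (observation x e) μ with hc
  have hbias : ∀ k, opNorm (clippedMoment lam (observation x e k) μ -
      secondMoment (observation x e k) μ) ≤ 20 * p * lam ^ 2 / n := by
    intro k
    refine (norm_le_of_entry_le (m := 4 * (5 * lam ^ 2 / n)) (by positivity) fun i j =>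
      norm_clippedMoment_sub_secondMoment_le hlam (hobs.measurable_observation k)
        (hobs.memLp_observation k)
        (fun i => hobs.integral_excess_observation_le hlam hcase k i) i j).trans_eq ?_
    ring
  have hclip : ∀ k, opNorm (clippedMoment lam (observation x e k) μ) ≤
      c + 20 * p * lam ^ 2 / n := by
    intro k
    have h1 : opNorm (clippedMoment lam (observation x e k) μ) ≤
        opNorm (secondMoment (observation x e k) μ) +
          opNorm (clippedMoment lam (observation x e k) μ -
            secondMoment (observation x e k) μ) := by
      unfold opNorm
      rw [map_sub]
      exact norm_le_norm_add_norm_sub' _ _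
    linarith [hbias k, opNorm_secondMoment_le_Cop (μ := μ) (observation x e) k]
  -- Chosen so that the Bernstein tail `2 * p * exp (-L)` is `exp (-t)`; as `p ≥ 2`, also `L ≤ 2 *
  -- (log p + t)`.
  set L := Real.log (2 * p) + t with hL
  have hlog2p : Real.log (2 * p) = Real.log 2 + Real.log p :=
    Real.log_mul two_ne_zero hp0.ne'
  have hL0 : 0 < L := by linarith
  have htail := hd.measureReal_norm_sum_ge_le hn hlam hobs (m := c + 20 * p * lam ^ 2 / n) hclip hL0
  have hexp : 2 * p * Real.exp (-L) = Real.exp (-t) := by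
    rw [hL, neg_add, Real.exp_add, Real.exp_neg, Real.exp_log (by positivity), ← mul_assoc,
      mul_inv_cancel₀ (by positivity), one_mul]
  rw [hexp] at htail
  set u := 2 * √(n * (2 * p * lam ^ 2 * ((c + 20 * p * lam ^ 2 / n) + 2 * lam ^ 2)) * L) +
        2 * (p * (4 * lam ^ 2)) * L with hu
  set bad := {ω | u ≤ opNorm (∑ k, (sampleTerm lam x e τ τ' k ω -
    clippedMoment lam (observation x e k) μ))} with hbad
  have hbadle : μ bad ≤ ENNReal.ofReal (Real.exp (-t)) :=
    (ENNReal.le_ofReal_iff_toReal_le (measure_ne_top _ _) (Real.exp_pos _).le).2 htail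
  have hSx := hobs.isHermitian_covariance hn
  have heig1 := eigval_add_smul_one hSx (ν ^ 2) ⟨s, hsp⟩
  have heig2 := eigval_add_smul_one hSx (ν ^ 2) ⟨s - 1, by omega⟩
  simp only [Nat.sub_add_cancel hs] at heig1 heig2
  have hsub : badᶜ ⊆ {ω | ∀ U' : Matrix (Fin p) (Fin s) 𝕜,
            IsLeadingBasis (symEstimator lam (observation x e) τ τ' ω) U' →
              sinThetaDist U' U ≤
                errorBound 168 c lam (eigval Sx s - eigval Sx (s + 1)) n p t} := by
    intro ω hω U' hU'
    have hω' := opNorm_symEstimator_sub_le (τ := τ) (τ' := τ') hn hobs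
      (le_of_not_ge fun hle => hω hle) hbias
    have hH : (symEstimator lam (observation x e) τ τ' ω).IsHermitian := by
      rw [symEstimator_eq_sum]
      refine IsSelfAdjoint.smul ?_ (sum_mem (S := selfAdjoint (Matrix (Fin p) (Fin p) 𝕜))
        fun k _ => symQuantized_isHermitian _ _ _)
      rw [isSelfAdjoint_iff, star_inv₀, star_natCast]
    have h1 := sinThetaDist_le (isHermitian_add_smul_one hSx (ν ^ 2)) hH
      (hU.add_smul_one hSx hsp.le (ν ^ 2)) hU' hs hsp (by rw [heig1, heig2]; linarith) hω'
    rw [heig1, heig2, add_sub_add_right_eq_sub] at h1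
    refine h1.trans (min_le_min le_rfl ?_)
    have h2 := deviation_le hn0 hp0 hlam (Cop_nonneg (observation x e) μ) ht (hlog2.trans hlogp)
      hL0.le (L := L) (by linarith)
    refine (div_le_div_of_nonneg_right h2 (sub_pos.2 hgap).le).trans_eq ?_
    rw [hc]
    ring
  refine le_trans ?_ (measure_mono hsub)
  -- Subadditivity suffices here, so neither the bad event nor the event of the theorem has to be
  -- shown measurable.
  have h1 : (1 : ENNReal) ≤ μ bad + μ badᶜ := by
    rw [← measure_univ (μ := μ), ← Set.union_compl_self bad]
    exact measure_union_le _ _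
  rw [ENNReal.ofReal_sub _ (Real.exp_pos _).le, ENNReal.ofReal_one, tsub_le_iff_left]
  exact h1.trans (by gcongr)
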